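/- Let $\Sigma$ be an alphabet with $|\Sigma|=q\ge 2$. For $R\in[0,1]$, a random code of block length $n$ and (expected) rate $R$ is a random set $C\subseteq\Sigma^n$ which contains each word of $\Sigma^n$ independently with probability $q^{-n(1-R)}$. Let $p\in[0,1]$, $1\le\ell\le q$ and $L\ge 1$. A code $C\subseteq\Sigma^n$ is $(p,\ell,L)$-list-recoverable if there are no $L$ distinct words $c^{(1)},\dots,c^{(L)}\in C$ and sets $K_1,\dots,K_n\subseteq\Sigma$ of size $\ell$ such that $|\{i\in[n] : c^{(j)}_i\notin K_i\}|\le pn$ for every $1\le j\le L$. For $R\in[0,1]$ let $\pi_n(R)$ be the probability that a random code of block length $n$ and rate $R$ is not $(p,\ell,L)$-list-recoverable, and let $R_n=\sup\{R\in[0,1] : \pi_n(R)\le\tfrac12\}$ (with $R_n=0$ if there is no such $R$). The threshold rate for $(p,\ell,L)$-list-recovery is the number $R^*\in[0,1]$ such that $R_n\to R^*$ as $n\to\infty$, $\pi_n(R)\to 0$ for every $R\in[0,1]$ with $R<R^*$, and $\pi_n(R)\to 1$ for every $R\in[0,1]$ with $R>R^*$. **Theorem.** There is a single algorithm on a real random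 access machine (unit-cost $+,-,\times,/$ and comparison of real numbers; unit-cost addition, truncated subtraction and comparison of natural numbers, which also serve as computed memory addresses; conversion from natural to real numbers, but no rounding, logarithm or exponential; no constants in the program other than natural numbers) that, given $q\ge 2$, $1\le\ell\le q$, $L\ge 1$, $p\in[0,1]$ and $\varepsilon>0$, outputs a real number $r$ with $|r-R^*|\le\varepsilon$, where $R^*$ is the threshold rate for $(p,\ell,L)$-list-recovery over an alphabet of size $q$ (which exists). Its running time is $$O\Big((L+1)^q+\mathrm{poly}\big(q,\,L,\,\log\tfrac1\varepsilon,\,\beta(p)\big)\Big),\qquad \beta(p)=\begin{cases}\log\frac1p & p>0,\\ 1 & p=0,\end{cases}$$ where the implied constant and the polynomial are absolute, $\log=\log_2$, and $\log\frac1\varepsilon$ is replaced by $0$ if $\varepsilon>1$. -/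

import Mathlib

/-! ### Random codes, list-recovery and threshold rates -/

namespace ListRecovery

open ProbabilityTheory Filter Topology unitInterval

/-- A code of block length `n` over the alphabet `Fin q`. -/
abbrev Code (q n : ℕ) : Type := Set (Fin n → Fin q)

/-- A property of codes over `Fin q`, for every block length. -/
abbrev CodeProperty (q : ℕ) : Type := ∀ n : ℕ, Code q n → Prop

theorem rpow_mem_unitInterval (q n : ℕ) (R : I) :
    (q : ℝ) ^ (-((n : ℝ) * (1 - (R : ℝ)))) ∈ I := by
  have hx : 0 ≤ (n : ℝ) * (1 - (R : ℝ)) := mul_nonneg (Nat.cast_nonneg n) (sub_nonneg.2 R.2.2)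
  refine ⟨Real.rpow_nonneg (Nat.cast_nonneg q) _, ?_⟩
  rcases Nat.eq_zero_or_pos q with rfl | hq
  · simpa using Real.zero_rpow_le_one _
  · exact Real.rpow_le_one_of_one_le_of_nonpos (by exact_mod_cast hq) (by linarith)

/-- The probability `q ^ (-n (1 - R))` with which a word belongs to the random code. -/
noncomputable def inclusionProb (q n : ℕ) (R : I) : I :=
  ⟨(q : ℝ) ^ (-((n : ℝ) * (1 - (R : ℝ)))), rpow_mem_unitInterval q n R⟩

/-- The probability that the random code of block length `n` and expected rate `R`, which contains
each word independently with probability `q ^ (-n (1 - R))`, satisfies the property `P`. -/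
noncomputable def probSatisfies {q : ℕ} (P : CodeProperty q) (n : ℕ) (R : I) : ℝ :=
  (setBernoulli (Set.univ : Set (Fin n → Fin q)) (inclusionProb q n R)).real {C | P n C}

/-- The threshold rate of `P` at block length `n`: the supremum of the rates `R ∈ [0, 1]` at which
the random code satisfies `P` with probability at most `1 / 2`, and `0` if there is no such rate
(the supremum of the empty set of reals is `0`). -/
noncomputable def thresholdRateAt {q : ℕ} (P : CodeProperty q) (n : ℕ) : ℝ :=
  sSup ((fun R : I => (R : ℝ)) '' {R : I | probSatisfies P n R ≤ 1 / 2})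

/-- `Rstar` is the (asymptotic) threshold rate of `P`: it is the limit of the threshold rates at
block length `n`, and random codes of smaller rate satisfy `P` with probability `o(1)`, while random
codes of larger rate satisfy it with probability `1 - o(1)`. -/
structure IsThresholdRate {q : ℕ} (P : CodeProperty q) (Rstar : ℝ) : Prop where
  mem : Rstar ∈ Set.Icc (0 : ℝ) 1
  tendsto : Tendsto (fun n => thresholdRateAt P n) atTop (𝓝 Rstar)
  below : ∀ R : I, (R : ℝ) < Rstar → Tendsto (fun n => probSatisfies P n R) atTop (𝓝 0)
  above : ∀ R : I, Rstar < (R : ℝ) → Tendsto (fun n => probSatisfies P n R) atTop (𝓝 1)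

/-- The matrix with the distinct columns `B 0, …, B (L - 1)` of length `n` is bad for
`(p, ℓ, L)`-list-recovery: for some sets `K i` of `ℓ` symbols, every column has at most a fraction
`p` of its coordinates `i` outside `K i`. -/
def IsBadMatrix {q n : ℕ} (p : ℝ) (ℓ L : ℕ) (B : Fin L → Fin n → Fin q) : Prop :=
  Function.Injective B ∧
    ∃ K : Fin n → Finset (Fin q), (∀ i, (K i).card = ℓ) ∧
      ∀ j : Fin L, ((Finset.univ.filter fun i : Fin n => B j i ∉ K i).card : ℝ) ≤ p * n

/-- A code is `(p, ℓ, L)`-list-recoverable if it contains no bad matrix. -/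
def IsListRecoverable {q n : ℕ} (p : ℝ) (ℓ L : ℕ) (C : Code q n) : Prop :=
  ¬ ∃ B : Fin L → Fin n → Fin q, IsBadMatrix p ℓ L B ∧ ∀ j, B j ∈ C

/-- The property of not being `(p, ℓ, L)`-list-recoverable, whose threshold rate is the threshold
rate for `(p, ℓ, L)`-list-recovery. -/
def NotListRecoverable (q : ℕ) (p : ℝ) (ℓ L : ℕ) : CodeProperty q :=
  fun _ C => ¬ IsListRecoverable p ℓ L C

/-- `log (1 / p)` if `p > 0`, and `1` if `p = 0`. -/
noncomputable def logInv (p : ℝ) : ℝ :=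
  if p = 0 then 1 else Real.logb 2 (1 / p)

end ListRecovery

/-! ### The real random access machine

The memory consists of natural-number cells and of real cells, both indexed by `ℕ`. Programs are
built from assignments by sequencing, branching and loops. Natural numbers (which serve as addresses
and counters) can be added, subtracted (truncated at `0`) and compared; real numbers can be added,
subtracted, multiplied, divided and compared. Natural numbers can be converted to real numbers but
not conversely, and only natural-number constants may occur in a program. Addresses may be
computed. Every constant, memory access, arithmetic operation, conversion, comparison and
assignment takes one unit of time. -/

namespace RealRAM

/-- The contents of the memory. -/
structure Store where
  nat : ℕ → ℕ
  real : ℕ → ℝ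

inductive NatExpr : Type
  | const (c : ℕ)
  | cell (addr : NatExpr)
  | add (a b : NatExpr)
  | sub (a b : NatExpr)

inductive RealExpr : Type
  | ofNat (a : NatExpr)
  | cell (addr : NatExpr)
  | add (x y : RealExpr)
  | sub (x y : RealExpr)
  | mul (x y : RealExpr)
  | div (x y : RealExpr)

inductive Test : Type
  | natLt (a b : NatExpr)
  | natLe (a b : NatExpr)
  | realLt (x y : RealExpr)
  | realLe (x y : RealExpr)

inductive Program : Type
  | skip
  | setNat (addr e : NatExpr)
  | setReal (addr : NatExpr) (e : RealExpr)
  | seq (P Q : Program)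
  | ite (b : Test) (P Q : Program)
  | loop (b : Test) (P : Program)

def NatExpr.eval (s : Store) : NatExpr → ℕ
  | .const c => c
  | .cell a => s.nat (a.eval s)
  | .add a b => a.eval s + b.eval s
  | .sub a b => a.eval s - b.eval s

def NatExpr.cost : NatExpr → ℕ
  | .const _ => 1
  | .cell a => a.cost + 1
  | .add a b => a.cost + b.cost + 1
  | .sub a b => a.cost + b.cost + 1

/-- A division by `0` yields `0`. -/
noncomputable def RealExpr.eval (s : Store) : RealExpr → ℝ
  | .ofNat a => (a.eval s : ℝ)
  | .cell a => s.real (a.eval s)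
  | .add x y => x.eval s + y.eval s
  | .sub x y => x.eval s - y.eval s
  | .mul x y => x.eval s * y.eval s
  | .div x y => x.eval s / y.eval s

def RealExpr.cost : RealExpr → ℕ
  | .ofNat a => a.cost + 1
  | .cell a => a.cost + 1
  | .add x y => x.cost + y.cost + 1
  | .sub x y => x.cost + y.cost + 1
  | .mul x y => x.cost + y.cost + 1
  | .div x y => x.cost + y.cost + 1

def Test.Holds (s : Store) : Test → Prop
  | .natLt a b => a.eval s < b.eval s
  | .natLe a b => a.eval s ≤ b.eval s
  | .realLt x y => x.eval s < y.eval s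
  | .realLe x y => x.eval s ≤ y.eval s

def Test.cost : Test → ℕ
  | .natLt a b => a.cost + b.cost + 1
  | .natLe a b => a.cost + b.cost + 1
  | .realLt x y => x.cost + y.cost + 1
  | .realLe x y => x.cost + y.cost + 1

/-- `Exec P s t s'`: the program `P`, started with memory `s`, halts after exactly `t` steps with
memory `s'`. In `loop b P` the body `P` is repeated as long as the test `b` holds. -/
inductive Exec : Program → Store → ℕ → Store → Prop
  | skip (s : Store) : Exec .skip s 1 s
  | setNat (s : Store) (addr e : NatExpr) :
      Exec (.setNat addr e) s (addr.cost + e.cost + 1)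
        ⟨Function.update s.nat (addr.eval s) (e.eval s), s.real⟩
  | setReal (s : Store) (addr : NatExpr) (e : RealExpr) :
      Exec (.setReal addr e) s (addr.cost + e.cost + 1)
        ⟨s.nat, Function.update s.real (addr.eval s) (e.eval s)⟩
  | seq {P Q : Program} {s s' s'' : Store} {t t' : ℕ} :
      Exec P s t s' → Exec Q s' t' s'' → Exec (.seq P Q) s (t + t') s''
  | ite_true {b : Test} {P Q : Program} {s s' : Store} {t : ℕ} :
      b.Holds s → Exec P s t s' → Exec (.ite b P Q) s (b.cost + t) s'
  | ite_false {b : Test} {P Q : Program} {s s' : Store} {t : ℕ} :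
      ¬ b.Holds s → Exec Q s t s' → Exec (.ite b P Q) s (b.cost + t) s'
  | loop_done {b : Test} {P : Program} {s : Store} :
      ¬ b.Holds s → Exec (.loop b P) s b.cost s
  | loop_step {b : Test} {P : Program} {s s' s'' : Store} {t t' : ℕ} :
      b.Holds s → Exec P s t s' → Exec (.loop b P) s' t' s'' →
        Exec (.loop b P) s (b.cost + t + t') s''

/-- The initial memory: the input numbers `q, ℓ, L` are in the first natural-number cells, the input
reals `p, ε` in the first real cells, and all other cells are `0`. -/
def input (q ℓ L : ℕ) (p ε : ℝ) : Store where
  nat := fun i => if i = 0 then q else if i = 1 then ℓ else if i = 2 then L else 0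
  real := fun i => if i = 0 then p else if i = 1 then ε else 0

/-- The output of a computation is the content of the first real cell. -/
def Store.output (s : Store) : ℝ := s.real 0

end RealRAM

/-! For a row u of a matrix with L columns let d(u) be the least number of letters of u outside a
set of ℓ symbols, and put Z(x) = Σ x^d(u), D(x) = Σ d(u) x^d(u), summed over all q^L rows. For p > 0
let x in (0, 1] solve the saddle point equation D(x) = p L Z(x), or let x = 1 if D(1) ≤ p L Z(1).
Then H = log Z(x) - p L log x is the entropy of the Gibbs distribution on rows with weights x^d(u),
and the threshold rate is 1 - H / (L log q) (`isThresholdRate_notListRecoverable`).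

Below this rate the first moment suffices: the rows of a bad matrix have total deficit at most p L
n, so a Chernoff bound leaves at most exp(H n) bad matrices, and each lies in the code with
probability q^(-n L (1 - R)). Above it the second moment method is applied to matrices with
independent rows of nearly Gibbs distribution, restricted to typical ones (`prob_avoids_mul_le`,
`eventually_le_probSatisfies`). Two such matrices that share the columns in S contribute a term
governed by the entropy of the letters in S. The Gibbs distribution is exchangeable, so Han's
inequality, which follows from strong subadditivity, bounds this entropy below by |S| H / L. Hence
every overlap is exponentially negligible. For p = 0 the same argument works with x = 0, except that
no bad matrix exists if ℓ = 1 < L; the threshold rate is then 1.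

To evaluate the formula, group the rows by deficit. The deficit depends only on the histogram, and
if v is the ℓ-th largest multiplicity, then d + ℓ v = Σ min(h_a, v). For each v a power of a
generating function whose exponents record Σ h_a, Σ min(h_a, v) and the numbers of symbols above and
below v therefore yields the counts (`deficitCount_eq_sum`); the table has polynomial size.
Bisection then finds x up to a factor 1 + ε / 4, the rate is Lipschitz in log x (`abs_rate_sub_le`),
and logarithms are computed digit by digit by repeated squaring. All loops make polynomially many
iterations, so the running time is polynomial even without the term (L + 1)^q. -/

namespace RealRAM

/-! ### Running times and proof rules for programs -/

/-- A bound for the running time of a program all of whose loops make at most `Y` iterations. -/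
def Program.bound (Y : ℕ) : Program → ℕ
  | .skip => 1
  | .setNat a e => a.cost + e.cost + 1
  | .setReal a e => a.cost + e.cost + 1
  | .seq P Q => P.bound Y + Q.bound Y
  | .ite b P Q => b.cost + (P.bound Y + Q.bound Y)
  | .loop b P => Y * (b.cost + P.bound Y) + b.cost

/-- A program is fixed and its expressions have constant cost, so each level of loops costs one more
factor `Y`. It remains only to estimate the largest number of iterations of any loop. -/
theorem Program.bound_le_pow (P : Program) :
    ∃ c k : ℕ, ∀ Y, P.bound Y ≤ c * (Y + 1) ^ k := by
  induction P with
  | skip => exact ⟨1, 0, fun Y => by simp [Program.bound]⟩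
  | setNat a e => exact ⟨a.cost + e.cost + 1, 0, fun Y => by simp [Program.bound]⟩
  | setReal a e => exact ⟨a.cost + e.cost + 1, 0, fun Y => by simp [Program.bound]⟩
  | seq P Q hP hQ =>
    obtain ⟨c, k, h⟩ := hP
    obtain ⟨c', k', h'⟩ := hQ
    refine ⟨c + c', k + k', fun Y => ?_⟩
    have h1 : (Y + 1) ^ k ≤ (Y + 1) ^ (k + k') := Nat.pow_le_pow_right (by omega) (by omega)
    have h2 : (Y + 1) ^ k' ≤ (Y + 1) ^ (k + k') := Nat.pow_le_pow_right (by omega) (by omega)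
    calc P.bound Y + Q.bound Y ≤ c * (Y + 1) ^ k + c' * (Y + 1) ^ k' := add_le_add (h Y) (h' Y)
      _ ≤ c * (Y + 1) ^ (k + k') + c' * (Y + 1) ^ (k + k') := by gcongr
      _ = _ := by ring
  | ite b P Q hP hQ =>
    obtain ⟨c, k, h⟩ := hP
    obtain ⟨c', k', h'⟩ := hQ
    refine ⟨b.cost + c + c', k + k', fun Y => ?_⟩
    have h1 : (Y + 1) ^ k ≤ (Y + 1) ^ (k + k') := Nat.pow_le_pow_right (by omega) (by omega)
    have h2 : (Y + 1) ^ k' ≤ (Y + 1) ^ (k + k') := Nat.pow_le_pow_right (by omega) (by omega)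
    have h3 : 1 ≤ (Y + 1) ^ (k + k') := Nat.one_le_pow _ _ (by omega)
    calc b.cost + (P.bound Y + Q.bound Y)
        ≤ b.cost * 1 + (c * (Y + 1) ^ k + c' * (Y + 1) ^ k') := by
          rw [mul_one]; exact Nat.add_le_add_left (add_le_add (h Y) (h' Y)) _
      _ ≤ b.cost * (Y + 1) ^ (k + k')
          + (c * (Y + 1) ^ (k + k') + c' * (Y + 1) ^ (k + k')) := by gcongr
      _ = _ := by ring
  | loop b P hP =>
    obtain ⟨c, k, h⟩ := hP
    refine ⟨b.cost + c, k + 1, fun Y => ?_⟩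
    have h3 : 1 ≤ (Y + 1) ^ k := Nat.one_le_pow _ _ (by omega)
    calc Y * (b.cost + P.bound Y) + b.cost
        ≤ Y * (b.cost * 1 + c * (Y + 1) ^ k) + b.cost * 1 := by
          rw [mul_one]; gcongr; exact h Y
      _ ≤ Y * (b.cost * (Y + 1) ^ k + c * (Y + 1) ^ k)
          + (b.cost * (Y + 1) ^ k + c * (Y + 1) ^ k) := by
          gcongr
          exact le_trans (Nat.mul_le_mul_left _ h3) (Nat.le_add_right _ _)
      _ = _ := by ring

/-- `P`, started in `s`, halts with a memory satisfying `Q`, within the time that it takes if all of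
its loops make at most `Y` iterations. -/
def Ends (Y : ℕ) (P : Program) (Q : Store → Prop) (s : Store) : Prop :=
  ∃ t s', Exec P s t s' ∧ t ≤ P.bound Y ∧ Q s'

variable {Y : ℕ}

theorem Ends.mono {P : Program} {Q Q' : Store → Prop} {s : Store} (h : Ends Y P Q s)
    (hQ : ∀ s', Q s' → Q' s') : Ends Y P Q' s := by
  obtain ⟨t, s', h1, h2, h3⟩ := h
  exact ⟨t, s', h1, h2, hQ _ h3⟩

theorem ends_skip {Q : Store → Prop} {s : Store} (h : Q s) : Ends Y .skip Q s :=
  ⟨1, s, .skip s, le_rfl, h⟩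

theorem ends_setNat {a e : NatExpr} {Q : Store → Prop} {s : Store}
    (h : Q ⟨Function.update s.nat (a.eval s) (e.eval s), s.real⟩) : Ends Y (.setNat a e) Q s :=
  ⟨_, _, .setNat s a e, le_rfl, h⟩

theorem ends_setReal {a : NatExpr} {e : RealExpr} {Q : Store → Prop} {s : Store}
    (h : Q ⟨s.nat, Function.update s.real (a.eval s) (e.eval s)⟩) : Ends Y (.setReal a e) Q s :=
  ⟨_, _, .setReal s a e, le_rfl, h⟩

theorem ends_seq {P P' : Program} {Q : Store → Prop} {s : Store}
    (h : Ends Y P (Ends Y P' Q) s) : Ends Y (.seq P P') Q s := by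
  obtain ⟨t, s', h1, h2, t', s'', h3, h4, h5⟩ := h
  exact ⟨t + t', s'', .seq h1 h3, add_le_add h2 h4, h5⟩

theorem ends_ite {b : Test} {P P' : Program} {Q : Store → Prop} {s : Store}
    (h : b.Holds s → Ends Y P Q s) (h' : ¬ b.Holds s → Ends Y P' Q s) :
    Ends Y (.ite b P P') Q s := by
  by_cases hb : b.Holds s
  · obtain ⟨t, s', h1, h2, h3⟩ := h hb
    refine ⟨_, s', .ite_true hb h1, ?_, h3⟩
    simp only [Program.bound]; omega
  · obtain ⟨t, s', h1, h2, h3⟩ := h' hb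
    refine ⟨_, s', .ite_false hb h1, ?_, h3⟩
    simp only [Program.bound]; omega

/-- A loop with the invariant `I k` after `k` iterations ends if it has to stop after at most `N`
iterations. -/
theorem ends_loop {b : Test} {P : Program} {Q : Store → Prop} {s : Store} (N : ℕ) (hN : N ≤ Y)
    (I : ℕ → Store → Prop) (h0 : I 0 s)
    (h : ∀ k s, k ≤ N → I k s →
      (¬ b.Holds s ∧ Q s) ∨ (k < N ∧ b.Holds s ∧ Ends Y P (I (k + 1)) s)) :
    Ends Y (.loop b P) Q s := by
  suffices H : ∀ m k s, m + k = N → I k s → ∃ t s', Exec (.loop b P) s t s' ∧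
      t ≤ m * (b.cost + P.bound Y) + b.cost ∧ Q s' by
    obtain ⟨t, s', h1, h2, h3⟩ := H N 0 s rfl h0
    refine ⟨t, s', h1, h2.trans ?_, h3⟩
    simp only [Program.bound]
    gcongr
  intro m
  induction m with
  | zero =>
    intro k s hk hI
    rcases h k s (by omega) hI with ⟨hb, hQ⟩ | ⟨hlt, -⟩
    · exact ⟨_, s, .loop_done hb, by simp, hQ⟩
    · omega
  | succ m ih =>
    intro k s hk hI
    rcases h k s (by omega) hI with ⟨hb, hQ⟩ | ⟨hlt, hb, t, s', h1, h2, h3⟩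
    · exact ⟨_, s, .loop_done hb, by simp, hQ⟩
    · obtain ⟨t', s'', h4, h5, h6⟩ := ih (k + 1) s' (by omega) h3
      refine ⟨_, s'', .loop_step hb h1 h4, ?_, h6⟩
      calc b.cost + t + t' ≤ b.cost + P.bound Y + (m * (b.cost + P.bound Y) + b.cost) := by omega
        _ = _ := by ring

/-- A loop that makes exactly `N` iterations. -/
theorem ends_for {b : Test} {P : Program} {Q : Store → Prop} {s : Store} (N : ℕ) (hN : N ≤ Y)
    (I : ℕ → Store → Prop) (h0 : I 0 s)
    (h : ∀ k s, k < N → I k s → b.Holds s ∧ Ends Y P (I (k + 1)) s)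
    (hend : ∀ s, I N s → ¬ b.Holds s ∧ Q s) :
    Ends Y (.loop b P) Q s := by
  refine ends_loop N hN I h0 fun k s hk hI => ?_
  rcases hk.lt_or_eq with hk | rfl
  · exact .inr ⟨hk, h k s hk hI⟩
  · exact .inl (hend s hI)

end RealRAM

/-! ### Histograms, deficits and the counting of words by deficit -/

namespace ListRecovery

open Finset

/-- The number of occurrences of each symbol in a word. -/
def histogram {L q : ℕ} (u : Fin L → Fin q) (a : Fin q) : ℕ := #{j | u j = a}

/-- The least possible number of letters outside a set of `ℓ` symbols, for a word with the
histogram `h`. -/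
noncomputable def deficit {q : ℕ} (ℓ : ℕ) (h : Fin q → ℕ) : ℕ :=
  sInf ((fun K : Finset (Fin q) => ∑ a ∈ Kᶜ, h a) '' {K | #K = ℓ})

theorem exists_deficit_eq {q ℓ : ℕ} (hℓ : ℓ ≤ q) (h : Fin q → ℕ) :
    ∃ K : Finset (Fin q), #K = ℓ ∧ ∑ a ∈ Kᶜ, h a = deficit ℓ h := by
  have : ((fun K : Finset (Fin q) => ∑ a ∈ Kᶜ, h a) '' {K | #K = ℓ}).Nonempty := by
    obtain ⟨K, -, hK⟩ := exists_subset_card_eq (s := (univ : Finset (Fin q))) (n := ℓ) (by simpa)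
    exact ⟨_, K, hK, rfl⟩
  obtain ⟨K, hK, h'⟩ := Nat.sInf_mem this
  exact ⟨K, hK, h'⟩

theorem deficit_le {q ℓ : ℕ} (h : Fin q → ℕ) {K : Finset (Fin q)} (hK : #K = ℓ) :
    deficit ℓ h ≤ ∑ a ∈ Kᶜ, h a :=
  Nat.sInf_le ⟨K, hK, rfl⟩

/-- `v` is the `ℓ`-th largest value of `h`. -/
def IsRankValue {q : ℕ} (ℓ : ℕ) (h : Fin q → ℕ) (v : ℕ) : Prop :=
  #{a | v < h a} < ℓ ∧ #{a | h a < v} ≤ q - ℓ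

theorem card_lt_add_card_le {q : ℕ} (h : Fin q → ℕ) (v : ℕ) :
    #{a | h a < v} + #{a | v ≤ h a} = q := by
  have := card_filter_add_card_filter_not (s := (univ : Finset (Fin q))) (fun a => h a < v)
  simpa using this

/-- An optimal set consists of ℓ most frequent symbols: all with multiplicity above v, and some with
multiplicity v. The truncation `min (h a) v` equals v on such a set and `h a` off it; for any other
set this gives an inequality. The selection of the set thereby becomes a sum over symbols. -/
theorem IsRankValue.deficit_add {q ℓ v : ℕ} {h : Fin q → ℕ} (hℓ : ℓ ≤ q)
    (hv : IsRankValue ℓ h v) : deficit ℓ h + ℓ * v = ∑ a, min (h a) v := by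
  obtain ⟨h1, h2⟩ := hv
  have h3 := card_lt_add_card_le h v
  apply le_antisymm
  · obtain ⟨K, hK1, hK2, hK⟩ := exists_subsuperset_card_eq
      (s := ({a | v < h a} : Finset (Fin q))) (t := ({a | v ≤ h a} : Finset (Fin q))) (n := ℓ)
      (fun a ha => by simp at ha ⊢; omega) (by omega) (by omega)
    have e1 : ∑ a ∈ Kᶜ, h a = ∑ a ∈ Kᶜ, min (h a) v := by
      refine sum_congr rfl fun a ha => (min_eq_left ?_).symm
      by_contra hlt
      exact (mem_compl.1 ha) (hK1 (by simp; omega))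
    have e2 : ℓ * v = ∑ a ∈ K, min (h a) v := by
      rw [sum_congr rfl (g := fun _ => v), sum_const, hK, smul_eq_mul]
      intro a ha
      have := hK2 ha
      simp at this
      exact min_eq_right this
    calc deficit ℓ h + ℓ * v ≤ ∑ a ∈ Kᶜ, h a + ℓ * v := by gcongr; exact deficit_le h hK
      _ = ∑ a ∈ Kᶜ, min (h a) v + ∑ a ∈ K, min (h a) v := by rw [e1, e2]
      _ = _ := sum_compl_add_sum K _
  · obtain ⟨K, hK, hd⟩ := exists_deficit_eq hℓ h
    rw [← hd, ← sum_compl_add_sum K (fun a => min (h a) v)]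
    gcongr with a ha
    · exact min_le_left _ _
    · calc ∑ a ∈ K, min (h a) v ≤ ∑ a ∈ K, v := sum_le_sum fun a _ => min_le_right _ _
        _ = ℓ * v := by rw [sum_const, hK, smul_eq_mul]

/-- If v < v', at least ℓ symbols have multiplicity v' or more, but fewer than ℓ exceed v.
Uniqueness ensures that summation over v counts every word once. -/
theorem IsRankValue.unique {q ℓ v v' : ℕ} {h : Fin q → ℕ} (hℓ : ℓ ≤ q)
    (hv : IsRankValue ℓ h v) (hv' : IsRankValue ℓ h v') : v = v' := by
  by_contra hne
  wlog hlt : v < v' generalizing v v'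
  · exact this hv' hv (Ne.symm hne) (by omega)
  have h1 : #{a | v' ≤ h a} ≤ #{a | v < h a} :=
    card_le_card fun a ha => by simp at ha ⊢; omega
  have := card_lt_add_card_le h v'
  have := hv.1
  have := hv'.2
  omega

theorem exists_isRankValue {q ℓ L : ℕ} {h : Fin q → ℕ} (hℓ : 1 ≤ ℓ) (hq : ℓ ≤ q)
    (hL : ∀ a, h a ≤ L) : ∃ v ≤ L, IsRankValue ℓ h v := by
  classical
  have h0 : ℓ ≤ #{a | 0 ≤ h a} := by simpa
  refine ⟨Nat.findGreatest (fun v => ℓ ≤ #{a | v ≤ h a}) L, Nat.findGreatest_le _, ?_, ?_⟩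
  · set v := Nat.findGreatest (fun v => ℓ ≤ #{a | v ≤ h a}) L with hv
    by_contra hlt
    have h2 : #{a | v < h a} = #{a | v + 1 ≤ h a} := rfl
    rcases Nat.lt_or_ge L (v + 1) with h3 | h3
    · have : #{a | v + 1 ≤ h a} = 0 := by
        simp only [card_eq_zero, filter_eq_empty_iff]
        intro a _ ha
        have := hL a
        omega
      omega
    · have := Nat.le_findGreatest (P := fun v => ℓ ≤ #{a | v ≤ h a}) h3 (by omega)
      omega
  · have := Nat.findGreatest_spec (P := fun v => ℓ ≤ #{a | v ≤ h a}) (Nat.zero_le L) h0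
    have := card_lt_add_card_le h (Nat.findGreatest (fun v => ℓ ≤ #{a | v ≤ h a}) L)
    omega

/-- The product of the power series with coefficients `C` with `∑ h ≤ L, w h * X ^ sh h`. -/
def shiftSum (L : ℕ) (w : ℕ → ℝ) (sh : ℕ → ℕ) (C : ℕ → ℝ) (i : ℕ) : ℝ :=
  ∑ h ∈ range (L + 1), if sh h ≤ i then w h * C (i - sh h) else 0

/-- Expansion of a q-th power of a power series: `h` selects one term from each of the q factors. -/
theorem iterate_shiftSum (L : ℕ) (w : ℕ → ℝ) (sh : ℕ → ℕ) (c : ℝ) (q i : ℕ) :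
    (shiftSum L w sh)^[q] (Pi.single 0 c) i =
      ∑ h : Fin q → Fin (L + 1), if ∑ a, sh (h a) = i then c * ∏ a, w (h a) else 0 := by
  induction q generalizing i with
  | zero => simp [Pi.single_apply, eq_comm]
  | succ q ih =>
    rw [Function.iterate_succ_apply', shiftSum,
      ← (Fin.consEquiv fun _ : Fin (q + 1) => Fin (L + 1)).sum_comp, Fintype.sum_prod_type,
      ← Fin.sum_univ_eq_sum_range (fun h => if sh h ≤ i then
        w h * (shiftSum L w sh)^[q] (Pi.single 0 c) (i - sh h) else 0)]
    refine sum_congr rfl fun h _ => ?_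
    split_ifs with hi
    · rw [ih, mul_sum]
      refine sum_congr rfl fun g _ => ?_
      simp only [Fin.consEquiv_apply, Fin.sum_univ_succ, Fin.prod_univ_succ, Fin.cons_zero,
        Fin.cons_succ, mul_ite, mul_zero]
      have : ∑ a, sh (g a) = i - sh h ↔ sh h + ∑ a, sh (g a) = i := by omega
      simp only [this]
      split_ifs
      · ring
      · rfl
    · symm
      refine sum_eq_zero fun g _ => if_neg ?_
      simp only [Fin.consEquiv_apply, Fin.sum_univ_succ, Fin.cons_zero, Fin.cons_succ]
      omega

theorem histogram_le {L q : ℕ} (u : Fin L → Fin q) (a : Fin q) : histogram u a ≤ L := by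
  simpa [histogram] using card_filter_le (univ : Finset (Fin L)) (fun j => u j = a)

theorem sum_histogram {L q : ℕ} (u : Fin L → Fin q) (K : Finset (Fin q)) :
    ∑ a ∈ K, histogram u a = #{j | u j ∈ K} := by
  rw [card_eq_sum_card_fiberwise (f := u) (t := K) (fun j hj => by simpa using hj)]
  refine sum_congr rfl fun a ha => congrArg card ?_
  ext j
  simp only [mem_filter, mem_univ, true_and]
  exact ⟨fun hj => ⟨hj ▸ ha, hj⟩, fun hj => hj.2⟩

/-- The power (Σ X_a)^L is expanded over words and, by the multinomial theorem, over exponent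
vectors; the coefficients of the monomial with exponents `h` agree. -/
theorem card_histogram_eq {L q : ℕ} (h : Fin q → ℕ) (hh : ∑ a, h a = L) :
    #{u : Fin L → Fin q | histogram u = h} = Nat.multinomial univ h := by
  have key : (∑ a : Fin q, (MvPolynomial.X a : MvPolynomial (Fin q) ℕ)) ^ L
      = ∑ u : Fin L → Fin q, ∏ j, MvPolynomial.X (u j) := by
    have := Finset.prod_univ_sum (fun _ : Fin L => (univ : Finset (Fin q)))
      (fun _ a => (MvPolynomial.X a : MvPolynomial (Fin q) ℕ))
    simpa using this
  have h1 : ∀ u : Fin L → Fin q, (∏ j, MvPolynomial.X (u j) : MvPolynomial (Fin q) ℕ)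
      = MvPolynomial.monomial (Finsupp.equivFunOnFinite.symm (histogram u)) 1 := by
    intro u
    rw [MvPolynomial.monomial_eq, ← prod_fiberwise (s := univ) (g := u)]
    simp only [map_one, one_mul]
    rw [Finsupp.prod_fintype _ _ (by simp)]
    refine prod_congr rfl fun a _ => ?_
    rw [prod_congr rfl (g := fun _ => MvPolynomial.X a) (fun j hj => by simp at hj; rw [hj]),
      prod_const]
    rfl
  rw [Finset.sum_pow_eq_sum_piAntidiag] at key
  have h2 : ∀ k : Fin q → ℕ, (∏ a, MvPolynomial.X a ^ k a : MvPolynomial (Fin q) ℕ)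
      = MvPolynomial.monomial (Finsupp.equivFunOnFinite.symm k) 1 := by
    intro k
    rw [MvPolynomial.monomial_eq, Finsupp.prod_fintype _ _ (by simp)]
    simp
  simp only [h1, h2] at key
  have := congrArg (MvPolynomial.coeff (Finsupp.equivFunOnFinite.symm h)) key
  rw [MvPolynomial.coeff_sum, MvPolynomial.coeff_sum] at this
  simp only [MvPolynomial.coeff_monomial, ← map_natCast (MvPolynomial.C (σ := Fin q) (R := ℕ)),
    MvPolynomial.coeff_C_mul, EmbeddingLike.apply_eq_iff_eq, mul_ite, mul_one, mul_zero] at this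
  simp only [sum_ite_eq', sum_boole, mem_piAntidiag, hh] at this
  simpa using this.symm

/-- Summation over words by their histograms. -/
theorem sum_histogram_comp {L q : ℕ} (Φ : (Fin q → ℕ) → ℝ) :
    ∑ u : Fin L → Fin q, Φ (histogram u) =
      ∑ h : Fin q → Fin (L + 1), if ∑ a, (h a : ℕ) = L then
        L.factorial * (∏ a, (1 / ((h a : ℕ).factorial : ℝ))) * Φ (fun a => h a) else 0 := by
  rw [← sum_fiberwise (s := univ)
    (g := fun (u : Fin L → Fin q) (a : Fin q) => (⟨histogram u a, Nat.lt_succ_of_le (histogram_le u a)⟩ : Fin (L + 1)))]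
  refine sum_congr rfl fun h _ => ?_
  have h1 : ∀ u : Fin L → Fin q,
      (fun a => (⟨histogram u a, Nat.lt_succ_of_le (histogram_le u a)⟩ : Fin (L + 1))) = h ↔
        histogram u = fun a => (h a : ℕ) := by
    intro u
    simp only [funext_iff, Fin.ext_iff]
  simp only [h1]
  rw [sum_congr rfl (g := fun _ => Φ fun a => h a)
    (fun u hu => by simp only [mem_filter, mem_univ, true_and] at hu; rw [hu])]
  rw [sum_const, nsmul_eq_mul]
  split_ifs with hs
  · rw [card_histogram_eq _ hs]
    congr 1
    have := Nat.multinomial_spec (univ : Finset (Fin q)) (fun a => (h a : ℕ))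
    rw [hs] at this
    rw [← this]
    push_cast
    rw [mul_right_comm, ← prod_mul_distrib, prod_eq_one, one_mul]
    intro a _
    field_simp
  · have : #{u : Fin L → Fin q | histogram u = fun a => (h a : ℕ)} = 0 := by
      rw [card_eq_zero, filter_eq_empty_iff]
      intro u _ hu
      apply hs
      have := sum_histogram u univ
      simpa [hu] using this
    rw [this]; simp

/-- The exponents which record, in base `Q`, the number of letters of a symbol that occurs `h`
times, this number truncated at `v`, and whether it exceeds `v` or lies below `v`. -/
def rankShift (Q v h : ℕ) : ℕ :=
  h + Q * min h v + Q * Q * (if v < h then 1 else 0) + Q * Q * Q * (if h < v then 1 else 0)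

theorem sum_rankShift {q : ℕ} (Q v : ℕ) (h : Fin q → ℕ) :
    ∑ a, rankShift Q v (h a) = ∑ a, h a + Q * ∑ a, min (h a) v + Q * Q * #{a | v < h a}
      + Q * Q * Q * #{a | h a < v} := by
  simp only [rankShift, sum_add_distrib, ← mul_sum]
  simp

theorem eq_of_digit_eq {Q a b a' b' : ℕ} (ha : a < Q) (ha' : a' < Q)
    (h : a + Q * b = a' + Q * b') : a = a' ∧ b = b' := by
  have h1 := congrArg (· % Q) h
  simp only [Nat.add_mul_mod_self_left, Nat.mod_eq_of_lt ha, Nat.mod_eq_of_lt ha'] at h1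
  subst h1
  exact ⟨rfl, Nat.eq_of_mul_eq_mul_left (by omega) (Nat.add_left_cancel h)⟩

/-- The number of words of length `L` with deficit `d`. -/
noncomputable def deficitCount (q ℓ L d : ℕ) : ℕ :=
  #{u : Fin L → Fin q | deficit ℓ (histogram u) = d}

/-- The base of the positional system in which the dynamic program stores its indices. -/
def indexBase (q L : ℕ) : ℕ := (q + 1) * L + 1

/-- The table of the dynamic program. -/
noncomputable def rankTable (q L v : ℕ) : ℕ → ℝ :=
  (shiftSum L (fun h => 1 / (h.factorial : ℝ)) (rankShift (indexBase q L) v))^[q]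
    (Pi.single 0 (L.factorial : ℝ))

/-- The initial value L! and the weights 1/h! produce multinomial coefficients. The indices summed
over are those whose digits say that the word has L letters, that v is its ℓ-th largest
multiplicity, and that its deficit is d. -/
theorem deficitCount_eq_sum {q ℓ L d : ℕ} (hℓ : 1 ≤ ℓ) (hq : ℓ ≤ q) (hL : 1 ≤ L) (hd : d ≤ L) :
    (deficitCount q ℓ L d : ℝ) = ∑ v ∈ range (L + 1), ∑ j ∈ range ℓ, ∑ j' ∈ range (q - ℓ + 1),
      rankTable q L v (L + indexBase q L * (d + ℓ * v) + indexBase q L * indexBase q L * j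
        + indexBase q L * indexBase q L * indexBase q L * j') := by
  classical
  set Q := indexBase q L with hQ
  have h1 : (deficitCount q ℓ L d : ℝ) =
      ∑ u : Fin L → Fin q, if deficit ℓ (histogram u) = d then (1 : ℝ) else 0 := by
    simp [deficitCount]
  rw [h1, sum_histogram_comp (fun h => if deficit ℓ h = d then (1 : ℝ) else 0)]
  simp only [rankTable, iterate_shiftSum, sum_comm (s := range _) (t := univ)]
  refine sum_congr rfl fun h _ => ?_
  set P : ℝ := L.factorial * ∏ a, 1 / ((h a : ℕ).factorial : ℝ) with hP
  have hb : ∀ a, (h a : ℕ) ≤ L := fun a => Nat.lt_succ_iff.1 (h a).2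
  have hsum : ∑ a, (h a : ℕ) < Q := by
    calc ∑ a, (h a : ℕ) ≤ ∑ a : Fin q, L := sum_le_sum fun a _ => hb a
      _ = q * L := by simp
      _ < Q := by rw [hQ, indexBase]; nlinarith
  have hmin : ∀ v, ∑ a, min (h a : ℕ) v < Q := fun v =>
    lt_of_le_of_lt (sum_le_sum fun a _ => min_le_left _ _) hsum
  have hqQ : q < Q := by rw [hQ, indexBase]; nlinarith
  have hcard : ∀ p : Fin q → Prop, ∀ [DecidablePred p], #{a | p a} < Q := fun p _ =>
    lt_of_le_of_lt (by simpa using card_filter_le univ p) hqQ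
  -- All digits are smaller than the base, so equality of exponents is equality of the four digits.
  have h2 : ∀ v ∈ range (L + 1), ∀ j ∈ range ℓ, ∀ j' ∈ range (q - ℓ + 1),
      (if ∑ a, rankShift Q v (h a) = L + Q * (d + ℓ * v) + Q * Q * j + Q * Q * Q * j'
        then P else 0) =
      if j = #{a | v < (h a : ℕ)} then if j' = #{a | (h a : ℕ) < v} then
        if ∑ a, (h a : ℕ) = L ∧ ∑ a, min (h a : ℕ) v = d + ℓ * v then P else 0 else 0 else 0 := by
    intro v hv j hj j' hj'
    rw [mem_range] at hv hj hj'
    rw [← ite_and, ← ite_and]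
    refine if_congr ?_ rfl rfl
    rw [sum_rankShift]
    constructor
    · intro e
      have e1 : ∑ a, (h a : ℕ) + Q * (∑ a, min (h a : ℕ) v + Q * (#{a | v < (h a : ℕ)} + Q *
          #{a | (h a : ℕ) < v})) = L + Q * ((d + ℓ * v) + Q * (j + Q * j')) := by
        linarith
      have hLQ : L < Q := by rw [hQ, indexBase]; nlinarith
      -- The base (q + 1) L + 1 is chosen for this digit: d ≤ L and ℓ v ≤ q L.
      have hdQ : d + ℓ * v < Q := by
        rw [hQ, indexBase]
        have : ℓ * v ≤ q * L := Nat.mul_le_mul hq (by omega)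
        nlinarith
      obtain ⟨a1, e2⟩ := eq_of_digit_eq hsum hLQ e1
      obtain ⟨a2, e3⟩ := eq_of_digit_eq (hmin v) hdQ e2
      obtain ⟨a3, a4⟩ := eq_of_digit_eq (hcard _) (by omega) e3
      exact ⟨⟨a3.symm, a4.symm⟩, a1, a2⟩
    · rintro ⟨⟨rfl, rfl⟩, e1, e2⟩
      rw [e1, e2]
  rw [sum_congr rfl fun v hv => sum_congr rfl fun j hj => sum_congr rfl (h2 v hv j hj)]
  simp only [sum_ite_irrel, sum_ite_eq', sum_const_zero, mem_range]
  -- For a fixed histogram only one v satisfies both digit bounds, and for it the second digit is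
  -- the deficit plus ℓ v.
  obtain ⟨v₀, hv₀, hr⟩ := exists_isRankValue hℓ hq hb
  rw [sum_eq_single_of_mem v₀ (by simpa using Nat.lt_succ_of_le hv₀)]
  · rw [if_pos hr.1, if_pos (Nat.lt_succ_of_le hr.2), ← hr.deficit_add hq]
    by_cases hs : ∑ a, (h a : ℕ) = L <;> simp [hs]
  · intro v _ hne
    by_cases c1 : #{a | v < (h a : ℕ)} < ℓ
    · by_cases c2 : #{a | (h a : ℕ) < v} < q - ℓ + 1
      · exact absurd (IsRankValue.unique hq ⟨c1, Nat.lt_succ_iff.1 c2⟩ hr) hne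
      · simp [c2]
    · simp [c1]

end ListRecovery

namespace ListRecovery

open Finset

/-! ### Products of a probability vector -/

section Product

variable {U : Type*} [Fintype U] {τ : U → ℝ}

theorem sum_prod_apply (f : U → ℝ) (n : ℕ) :
    ∑ w : Fin n → U, ∏ i, f (w i) = (∑ u, f u) ^ n :=
  (Fintype.sum_pow f n).symm

theorem sum_prod_mul_sum (hτ : ∑ u, τ u = 1) {f : U → ℝ} (n : ℕ) :
    ∑ w : Fin n → U, (∏ i, τ (w i)) * ∑ i, f (w i) = n * ∑ u, τ u * f u := by
  induction n with
  | zero => simp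
  | succ n ih =>
    rw [← (Fin.consEquiv fun _ : Fin (n + 1) => U).sum_comp, Fintype.sum_prod_type]
    simp only [Fin.consEquiv_apply, Fin.sum_univ_succ, Fin.prod_univ_succ, Fin.cons_zero,
      Fin.cons_succ]
    have h1 : ∀ x : U, ∑ w : Fin n → U, (τ x * ∏ i, τ (w i)) * (f x + ∑ i, f (w i))
        = τ x * f x + τ x * (n * ∑ u, τ u * f u) := by
      intro x
      rw [← ih, mul_sum, ← mul_one (τ x * f x), ← one_pow n, ← hτ, ← sum_prod_apply, mul_sum,
        ← sum_add_distrib]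
      exact sum_congr rfl fun w _ => by ring
    simp only [h1, sum_add_distrib, ← sum_mul, hτ]
    push_cast; ring

/-- Induction on the length: the cross terms vanish for centred letters, so variances add up. -/
theorem sum_prod_mul_sum_sq (hτ : ∑ u, τ u = 1) {f : U → ℝ} (hf : ∑ u, τ u * f u = 0) (n : ℕ) :
    ∑ w : Fin n → U, (∏ i, τ (w i)) * (∑ i, f (w i)) ^ 2 = n * ∑ u, τ u * f u ^ 2 := by
  induction n with
  | zero => simp
  | succ n ih =>
    rw [← (Fin.consEquiv fun _ : Fin (n + 1) => U).sum_comp, Fintype.sum_prod_type]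
    simp only [Fin.consEquiv_apply, Fin.sum_univ_succ, Fin.prod_univ_succ, Fin.cons_zero,
      Fin.cons_succ]
    have h1 : ∀ x : U, ∑ w : Fin n → U, (τ x * ∏ i, τ (w i)) * (f x + ∑ i, f (w i)) ^ 2
        = τ x * f x ^ 2 + τ x * (n * ∑ u, τ u * f u ^ 2) := by
      intro x
      have h2 := sum_prod_mul_sum hτ (f := f) n
      rw [hf, mul_zero] at h2
      have h3 := sum_prod_apply τ n
      rw [hτ, one_pow] at h3
      calc _ = ∑ w : Fin n → U, (τ x * f x ^ 2 * (∏ i, τ (w i)) + τ x * ((∏ i, τ (w i)) *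
            (∑ i, f (w i)) ^ 2) + 2 * τ x * f x * ((∏ i, τ (w i)) * ∑ i, f (w i))) :=
            sum_congr rfl fun w _ => by ring
        _ = _ := by
            rw [sum_add_distrib, sum_add_distrib, ← mul_sum, ← mul_sum, ← mul_sum, h2, h3, ih]
            ring
    simp only [h1, sum_add_distrib, ← sum_mul, hτ]
    push_cast; ring

/-- The probability of a set of words whose letters are independent with distribution `τ`. -/
noncomputable def productMass (τ : U → ℝ) {n : ℕ} (s : Set (Fin n → U)) : ℝ :=
  open scoped Classical in ∑ w : Fin n → U, if w ∈ s then ∏ i, τ (w i) else 0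

theorem productMass_nonneg (h0 : ∀ u, 0 ≤ τ u) {n : ℕ} (s : Set (Fin n → U)) :
    0 ≤ productMass τ s :=
  sum_nonneg fun w _ => by split_ifs <;> [exact prod_nonneg fun i _ => h0 _; exact le_rfl]

theorem productMass_mono (h0 : ∀ u, 0 ≤ τ u) {n : ℕ} {s t : Set (Fin n → U)} (h : s ⊆ t) :
    productMass τ s ≤ productMass τ t := by
  refine sum_le_sum fun w _ => ?_
  have := prod_nonneg fun i (_ : i ∈ univ) => h0 (w i)
  by_cases hw : w ∈ s
  · simp [hw, h hw]
  · simp only [hw, if_false]; split_ifs <;> simp [this]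

theorem productMass_iUnion_le (h0 : ∀ u, 0 ≤ τ u) {n : ℕ} {ι : Type*} [Fintype ι]
    (s : ι → Set (Fin n → U)) : productMass τ (⋃ i, s i) ≤ ∑ i, productMass τ (s i) := by
  classical
  unfold productMass
  rw [sum_comm]
  refine sum_le_sum fun w _ => ?_
  have := prod_nonneg fun i (_ : i ∈ univ) => h0 (w i)
  have h2 : ∀ i ∈ (univ : Finset ι), 0 ≤ if w ∈ s i then ∏ i, τ (w i) else 0 := fun i _ => by
    split_ifs <;> simp [this]
  split_ifs with hw
  · obtain ⟨i, hi⟩ := Set.mem_iUnion.1 hw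
    calc _ = (if w ∈ s i then ∏ i, τ (w i) else 0) := by simp [hi]
      _ ≤ _ := single_le_sum h2 (mem_univ i)
  · exact sum_nonneg h2

theorem productMass_compl (hτ : ∑ u, τ u = 1) {n : ℕ} (s : Set (Fin n → U)) :
    productMass τ sᶜ = 1 - productMass τ s := by
  have h := sum_prod_apply τ n
  rw [hτ, one_pow] at h
  rw [eq_sub_iff_add_eq, ← h, productMass, productMass, ← sum_add_distrib]
  refine sum_congr rfl fun w _ => ?_
  by_cases hw : w ∈ s <;> simp [hw]

/-- Chebyshev's inequality. -/
theorem productMass_le_of_mean_lt (h0 : ∀ u, 0 ≤ τ u) (hτ : ∑ u, τ u = 1) (f : U → ℝ) {a : ℝ}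
    (ha : ∑ u, τ u * f u < a) :
    ∃ V : ℝ, ∀ n : ℕ, 0 < n → productMass τ {w : Fin n → U | a * n ≤ ∑ i, f (w i)} ≤ V / n := by
  set m := ∑ u, τ u * f u with hm
  have hf : ∑ u, τ u * (f u - m) = 0 := by
    simp only [mul_sub, sum_sub_distrib, ← sum_mul, hτ, ← hm]; ring
  refine ⟨(∑ u, τ u * (f u - m) ^ 2) / (a - m) ^ 2, fun n hn => ?_⟩
  have hn' : (0 : ℝ) < n := by exact_mod_cast hn
  have hδ : 0 < a - m := by linarith
  have h1 := sum_prod_mul_sum_sq hτ hf n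
  rw [div_div, le_div_iff₀ (by positivity)]
  have h2 : productMass τ {w : Fin n → U | a * n ≤ ∑ i, f (w i)} * (n * (a - m)) ^ 2 ≤
      n * ∑ u, τ u * (f u - m) ^ 2 := by
    rw [← h1, productMass, sum_mul]
    refine sum_le_sum fun w _ => ?_
    have := prod_nonneg fun i (_ : i ∈ univ) => h0 (w i)
    split_ifs with hw
    · have h3 : ∑ i, (f (w i) - m) = ∑ i, f (w i) - n * m := by simp
      rw [h3]
      have hw' : a * n ≤ ∑ i, f (w i) := hw
      gcongr
      linarith
    · rw [zero_mul]; positivity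
  have h4 : (productMass τ {w : Fin n → U | a * n ≤ ∑ i, f (w i)} * ((a - m) ^ 2 * n)) * n ≤
      (∑ u, τ u * (f u - m) ^ 2) * n := by linarith
  exact le_of_mul_le_mul_right h4 hn'

theorem tendsto_productMass_of_mean_lt (h0 : ∀ u, 0 ≤ τ u) (hτ : ∑ u, τ u = 1) (f : U → ℝ)
    {a : ℝ} (ha : ∑ u, τ u * f u < a) :
    Filter.Tendsto (fun n : ℕ => productMass τ {w : Fin n → U | a * n ≤ ∑ i, f (w i)})
      Filter.atTop (nhds 0) := by
  obtain ⟨V, hV⟩ := productMass_le_of_mean_lt h0 hτ f ha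
  refine squeeze_zero' (.of_forall fun n => productMass_nonneg h0 _) ?_
    (tendsto_const_div_atTop_nhds_zero_nat V)
  filter_upwards [Filter.eventually_gt_atTop 0] with n hn using hV n hn

/-- Letters from a set of probability `< 1` rarely fill a long word. -/
theorem tendsto_productMass_forall (h0 : ∀ u, 0 ≤ τ u) (s : Set U) [DecidablePred (· ∈ s)]
    (hs : (∑ u, if u ∈ s then τ u else 0) < 1) :
    Filter.Tendsto (fun n : ℕ => productMass τ {w : Fin n → U | ∀ i, w i ∈ s})
      Filter.atTop (nhds 0) := by
  have h1 : ∀ n : ℕ, productMass τ {w : Fin n → U | ∀ i, w i ∈ s} =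
      (∑ u, if u ∈ s then τ u else 0) ^ n := by
    intro n
    rw [← sum_prod_apply, productMass]
    refine sum_congr rfl fun w _ => ?_
    by_cases hw : ∀ i, w i ∈ s
    · simp [hw]
    · have : ¬ w ∈ {w : Fin n → U | ∀ i, w i ∈ s} := hw
      rw [if_neg this]
      push Not at hw
      obtain ⟨i, hi⟩ := hw
      exact (prod_eq_zero (mem_univ i) (by simp [hi])).symm
  simp only [h1]
  exact tendsto_pow_atTop_nhds_zero_of_lt_one
    (sum_nonneg fun u _ => by split_ifs <;> simp [h0]) hs

end Product

/-! ### Entropies of marginals -/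

section Entropy

variable {L q : ℕ} {τ : (Fin L → Fin q) → ℝ}

/-- The probability that a random word agrees with `u` on `S`. -/
noncomputable def marginal (τ : (Fin L → Fin q) → ℝ) (S : Finset (Fin L)) (u : Fin L → Fin q) : ℝ :=
  ∑ u', if ∀ j ∈ S, u' j = u j then τ u' else 0

/-- The entropy (in nats) of the letters with positions in `S`. -/
noncomputable def marginalEntropy (τ : (Fin L → Fin q) → ℝ) (S : Finset (Fin L)) : ℝ :=
  ∑ u, τ u * -Real.log (marginal τ S u)

theorem marginal_nonneg (h0 : ∀ u, 0 ≤ τ u) (S : Finset (Fin L)) (u : Fin L → Fin q) :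
    0 ≤ marginal τ S u :=
  sum_nonneg fun u' _ => by split_ifs <;> simp [h0]

theorem le_marginal (h0 : ∀ u, 0 ≤ τ u) (S : Finset (Fin L)) (u : Fin L → Fin q) :
    τ u ≤ marginal τ S u := by
  have h : ∀ u' ∈ univ, 0 ≤ if ∀ j ∈ S, u' j = u j then τ u' else 0 := fun u' _ => by
    split_ifs <;> simp [h0]
  simpa [marginal] using single_le_sum h (mem_univ u)

theorem marginal_congr {S : Finset (Fin L)} {u u' : Fin L → Fin q} (h : ∀ j ∈ S, u j = u' j) :
    marginal τ S u = marginal τ S u' := by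
  refine sum_congr rfl fun v _ => if_congr ?_ rfl rfl
  exact forall₂_congr fun j hj => by rw [h j hj]

theorem marginal_empty (hτ : ∑ u, τ u = 1) (u : Fin L → Fin q) : marginal τ ∅ u = 1 := by
  simp [marginal, hτ]

theorem marginal_univ (u : Fin L → Fin q) : marginal τ univ u = τ u := by
  simp [marginal, ← funext_iff]

theorem marginalEntropy_empty (hτ : ∑ u, τ u = 1) : marginalEntropy τ ∅ = 0 := by
  simp [marginalEntropy, marginal_empty hτ]

theorem marginalEntropy_univ : marginalEntropy τ univ = ∑ u, Real.negMulLog (τ u) := by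
  simp [marginalEntropy, marginal_univ, Real.negMulLog]

/-- Conditioned on the letters in `S`, the sum of the probabilities of agreeing with `u₁` on `S₁`
and with `u₂` on `S₂` is at most `1`, if these are weighted by the reciprocal of their total. -/
theorem sum_div_marginal_le_one (T S₁ S₂ : Finset (Fin L)) (hT : T = S₁ ∪ S₂)
    (u₁ u₂ : Fin L → Fin q) :
    (∑ u, if (∀ j ∈ S₁, u j = u₁ j) ∧ ∀ j ∈ S₂, u j = u₂ j then τ u / marginal τ T u else 0)
      ≤ 1 := by
  classical
  by_cases h : ∃ u₀ : Fin L → Fin q, ((∀ j ∈ S₁, u₀ j = u₁ j) ∧ ∀ j ∈ S₂, u₀ j = u₂ j)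
  · obtain ⟨u₀, h1, h2⟩ := h
    have h3 : ∀ u : Fin L → Fin q, ((∀ j ∈ S₁, u j = u₁ j) ∧ ∀ j ∈ S₂, u j = u₂ j) ↔
        ∀ j ∈ T, u j = u₀ j := by
      intro u
      subst hT
      simp only [mem_union]
      constructor
      · rintro ⟨a, b⟩ j (hj | hj)
        · rw [a j hj, h1 j hj]
        · rw [b j hj, h2 j hj]
      · intro a
        exact ⟨fun j hj => by rw [a j (.inl hj), h1 j hj],
          fun j hj => by rw [a j (.inr hj), h2 j hj]⟩
    have h4 : ∀ u : Fin L → Fin q, (if (∀ j ∈ S₁, u j = u₁ j) ∧ ∀ j ∈ S₂, u j = u₂ j then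
        τ u / marginal τ T u else 0) =
        (if ∀ j ∈ T, u j = u₀ j then τ u else 0) / marginal τ T u₀ := by
      intro u
      simp only [h3]
      split_ifs with hu
      · rw [marginal_congr hu]
      · simp
    simp only [h4, ← sum_div]
    exact div_self_le_one _
  · push Not at h
    rw [sum_eq_zero]
    · exact zero_le_one
    · intro u _
      rw [if_neg]
      rintro ⟨a, b⟩
      obtain ⟨j, hj, hne⟩ := h u a
      exact hne (b j hj)

/-- Strong subadditivity of the entropy. -/
theorem marginalEntropy_submodular (h0 : ∀ u, 0 ≤ τ u) (hτ : ∑ u, τ u = 1)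
    (S₁ S₂ : Finset (Fin L)) :
    marginalEntropy τ (S₁ ∪ S₂) + marginalEntropy τ (S₁ ∩ S₂) ≤
      marginalEntropy τ S₁ + marginalEntropy τ S₂ := by
  classical
  set T := S₁ ∪ S₂ with hT
  set S := S₁ ∩ S₂ with hS
  -- This is log t ≤ t - 1 for the ratio t of marginals. Where τ u > 0 all marginals are positive,
  -- so that the logarithm splits.
  have h1 : ∀ u, τ u * (Real.log (marginal τ S₁ u) + Real.log (marginal τ S₂ u)
      - Real.log (marginal τ T u) - Real.log (marginal τ S u)) ≤
      τ u * (marginal τ S₁ u * marginal τ S₂ u / (marginal τ T u * marginal τ S u)) - τ u := by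
    intro u
    rcases (h0 u).eq_or_lt with hu | hu
    · simp [← hu]
    have p1 := hu.trans_le (le_marginal h0 S₁ u)
    have p2 := hu.trans_le (le_marginal h0 S₂ u)
    have p3 := hu.trans_le (le_marginal h0 T u)
    have p4 := hu.trans_le (le_marginal h0 S u)
    have := Real.log_le_sub_one_of_pos (div_pos (mul_pos p1 p2) (mul_pos p3 p4))
    rw [Real.log_div (by positivity) (by positivity), Real.log_mul p1.ne' p2.ne',
      Real.log_mul p3.ne' p4.ne'] at this
    nlinarith
  -- The mean of the ratio is at most 1. Expand the marginals on S₁ and S₂ as sums over u₁ and u₂,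
  -- which must agree on S. Summing over u first leaves a factor at most 1, then the sum over u₂
  -- cancels the marginal on S.
  have h2 : ∑ u, τ u * (marginal τ S₁ u * marginal τ S₂ u / (marginal τ T u * marginal τ S u))
      ≤ 1 := by
    have e1 : ∀ u, τ u * (marginal τ S₁ u * marginal τ S₂ u / (marginal τ T u * marginal τ S u)) =
        ∑ u₁, ∑ u₂, (if ∀ j ∈ S, u₂ j = u₁ j then τ u₁ * τ u₂ / marginal τ S u₁ else 0) *
          (if (∀ j ∈ S₁, u j = u₁ j) ∧ ∀ j ∈ S₂, u j = u₂ j then τ u / marginal τ T u else 0) := by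
      intro u
      have e2 : τ u * (marginal τ S₁ u * marginal τ S₂ u / (marginal τ T u * marginal τ S u)) =
          marginal τ S₁ u * (marginal τ S₂ u * (τ u / marginal τ T u / marginal τ S u)) := by
        field_simp
      rw [e2, marginal, sum_mul]
      refine sum_congr rfl fun u₁ _ => ?_
      nth_rewrite 1 [marginal]
      rw [sum_mul, mul_sum]
      refine sum_congr rfl fun u₂ _ => ?_
      by_cases a1 : ∀ j ∈ S₁, u₁ j = u j
      · by_cases a2 : ∀ j ∈ S₂, u₂ j = u j
        · have a3 : ∀ j ∈ S, u₂ j = u₁ j := fun j hj => by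
            rw [hS, mem_inter] at hj
            rw [a1 j hj.1, a2 j hj.2]
          have a4 : marginal τ S u₁ = marginal τ S u :=
            marginal_congr fun j hj => a1 j (mem_inter.1 hj).1
          rw [if_pos a1, if_pos a2, if_pos a3, a4, if_pos ⟨fun j hj => (a1 j hj).symm,
            fun j hj => (a2 j hj).symm⟩]
          ring
        · have : ¬ ((∀ j ∈ S₁, u j = u₁ j) ∧ ∀ j ∈ S₂, u j = u₂ j) := fun h =>
            a2 fun j hj => (h.2 j hj).symm
          simp [this, a2]
      · have : ¬ ((∀ j ∈ S₁, u j = u₁ j) ∧ ∀ j ∈ S₂, u j = u₂ j) := fun h =>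
            a1 fun j hj => (h.1 j hj).symm
        simp [this, a1]
    simp only [e1]
    rw [sum_comm]
    calc _ = ∑ u₁, ∑ u₂, (if ∀ j ∈ S, u₂ j = u₁ j then τ u₁ * τ u₂ / marginal τ S u₁ else 0) *
          ∑ u, (if (∀ j ∈ S₁, u j = u₁ j) ∧ ∀ j ∈ S₂, u j = u₂ j then
            τ u / marginal τ T u else 0) := by
          refine sum_congr rfl fun u₁ _ => ?_
          rw [sum_comm]
          exact sum_congr rfl fun u₂ _ => (mul_sum _ _ _).symm
      _ ≤ ∑ u₁, ∑ u₂, (if ∀ j ∈ S, u₂ j = u₁ j then τ u₁ * τ u₂ / marginal τ S u₁ else 0) := by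
          refine sum_le_sum fun u₁ _ => sum_le_sum fun u₂ _ => mul_le_of_le_one_right ?_
            (sum_div_marginal_le_one T S₁ S₂ hT u₁ u₂)
          split_ifs
          · exact div_nonneg (mul_nonneg (h0 _) (h0 _)) (marginal_nonneg h0 _ _)
          · exact le_rfl
      _ ≤ ∑ u₁, τ u₁ := by
          refine sum_le_sum fun u₁ _ => ?_
          have : ∀ u₂, (if ∀ j ∈ S, u₂ j = u₁ j then τ u₁ * τ u₂ / marginal τ S u₁ else 0) =
              τ u₁ / marginal τ S u₁ * (if ∀ j ∈ S, u₂ j = u₁ j then τ u₂ else 0) := by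
            intro u₂; split_ifs <;> ring
          simp only [this, ← mul_sum]
          change τ u₁ / marginal τ S u₁ * marginal τ S u₁ ≤ _
          rw [div_mul_comm]
          exact mul_le_of_le_one_left (h0 _) (div_self_le_one _)
      _ = 1 := hτ
  have h3 := sum_le_sum fun u (_ : u ∈ univ) => h1 u
  rw [sum_sub_distrib, hτ] at h3
  have h4 : ∑ u, τ u * (Real.log (marginal τ S₁ u) + Real.log (marginal τ S₂ u)
      - Real.log (marginal τ T u) - Real.log (marginal τ S u)) =
      marginalEntropy τ T + marginalEntropy τ S - marginalEntropy τ S₁ - marginalEntropy τ S₂ := by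
    simp only [marginalEntropy, ← sum_add_distrib, ← sum_sub_distrib]
    exact sum_congr rfl fun u _ => by ring
  linarith

theorem marginal_comp_perm (hs : ∀ (σ : Equiv.Perm (Fin L)) u, τ (u ∘ σ) = τ u)
    (σ : Equiv.Perm (Fin L)) (S : Finset (Fin L)) (u : Fin L → Fin q) :
    marginal τ S (u ∘ σ) = marginal τ (S.map σ.toEmbedding) u := by
  rw [marginal, marginal, ← (σ.arrowCongr (Equiv.refl (Fin q))).symm.sum_comp]
  refine sum_congr rfl fun v _ => ?_
  have : (σ.arrowCongr (Equiv.refl (Fin q))).symm v = v ∘ σ := by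
    ext j; simp [Equiv.arrowCongr]
  rw [this, hs]
  refine if_congr ?_ rfl rfl
  simp only [Function.comp_apply, mem_map, Equiv.coe_toEmbedding, forall_exists_index, and_imp,
    forall_apply_eq_imp_iff₂]

/-- For an exchangeable distribution, permuted words have the same mean log-probabilities. -/
theorem sum_mul_log_marginal_comp (hs : ∀ (σ : Equiv.Perm (Fin L)) u, τ (u ∘ σ) = τ u)
    (σ : Equiv.Perm (Fin L)) (S : Finset (Fin L)) :
    ∑ u, τ u * Real.log (marginal τ S (u ∘ σ)) = -marginalEntropy τ S := by
  rw [marginalEntropy, ← sum_neg_distrib,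
    ← (σ.arrowCongr (Equiv.refl (Fin q))).symm.sum_comp fun u =>
      -(τ u * -Real.log (marginal τ S u))]
  refine sum_congr rfl fun v _ => ?_
  have : (σ.arrowCongr (Equiv.refl (Fin q))).symm v = v ∘ σ := by
    ext j; simp [Equiv.arrowCongr]
  rw [this, hs]
  ring

theorem marginalEntropy_map (hs : ∀ (σ : Equiv.Perm (Fin L)) u, τ (u ∘ σ) = τ u)
    (σ : Equiv.Perm (Fin L)) (S : Finset (Fin L)) :
    marginalEntropy τ (S.map σ.toEmbedding) = marginalEntropy τ S := by
  rw [← neg_inj, ← sum_mul_log_marginal_comp hs σ S, marginalEntropy, ← sum_neg_distrib]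
  refine sum_congr rfl fun u _ => ?_
  rw [marginal_comp_perm hs]
  ring

/-- A bijection between S and T extends to a permutation of all positions, under which the
distribution is invariant. -/
theorem marginalEntropy_congr_card (hs : ∀ (σ : Equiv.Perm (Fin L)) u, τ (u ∘ σ) = τ u)
    {S T : Finset (Fin L)} (h : #S = #T) : marginalEntropy τ S = marginalEntropy τ T := by
  classical
  obtain ⟨e⟩ : Nonempty (S ≃ T) := ⟨Finset.equivOfCardEq h⟩
  have : T = S.map (e.extendSubtype).toEmbedding := by
    symm
    refine eq_of_subset_of_card_le (fun x hx => ?_) (by simp [h])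
    obtain ⟨y, hy, rfl⟩ := mem_map.1 hx
    have := e.extendSubtype_mem y hy
    exact this
  rw [this, marginalEntropy_map hs]

/-- A concave sequence that vanishes at `0` has decreasing averages. -/
theorem mul_le_mul_of_concave {g : ℕ → ℝ} {N : ℕ} (hg0 : g 0 = 0)
    (hg : ∀ k, k + 2 ≤ N → g (k + 2) + g k ≤ 2 * g (k + 1)) {k : ℕ} (hk : k ≤ N) :
    k * g N ≤ N * g k := by
  -- One step of the monotonicity of g m / m, with denominators cleared so that m = 0 is allowed.
  have h1 : ∀ m, m + 1 ≤ N → m * g (m + 1) ≤ (m + 1) * g m := by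
    intro m
    induction m with
    | zero => intro _; simp [hg0]
    | succ m ih =>
      intro hm
      have a := ih (by omega)
      have b := hg m (by omega)
      push_cast
      nlinarith
  induction N, hk using Nat.le_induction with
  | base => rfl
  | succ N hkN ih =>
    have a := ih (fun k hk => hg k (by omega)) (fun m hm => h1 m (by omega))
    have b := h1 N le_rfl
    rcases Nat.eq_zero_or_pos N with rfl | hN
    · obtain rfl : k = 0 := by omega
      simp [hg0]
    have hN' : (0 : ℝ) < N := by exact_mod_cast hN
    have hk' : (0 : ℝ) ≤ k := by positivity
    push_cast
    refine le_of_mul_le_mul_left ?_ hN'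
    nlinarith [mul_le_mul_of_nonneg_left b hk']

/-- Han's inequality for exchangeable distributions. -/
theorem card_mul_marginalEntropy_univ_le (h0 : ∀ u, 0 ≤ τ u) (hτ : ∑ u, τ u = 1)
    (hs : ∀ (σ : Equiv.Perm (Fin L)) u, τ (u ∘ σ) = τ u) (S : Finset (Fin L)) :
    #S * marginalEntropy τ univ ≤ L * marginalEntropy τ S := by
  classical
  -- Entropies depend only on the number of positions, so initial segments represent all sets.
  set I : ℕ → Finset (Fin L) := fun k => {j | (j : ℕ) < k} with hI
  have hcard : ∀ k ≤ L, #(I k) = k := by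
    intro k hk
    have := Fin.card_filter_val_lt (n := L) (m := k)
    simp only [hI]
    omega
  have hS : marginalEntropy τ S = marginalEntropy τ (I #S) :=
    marginalEntropy_congr_card hs (hcard _ (by simpa using card_le_univ S)).symm
  have hU : marginalEntropy τ univ = marginalEntropy τ (I L) :=
    marginalEntropy_congr_card hs (by rw [hcard L le_rfl]; simp)
  rw [hS, hU]
  refine mul_le_mul_of_concave (g := fun k => marginalEntropy τ (I k)) ?_ ?_
    (by simpa using card_le_univ S)
  · simp only [hI, not_lt_zero, filter_false]
    exact marginalEntropy_empty hτ
  · intro k hk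
    -- The sets I (k + 1) and J have equal size, union I (k + 2) and intersection I k; submodularity
    -- applied to them is concavity of the entropy in the number of positions.
    set J : Finset (Fin L) := insert ⟨k + 1, by omega⟩ (I k) with hJ
    have c1 : #J = k + 1 := by
      rw [hJ, card_insert_of_notMem (by simp [hI]), hcard k (by omega)]
    have e1 : I (k + 1) ∪ J = I (k + 2) := by
      ext j; simp [hI, hJ, Fin.ext_iff]; omega
    have e2 : I (k + 1) ∩ J = I k := by
      ext j; simp [hI, hJ]; omega
    have := marginalEntropy_submodular h0 hτ (I (k + 1)) J
    rw [e1, e2, marginalEntropy_congr_card hs (c1.trans (hcard (k + 1) (by omega)).symm)] at this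
    linarith

end Entropy

end ListRecovery

namespace ListRecovery

open Finset ProbabilityTheory MeasureTheory unitInterval

/-! ### The moments of the number of bad matrices in a random code -/

section RandomCode

theorem setBernoulli_real_superset {W : Type*} [Fintype W] (T : Finset W) (r : I) :
    (setBernoulli (Set.univ : Set W) r).real {C | ∀ x ∈ T, x ∈ C} = (r : ℝ) ^ #T := by
  rw [measureReal_def, setBernoulli_apply']
  have : (fun p : W → Prop => {i | p i}) ⁻¹' {C | ∀ x ∈ T, x ∈ C} =
      Set.pi (T : Set W) fun _ => ({True} : Set Prop) := by
    ext p
    simp [Set.mem_pi]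
  rw [this, Measure.infinitePi_pi _ (fun _ _ => by measurability)]
  simp

variable {W : Type*} [Fintype W]

theorem sum_setBernoulli_real (r : I) (s : Set (Set W)) [DecidablePred (· ∈ s)] :
    ∑ C : Set W, (if C ∈ s then (setBernoulli (Set.univ : Set W) r).real {C} else 0) =
      (setBernoulli (Set.univ : Set W) r).real s := by
  rw [← sum_filter, sum_measureReal_singleton]
  congr 1
  ext C
  simp

/-- The second moment method. -/
theorem sq_mul_sum_le_of_second_moment {Ω : Type*} [Fintype Ω] {P X : Ω → ℝ} (hP : ∀ ω, 0 ≤ P ω)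
    (hP1 : ∑ ω, P ω = 1) (s : Set Ω) [DecidablePred (· ∈ s)] (hs : ∀ ω ∈ s, X ω = 0) :
    (∑ ω, P ω * X ω) ^ 2 * ∑ ω, (if ω ∈ s then P ω else 0) ≤
      ∑ ω, P ω * X ω ^ 2 - (∑ ω, P ω * X ω) ^ 2 := by
  set m := ∑ ω, P ω * X ω with hm
  have h1 : ∑ ω, P ω * X ω ^ 2 - m ^ 2 = ∑ ω, P ω * (X ω - m) ^ 2 := by
    have : ∀ ω, P ω * (X ω - m) ^ 2 = P ω * X ω ^ 2 - 2 * m * (P ω * X ω) + m ^ 2 * P ω :=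
      fun ω => by ring
    simp only [this, sum_add_distrib, sum_sub_distrib, ← mul_sum, hP1, ← hm]
    ring
  rw [h1, mul_sum]
  refine sum_le_sum fun ω _ => ?_
  split_ifs with hω
  · rw [hs ω hω]; apply le_of_eq; ring
  · rw [mul_zero]; exact mul_nonneg (hP ω) (sq_nonneg _)

end RandomCode

variable {L q n : ℕ}

/-- The columns of a matrix with the rows `w i`. -/
def column (w : Fin n → Fin L → Fin q) (j : Fin L) : Fin n → Fin q := fun i => w i j

/-- A comparison of the probability that two sets of words lie in a random code with the sum over
the possible coincidences of these words. -/
theorem pow_card_union_le {r : ℝ} (hr : 0 ≤ r) {α : Type*} [DecidableEq α] {B B' : Fin L → α}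
    (hB : Function.Injective B) (hB' : Function.Injective B') :
    r ^ #(univ.image B ∪ univ.image B') ≤ r ^ (2 * L) +
      ∑ S ∈ (univ : Finset (Finset (Fin L))).erase ∅, ∑ ρ : Equiv.Perm (Fin L),
        if ∀ j ∈ S, B j = B' (ρ j) then r ^ (2 * L - #S) else 0 := by
  set S : Finset (Fin L) := {j | B j ∈ univ.image B'} with hS
  have hnn : ∀ (S : Finset (Fin L)) (ρ : Equiv.Perm (Fin L)),
      0 ≤ if ∀ j ∈ S, B j = B' (ρ j) then r ^ (2 * L - #S) else 0 := fun S ρ => by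
    split_ifs <;> positivity
  have hcard : #(univ.image B ∪ univ.image B') = 2 * L - #S := by
    have h1 := card_union_add_card_inter (univ.image B) (univ.image B')
    have h2 : univ.image B ∩ univ.image B' = S.image B := by
      ext x
      simp only [mem_inter, mem_image, mem_univ, true_and, hS, mem_filter]
      constructor
      · rintro ⟨⟨j, rfl⟩, j', hj'⟩; exact ⟨j, ⟨j', hj'⟩, rfl⟩
      · rintro ⟨j, ⟨j', hj'⟩, rfl⟩; exact ⟨⟨j, rfl⟩, j', hj'⟩
    rw [h2, card_image_of_injective _ hB, card_image_of_injective _ hB,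
      card_image_of_injective _ hB', card_univ, Fintype.card_fin] at h1
    omega
  rw [hcard]
  by_cases h0 : S = ∅
  · rw [h0, card_empty, Nat.sub_zero]
    exact le_add_of_nonneg_right (sum_nonneg fun S _ => sum_nonneg fun ρ _ => hnn S ρ)
  -- Matching the common columns gives an injection from S into the positions of B', which extends
  -- to a permutation. The sum over all S and ρ overcounts, which is harmless for an upper bound.
  · have hmem : ∀ j : {j // B j ∈ univ.image B'}, ∃ j', B' j' = B j := fun j => by
      simpa using j.2
    choose f hf using hmem
    have hfi : Function.Injective f := fun a b hab => by
      apply Subtype.ext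
      apply hB
      rw [← hf a, ← hf b, hab]
    let e : {j // B j ∈ univ.image B'} ≃ {j // j ∈ Set.range f} := Equiv.ofInjective f hfi
    let ρ : Equiv.Perm (Fin L) := e.extendSubtype
    have hρ : ∀ j ∈ S, B j = B' (ρ j) := by
      intro j hj
      have hj' : B j ∈ univ.image B' := by simpa [hS] using hj
      rw [Equiv.extendSubtype_apply_of_mem e j hj']
      exact (hf ⟨j, hj'⟩).symm
    calc r ^ (2 * L - #S) = if ∀ j ∈ S, B j = B' (ρ j) then r ^ (2 * L - #S) else 0 := by
          rw [if_pos hρ]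
      _ ≤ ∑ ρ : Equiv.Perm (Fin L), if ∀ j ∈ S, B j = B' (ρ j) then r ^ (2 * L - #S) else 0 :=
          single_le_sum (f := fun ρ : Equiv.Perm (Fin L) =>
            if ∀ j ∈ S, B j = B' (ρ j) then r ^ (2 * L - #S) else 0) (fun ρ _ => hnn S ρ)
            (mem_univ ρ)
      _ ≤ _ := single_le_sum (f := fun S : Finset (Fin L) => ∑ ρ : Equiv.Perm (Fin L),
            if ∀ j ∈ S, B j = B' (ρ j) then r ^ (2 * L - #S) else 0)
            (fun S _ => sum_nonneg fun ρ _ => hnn S ρ) (mem_erase.2 ⟨h0, mem_univ S⟩)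
      _ ≤ _ := le_add_of_nonneg_left (by positivity)

/-- The probability that the columns of a random matrix with independent rows agree with given words
in the positions `S`. -/
theorem sum_prod_agree (τ : (Fin L → Fin q) → ℝ) (S : Finset (Fin L))
    (w' : Fin n → Fin L → Fin q) (ρ : Equiv.Perm (Fin L)) :
    (∑ w : Fin n → Fin L → Fin q, if ∀ j ∈ S, column w j = column w' (ρ j) then
      ∏ i, τ (w i) else 0) = ∏ i, marginal τ S (w' i ∘ ρ) := by
  simp only [marginal]
  rw [prod_univ_sum, Fintype.piFinset_univ]
  refine sum_congr rfl fun w _ => ?_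
  by_cases h : ∀ j ∈ S, column w j = column w' (ρ j)
  · rw [if_pos h]
    refine prod_congr rfl fun i _ => (if_pos fun j hj => ?_).symm
    exact congrFun (h j hj) i
  · rw [if_neg h]
    push Not at h
    obtain ⟨j, hj, hne⟩ := h
    obtain ⟨i, hi⟩ := Function.ne_iff.1 hne
    refine (prod_eq_zero (mem_univ i) (if_neg fun h' => hi ?_)).symm
    exact h' j hj

/-- The random code rarely avoids a set `G` of matrices whose columns are not too correlated. -/
theorem prob_avoids_mul_le {τ : (Fin L → Fin q) → ℝ} (h0 : ∀ u, 0 ≤ τ u) (hτ : ∑ u, τ u = 1)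
    (r : I) (hr : 0 < (r : ℝ)) (G : Set (Fin n → Fin L → Fin q))
    (hinj : ∀ w ∈ G, Function.Injective (column w)) (β : Finset (Fin L) → ℝ)
    (hβ0 : ∀ S, 0 ≤ β S)
    (hβ : ∀ w ∈ G, ∀ S ρ, ∏ i, marginal τ S (w i ∘ (ρ : Equiv.Perm (Fin L))) ≤ β S) :
    productMass τ G ^ 2 * (setBernoulli (Set.univ : Set (Fin n → Fin q)) r).real
        {C | ∀ w ∈ G, ¬ ∀ j, column w j ∈ C} ≤
      ∑ S ∈ (univ : Finset (Finset (Fin L))).erase ∅, L.factorial * (β S * ((r : ℝ) ^ #S)⁻¹) := by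
  classical
  set μ := setBernoulli (Set.univ : Set (Fin n → Fin q)) r with hμ
  set ν : (Fin n → Fin L → Fin q) → ℝ := fun w => if w ∈ G then ∏ i, τ (w i) else 0 with hν
  have hν0 : ∀ w, 0 ≤ ν w := fun w => by
    simp only [hν]; split_ifs
    · exact prod_nonneg fun i _ => h0 _
    · exact le_rfl
  have hνle : ∀ w, ν w ≤ ∏ i, τ (w i) := fun w => by
    simp only [hν]; split_ifs
    · exact le_rfl
    · exact prod_nonneg fun i _ => h0 _
  have hmass : productMass τ G = ∑ w, ν w := by
    unfold productMass; exact sum_congr rfl fun w _ => by simp only [hν]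
  have hνsum : ∑ w, ν w ≤ 1 := by
    calc ∑ w, ν w ≤ ∑ w : Fin n → Fin L → Fin q, ∏ i, τ (w i) := sum_le_sum fun w _ => hνle w
      _ = 1 := by rw [sum_prod_apply, hτ, one_pow]
  -- The matrices of G inside the code are counted with their τ-weights rather than uniformly. Thus
  -- X vanishes on codes that avoid G.
  set X : Set (Fin n → Fin q) → ℝ := fun C => ∑ w, if ∀ j, column w j ∈ C then ν w else 0 with hX
  have hsub : ∀ T : Finset (Fin n → Fin q), ∑ C, (if ∀ x ∈ T, x ∈ C then μ.real {C} else 0) =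
      (r : ℝ) ^ #T := by
    intro T
    rw [← setBernoulli_real_superset T r, ← sum_setBernoulli_real]
    rfl
  have hP1 : ∑ C, μ.real {C} = 1 := by
    simpa using hsub ∅
  have hEX : ∑ C, μ.real {C} * X C = (r : ℝ) ^ L * productMass τ G := by
    rw [hmass, mul_sum]
    simp only [hX, mul_sum]
    rw [sum_comm]
    refine sum_congr rfl fun w _ => ?_
    by_cases hw : w ∈ G
    · have := hsub (univ.image (column w))
      rw [card_image_of_injective _ (hinj w hw), card_univ, Fintype.card_fin] at this
      rw [← this, sum_mul]
      refine sum_congr rfl fun C _ => ?_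
      simp [mul_ite, ite_mul]
    · simp [hν, hw]
  -- Pairs are sorted by their common columns. The term without coincidences equals the square of
  -- the mean, so the remaining sum bounds the variance. In it, w' is kept fixed and the mass of the
  -- matrices w that agree with it on S is a product of marginals, bounded by β S; the L!
  -- permutations account for the factorial.
  have hEX2 : ∑ C, μ.real {C} * X C ^ 2 ≤ (r : ℝ) ^ (2 * L) * productMass τ G ^ 2 +
      ∑ S ∈ (univ : Finset (Finset (Fin L))).erase ∅,
        L.factorial * (β S * (r : ℝ) ^ (2 * L - #S)) := by
    have e1 : ∀ C, μ.real {C} * X C ^ 2 = ∑ w', ∑ w, ν w' * ν w *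
        (if ∀ x ∈ univ.image (column w) ∪ univ.image (column w'), x ∈ C then μ.real {C} else 0) := by
      intro C
      simp only [hX]
      rw [sq, sum_mul_sum, mul_sum]
      refine sum_congr rfl fun w' _ => ?_
      rw [mul_sum]
      refine sum_congr rfl fun w _ => ?_
      have : (∀ x ∈ univ.image (column w) ∪ univ.image (column w'), x ∈ C) ↔
          (∀ j, column w j ∈ C) ∧ ∀ j, column w' j ∈ C := by
        simp only [mem_union, mem_image, mem_univ, true_and]
        exact ⟨fun h => ⟨fun j => h _ (.inl ⟨j, rfl⟩), fun j => h _ (.inr ⟨j, rfl⟩)⟩,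
          by rintro ⟨h1, h2⟩ x (⟨j, rfl⟩ | ⟨j, rfl⟩); exacts [h1 j, h2 j]⟩
      rw [if_congr this rfl rfl]
      by_cases a1 : ∀ j, column w j ∈ C <;> by_cases a2 : ∀ j, column w' j ∈ C <;> simp [a1, a2]
      ring
    simp only [e1]
    rw [sum_comm]
    have e2 : ∀ w' w, ν w' * ν w * (r : ℝ) ^ #(univ.image (column w) ∪ univ.image (column w')) ≤
        ν w' * ν w * ((r : ℝ) ^ (2 * L) +
          ∑ S ∈ (univ : Finset (Finset (Fin L))).erase ∅, ∑ ρ : Equiv.Perm (Fin L),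
            if ∀ j ∈ S, column w j = column w' (ρ j) then (r : ℝ) ^ (2 * L - #S) else 0) := by
      intro w' w
      by_cases hw : w ∈ G
      · by_cases hw' : w' ∈ G
        · exact mul_le_mul_of_nonneg_left (pow_card_union_le hr.le (hinj w hw) (hinj w' hw'))
            (mul_nonneg (hν0 _) (hν0 _))
        · simp [hν, hw']
      · simp [hν, hw]
    calc _ = ∑ w', ∑ w, ν w' * ν w *
          (r : ℝ) ^ #(univ.image (column w) ∪ univ.image (column w')) := by
          refine sum_congr rfl fun w' _ => ?_
          rw [sum_comm]
          refine sum_congr rfl fun w _ => ?_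
          rw [← mul_sum, hsub]
      _ ≤ _ := sum_le_sum fun w' _ => sum_le_sum fun w _ => e2 w' w
      _ = (r : ℝ) ^ (2 * L) * (∑ w, ν w) ^ 2 + ∑ S ∈ (univ : Finset (Finset (Fin L))).erase ∅,
          ∑ ρ : Equiv.Perm (Fin L), ∑ w', ν w' * ((r : ℝ) ^ (2 * L - #S) *
            ∑ w, if ∀ j ∈ S, column w j = column w' (ρ j) then ν w else 0) := by
          simp only [mul_add, sum_add_distrib]
          congr 1
          · rw [sq, sum_mul_sum, mul_sum]
            refine sum_congr rfl fun w' _ => ?_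
            rw [mul_sum]
            exact sum_congr rfl fun w _ => by ring
          · simp only [mul_sum]
            rw [sum_congr rfl fun w' _ => sum_comm]
            rw [sum_comm]
            refine sum_congr rfl fun S _ => ?_
            rw [sum_congr rfl fun w' _ => sum_comm]
            rw [sum_comm]
            refine sum_congr rfl fun ρ _ => sum_congr rfl fun w' _ => sum_congr rfl fun w _ => ?_
            split_ifs <;> ring
      _ ≤ _ := by
          rw [hmass]
          gcongr with S hS
          have hρ : ∀ ρ : Equiv.Perm (Fin L), ∑ w', ν w' * ((r : ℝ) ^ (2 * L - #S) *
              ∑ w, if ∀ j ∈ S, column w j = column w' (ρ j) then ν w else 0) ≤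
              β S * (r : ℝ) ^ (2 * L - #S) := by
            intro ρ
            calc _ ≤ ∑ w', ν w' * ((r : ℝ) ^ (2 * L - #S) * β S) := by
                  refine sum_le_sum fun w' _ => ?_
                  by_cases hw' : w' ∈ G
                  · refine mul_le_mul_of_nonneg_left (mul_le_mul_of_nonneg_left ?_ (by positivity))
                      (hν0 _)
                    refine le_trans ?_ (hβ w' hw' S ρ)
                    rw [← sum_prod_agree]
                    refine sum_le_sum fun w _ => ?_
                    split_ifs
                    · exact hνle w
                    · exact le_rfl
                  · simp [hν, hw']
              _ = (∑ w', ν w') * ((r : ℝ) ^ (2 * L - #S) * β S) := by rw [sum_mul]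
              _ ≤ 1 * ((r : ℝ) ^ (2 * L - #S) * β S) :=
                  mul_le_mul_of_nonneg_right hνsum (mul_nonneg (by positivity) (hβ0 S))
              _ = _ := by ring
          calc _ ≤ ∑ ρ : Equiv.Perm (Fin L), β S * (r : ℝ) ^ (2 * L - #S) :=
                sum_le_sum fun ρ _ => hρ ρ
            _ = _ := by
              rw [sum_const, card_univ, Fintype.card_perm, Fintype.card_fin, nsmul_eq_mul]
  have hX0 : ∀ C ∈ {C | ∀ w ∈ G, ¬ ∀ j, column w j ∈ C}, X C = 0 := by
    intro C hC
    refine sum_eq_zero fun w _ => ?_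
    by_cases hw : w ∈ G
    · rw [if_neg (hC w hw)]
    · simp [hν, hw]
  have key := sq_mul_sum_le_of_second_moment (P := fun C => μ.real {C})
    (fun C => measureReal_nonneg) hP1 {C | ∀ w ∈ G, ¬ ∀ j, column w j ∈ C} hX0
  rw [sum_setBernoulli_real, hEX] at key
  have hr2 : (0 : ℝ) < (r : ℝ) ^ (2 * L) := by positivity
  refine le_of_mul_le_mul_left ?_ hr2
  rw [mul_sum]
  have e3 : ∀ S ∈ (univ : Finset (Finset (Fin L))).erase ∅,
      (r : ℝ) ^ (2 * L) * (L.factorial * (β S * ((r : ℝ) ^ #S)⁻¹)) =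
        L.factorial * (β S * (r : ℝ) ^ (2 * L - #S)) := by
    intro S _
    have : #S ≤ L := by simpa using card_le_univ S
    rw [pow_sub₀ _ hr.ne' (by omega)]
    ring
  rw [sum_congr rfl e3]
  have e4 : ((r : ℝ) ^ L * productMass τ G) ^ 2 = (r : ℝ) ^ (2 * L) * productMass τ G ^ 2 := by
    rw [mul_pow, ← pow_mul, mul_comm L 2]
  rw [e4] at key
  linarith

end ListRecovery

/-! ### Random codes of large rate contain bad matrices -/

namespace ListRecovery

open Finset ProbabilityTheory MeasureTheory Filter Topology

variable {q ℓ L : ℕ}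

theorem inclusionProb_pow_inv (hq : 2 ≤ q) (n : ℕ) (R : unitInterval) (k : ℕ) :
    ((inclusionProb q n R : ℝ) ^ k)⁻¹ = Real.exp (k * ((1 - R) * Real.log q) * n) := by
  have hq' : (0 : ℝ) < q := by exact_mod_cast (by omega : 0 < q)
  change (((q : ℝ) ^ (-((n : ℝ) * (1 - (R : ℝ))))) ^ k)⁻¹ = _
  rw [Real.rpow_def_of_pos hq', ← Real.exp_nat_mul, ← Real.exp_neg]
  congr 1
  ring

theorem inclusionProb_pos (hq : 2 ≤ q) (n : ℕ) (R : unitInterval) :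
    0 < (inclusionProb q n R : ℝ) := by
  have hq' : (0 : ℝ) < q := by exact_mod_cast (by omega : 0 < q)
  exact Real.rpow_pos_of_pos hq' _

/-- The second alternative serves p = 0, where no mean lies strictly below p: the number of letters
in s is an integer of mean 0, so it vanishes almost surely by Markov's inequality. -/
theorem tendsto_productMass_lt_sum {U : Type*} [Fintype U] {τ : U → ℝ} (h0 : ∀ u, 0 ≤ τ u)
    (hτ : ∑ u, τ u = 1) (s : Set U) [DecidablePred (· ∈ s)] {p : ℝ}
    (h : (∑ u, τ u * if u ∈ s then (1 : ℝ) else 0) < p ∨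
      (0 ≤ p ∧ (∑ u, τ u * if u ∈ s then (1 : ℝ) else 0) = 0)) :
    Tendsto (fun n : ℕ => productMass τ
      {w : Fin n → U | p * n < ∑ i, if w i ∈ s then (1 : ℝ) else 0}) atTop (𝓝 0) := by
  rcases h with h | ⟨hp, h⟩
  · refine squeeze_zero (fun n => productMass_nonneg h0 _) (fun n => productMass_mono h0 ?_)
      (tendsto_productMass_of_mean_lt h0 hτ (fun u => if u ∈ s then (1 : ℝ) else 0) h)
    intro w hw
    have hw' : p * n < ∑ i, if w i ∈ s then (1 : ℝ) else 0 := hw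
    exact hw'.le
  · have h1 : ∀ n : ℕ, productMass τ
        {w : Fin n → U | p * n < ∑ i, if w i ∈ s then (1 : ℝ) else 0} = 0 := by
      intro n
      refine le_antisymm ?_ (productMass_nonneg h0 _)
      have h2 := sum_prod_mul_sum hτ (f := fun u => if u ∈ s then (1 : ℝ) else 0) n
      rw [h, mul_zero] at h2
      refine le_trans ?_ h2.le
      rw [productMass]
      refine sum_le_sum fun w _ => ?_
      have hw0 := prod_nonneg fun i (_ : i ∈ univ) => h0 (w i)
      have h3 : 0 ≤ ∑ i, if w i ∈ s then (1 : ℝ) else 0 :=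
        sum_nonneg fun i _ => by split_ifs <;> norm_num
      split_ifs with hw
      · have hw' : p * n < ∑ i, if w i ∈ s then (1 : ℝ) else 0 := hw
        have h4 : 0 < ∑ i, if w i ∈ s then (1 : ℝ) else 0 := lt_of_le_of_lt (by positivity) hw'
        rw [sum_boole] at h4 ⊢
        have h5 : (1 : ℝ) ≤ #{i | w i ∈ s} := by
          exact_mod_cast Nat.cast_pos.1 h4
        exact le_mul_of_one_le_right hw0 h5
      · exact mul_nonneg hw0 h3
    simp only [h1]
    exact tendsto_const_nhds

/-- If the entropy of an exchangeable distribution of rows that obeys the constraints of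
list-recovery is large, then random codes contain bad matrices, uniformly in the rate. -/
theorem eventually_le_probSatisfies (hq : 2 ≤ q) (hL : 1 ≤ L) {p : ℝ}
    (K : (Fin L → Fin q) → Finset (Fin q)) (hK : ∀ u, #(K u) = ℓ) {τ : (Fin L → Fin q) → ℝ}
    (h0 : ∀ u, 0 ≤ τ u) (hτ : ∑ u, τ u = 1)
    (hs : ∀ (ρ : Equiv.Perm (Fin L)) u, τ (u ∘ ρ) = τ u)
    (hc : ∀ j, (∑ u, τ u * if u j ∉ K u then (1 : ℝ) else 0) < p ∨
      (0 ≤ p ∧ (∑ u, τ u * if u j ∉ K u then (1 : ℝ) else 0) = 0))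
    (hd : ∀ i j, i ≠ j → (∑ u, if u i = u j then τ u else 0) < 1)
    {R₀ : ℝ} (hR : L * ((1 - R₀) * Real.log q) < marginalEntropy τ univ) {η : ℝ} (hη : 0 < η) :
    ∀ᶠ n in atTop, ∀ R : unitInterval, R₀ ≤ R →
      1 - η ≤ probSatisfies (NotListRecoverable q p ℓ L) n R := by
  classical
  have hL' : (0 : ℝ) < L := by exact_mod_cast hL
  have hlog : 0 < Real.log q := Real.log_pos (by exact_mod_cast hq)
  -- κ is the surplus of entropy per column over the cost of including a word at rate R₀. Half of it
  -- is spent as tolerance for typicality.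
  set κ := marginalEntropy τ univ / L - (1 - R₀) * Real.log q with hκ
  have hκ0 : 0 < κ := by
    rw [hκ, sub_pos, lt_div_iff₀ hL']; linarith
  set δ := κ / 2 with hδ
  have hδ0 : 0 < δ := by positivity
  -- The atypical events: two columns coincide, a column violates the constraint of list-recovery,
  -- or an empirical log-marginal exceeds its mean by more than the tolerance.
  let A : (n : ℕ) → ({ij : Fin L × Fin L // ij.1 ≠ ij.2} ⊕ Fin L ⊕
      (Finset (Fin L) × Equiv.Perm (Fin L))) → Set (Fin n → Fin L → Fin q) := fun n =>
    Sum.elim (fun ij => {w | ∀ i, w i ∈ {u : Fin L → Fin q | u ij.1.1 = u ij.1.2}})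
      (Sum.elim (fun j => {w | p * n < ∑ i,
          if w i ∈ {u : Fin L → Fin q | u j ∉ K u} then (1 : ℝ) else 0})
        (fun Sρ => {w | (-marginalEntropy τ Sρ.1 + δ) * n ≤
          ∑ i, Real.log (marginal τ Sρ.1 (w i ∘ Sρ.2))}))
  have hA : ∀ i, Tendsto (fun n => productMass τ (A n i)) atTop (𝓝 0) := by
    rintro (⟨⟨i, j⟩, hij⟩ | j | ⟨S, ρ⟩)
    · exact tendsto_productMass_forall h0 _ (by simpa using hd i j hij)
    · exact tendsto_productMass_lt_sum h0 hτ _ (by simpa using hc j)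
    · refine tendsto_productMass_of_mean_lt h0 hτ (fun u => Real.log (marginal τ S (u ∘ ρ))) ?_
      rw [sum_mul_log_marginal_comp hs]
      linarith
  have hA' : Tendsto (fun n => ∑ i, productMass τ (A n i)) atTop (𝓝 0) := by
    have := tendsto_finsetSum univ fun i _ => hA i
    simpa using this
  -- The factor 4 compensates for the squared mass of G, which is at least (1/2)^2.
  have hE : Tendsto (fun n : ℕ => 4 * (∑ S ∈ (univ : Finset (Finset (Fin L))).erase ∅,
      (L.factorial : ℝ) * Real.exp (-δ * n))) atTop (𝓝 0) := by
    have h1 : Tendsto (fun n : ℕ => Real.exp (-δ * n)) atTop (𝓝 0) := by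
      refine Real.tendsto_exp_atBot.comp ?_
      exact (tendsto_natCast_atTop_atTop).const_mul_atTop_of_neg (by linarith)
    have h2 := (tendsto_finsetSum ((univ : Finset (Finset (Fin L))).erase ∅)
      fun S _ => h1.const_mul (L.factorial : ℝ)).const_mul 4
    simpa using h2
  filter_upwards [hA'.eventually_lt_const (show (0 : ℝ) < 1 / 2 by norm_num),
    hE.eventually_lt_const hη] with n hn1 hn2
  intro R hR0
  set G : Set (Fin n → Fin L → Fin q) := (⋃ i, A n i)ᶜ with hG
  have hmass : 1 / 2 ≤ productMass τ G := by
    rw [hG, productMass_compl hτ]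
    have := productMass_iUnion_le h0 (A n)
    linarith
  have hnot : ∀ w ∈ G, ∀ i, w ∉ A n i := fun w hw i hi => hw (Set.mem_iUnion.2 ⟨i, hi⟩)
  have hinj : ∀ w ∈ G, Function.Injective (column w) := by
    intro w hw i j hij
    by_contra hne
    exact hnot w hw (.inl ⟨(i, j), hne⟩) fun i => congrFun hij i
  have hbad : ∀ w ∈ G, IsBadMatrix p ℓ L (column w) := by
    refine fun w hw => ⟨hinj w hw, fun i => K (w i), fun i => hK _, fun j => ?_⟩
    have h1 := hnot w hw (.inr (.inl j))
    have h2 : ¬ p * n < ∑ i, if w i ∈ {u : Fin L → Fin q | u j ∉ K u} then (1 : ℝ) else 0 := h1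
    rw [not_lt, sum_boole] at h2
    exact h2
  have hβ : ∀ w ∈ G, ∀ S ρ, ∏ i, marginal τ S (w i ∘ (ρ : Equiv.Perm (Fin L))) ≤
      Real.exp ((-marginalEntropy τ S + δ) * n) := by
    intro w hw S ρ
    have h1 : ¬ (-marginalEntropy τ S + δ) * n ≤ ∑ i, Real.log (marginal τ S (w i ∘ ρ)) :=
      hnot w hw (.inr (.inr (S, ρ)))
    rw [not_le] at h1
    refine le_trans ?_ (Real.exp_le_exp.2 h1.le)
    rw [Real.exp_sum]
    -- A marginal may vanish; with log 0 = 0 it is then bounded by 1, so the estimate persists.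
    exact prod_le_prod (fun i _ => marginal_nonneg h0 _ _) fun i _ => Real.le_exp_log _
  have key := prob_avoids_mul_le h0 hτ (inclusionProb q n R) (inclusionProb_pos hq n R) G hinj _
    (fun S => (Real.exp_pos _).le) hβ
  set μ := setBernoulli (Set.univ : Set (Fin n → Fin q)) (inclusionProb q n R) with hμ
  set av : Set (Set (Fin n → Fin q)) := {C | ∀ w ∈ G, ¬ ∀ j, column w j ∈ C} with hav
  have h3 : ∑ S ∈ (univ : Finset (Finset (Fin L))).erase ∅, (L.factorial : ℝ) *
      (Real.exp ((-marginalEntropy τ S + δ) * n) * ((inclusionProb q n R : ℝ) ^ #S)⁻¹) ≤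
      ∑ S ∈ (univ : Finset (Finset (Fin L))).erase ∅, (L.factorial : ℝ) * Real.exp (-δ * n) := by
    refine sum_le_sum fun S hS => ?_
    rw [inclusionProb_pow_inv hq, ← Real.exp_add]
    gcongr
    rw [← add_mul]
    gcongr
    have hS1 : (1 : ℝ) ≤ #S := by
      have : S.Nonempty := nonempty_iff_ne_empty.2 (mem_erase.1 hS).1
      exact_mod_cast this.card_pos
    -- By Han's inequality the exponent of the overlap S is at most -|S| κ + δ ≤ -δ. A rate above R₀
    -- only decreases it, so the bound is uniform in R.
    have hHan := card_mul_marginalEntropy_univ_le h0 hτ hs S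
    have h4 : #S * (marginalEntropy τ univ / L) ≤ marginalEntropy τ S := by
      rw [← mul_div_assoc, div_le_iff₀ hL']; linarith
    have h5 : #S * ((1 - (R : ℝ)) * Real.log q) ≤ #S * ((1 - R₀) * Real.log q) := by gcongr
    have h6 : κ ≤ #S * κ := le_mul_of_one_le_left hκ0.le hS1
    have h7 : #S * κ = #S * (marginalEntropy τ univ / L) - #S * ((1 - R₀) * Real.log q) := by
      rw [hκ]; ring
    linarith
  have h8 : μ.real av ≤ η := by
    have h9 : (1 / 2 : ℝ) ^ 2 * μ.real av ≤ productMass τ G ^ 2 * μ.real av := by gcongr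
    have h10 := h9.trans (key.trans h3)
    linarith
  have h11 : avᶜ ⊆ {C | NotListRecoverable q p ℓ L n C} := by
    intro C hC
    rw [hav, Set.mem_compl_iff, Set.mem_ofPred_eq] at hC
    push Not at hC
    obtain ⟨w, hw, hwC⟩ := hC
    exact not_not.2 ⟨column w, hbad w hw, hwC⟩
  calc 1 - η ≤ 1 - μ.real av := by linarith
    _ = μ.real avᶜ := (probReal_compl_eq_one_sub (Set.toFinite av).measurableSet).symm
    _ ≤ _ := measureReal_mono h11

/-! ### The weights of rows -/

/-- The generating function of the deficits of words. -/
noncomputable def weightSum (q ℓ L : ℕ) (x : ℝ) : ℝ :=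
  ∑ u : Fin L → Fin q, x ^ deficit ℓ (histogram u)

/-- `weightSum`, with each word weighted by its deficit. -/
noncomputable def deficitSum (q ℓ L : ℕ) (x : ℝ) : ℝ :=
  ∑ u : Fin L → Fin q, (deficit ℓ (histogram u) : ℝ) * x ^ deficit ℓ (histogram u)

/-- The distribution of words whose density is a power of `x` with their deficit as exponent. -/
noncomputable def gibbs (q ℓ L : ℕ) (x : ℝ) (u : Fin L → Fin q) : ℝ :=
  x ^ deficit ℓ (histogram u) / weightSum q ℓ L x

theorem histogram_comp_perm (ρ : Equiv.Perm (Fin L)) (u : Fin L → Fin q) :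
    histogram (u ∘ ρ) = histogram u := by
  ext a
  unfold histogram
  rw [← card_map ρ.toEmbedding]
  congr 1
  ext j
  simp only [Finset.mem_map, mem_filter, mem_univ, true_and, Function.comp_apply, Equiv.coe_toEmbedding]
  exact ⟨by rintro ⟨i, hi, rfl⟩; exact hi, fun h => ⟨ρ.symm j, by simpa using h, by simp⟩⟩

theorem deficit_eq_zero (hℓ : ℓ ≤ q) {u : Fin L → Fin q} {K : Finset (Fin q)}
    (hK : #K ≤ ℓ) (h : ∀ j, u j ∈ K) : deficit ℓ (histogram u) = 0 := by
  obtain ⟨K', h1, -, h2⟩ := exists_subsuperset_card_eq (subset_univ K) hK (by simpa using hℓ)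
  have := deficit_le (histogram u) h2
  rw [sum_histogram] at this
  rw [← Nat.le_zero]
  refine this.trans (le_of_eq ?_)
  rw [card_eq_zero, filter_eq_empty_iff]
  exact fun j _ hj => (mem_compl.1 hj) (h1 (h j))

/-- Constant words have deficit 0 and contribute x^0 = 1, also at x = 0. -/
theorem one_le_weightSum (hq : 2 ≤ q) (hℓ : 1 ≤ ℓ) (hℓq : ℓ ≤ q) {x : ℝ} (hx : 0 ≤ x) :
    1 ≤ weightSum q ℓ L x := by
  have h : deficit ℓ (histogram fun _ : Fin L => (⟨0, by omega⟩ : Fin q)) = 0 :=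
    deficit_eq_zero hℓq (K := {⟨0, by omega⟩}) (by simpa using hℓ) (by simp)
  have := single_le_sum (f := fun u : Fin L → Fin q => x ^ deficit ℓ (histogram u))
    (fun u _ => by positivity) (mem_univ fun _ => (⟨0, by omega⟩ : Fin q))
  simp only [h, pow_zero] at this
  exact this

theorem gibbs_nonneg {x : ℝ} (hx : 0 ≤ x) (u : Fin L → Fin q) : 0 ≤ gibbs q ℓ L x u :=
  div_nonneg (by positivity) (sum_nonneg fun _ _ => by positivity)

theorem sum_gibbs (hq : 2 ≤ q) (hℓ : 1 ≤ ℓ) (hℓq : ℓ ≤ q) {x : ℝ} (hx : 0 ≤ x) :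
    ∑ u, gibbs q ℓ L x u = 1 := by
  unfold gibbs
  rw [← sum_div]
  exact div_self (by have := one_le_weightSum (L := L) hq hℓ hℓq hx; unfold weightSum at *; linarith)

theorem gibbs_comp_perm (x : ℝ) (ρ : Equiv.Perm (Fin L)) (u : Fin L → Fin q) :
    gibbs q ℓ L x (u ∘ ρ) = gibbs q ℓ L x u := by
  rw [gibbs, gibbs, histogram_comp_perm]

theorem sum_gibbs_mul_deficit (x : ℝ) :
    ∑ u, gibbs q ℓ L x u * deficit ℓ (histogram u) = deficitSum q ℓ L x / weightSum q ℓ L x := by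
  rw [deficitSum, sum_div]
  exact sum_congr rfl fun u _ => by rw [gibbs]; ring

/-- The logarithm of a Gibbs probability is affine in the deficit. Where the weight vanishes both
sides contribute 0, so x = 0 is allowed. -/
theorem entropy_gibbs (hq : 2 ≤ q) (hℓ : 1 ≤ ℓ) (hℓq : ℓ ≤ q) {x : ℝ} (hx : 0 ≤ x) :
    ∑ u, Real.negMulLog (gibbs q ℓ L x u) = Real.log (weightSum q ℓ L x) -
      deficitSum q ℓ L x / weightSum q ℓ L x * Real.log x := by
  have hZ := one_le_weightSum (L := L) hq hℓ hℓq hx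
  rw [← sum_gibbs_mul_deficit, sum_mul, ← one_mul (Real.log (weightSum q ℓ L x)),
    ← sum_gibbs (L := L) hq hℓ hℓq hx, sum_mul, ← sum_sub_distrib]
  refine sum_congr rfl fun u _ => ?_
  rw [Real.negMulLog]
  by_cases h : x ^ deficit ℓ (histogram u) = 0
  · simp [gibbs, h]
  · have : Real.log (gibbs q ℓ L x u) =
        deficit ℓ (histogram u) * Real.log x - Real.log (weightSum q ℓ L x) := by
      rw [gibbs, Real.log_div h (by linarith), Real.log_pow]
    rw [this]; ring

/-- The entropy is at most the logarithm of the number of outcomes. -/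
theorem sum_negMulLog_le {U : Type*} [Fintype U] [Nonempty U] {τ : U → ℝ} (h0 : ∀ u, 0 ≤ τ u)
    (hτ : ∑ u, τ u = 1) : ∑ u, Real.negMulLog (τ u) ≤ Real.log (Fintype.card U) := by
  have hN : (0 : ℝ) < Fintype.card U := by exact_mod_cast Fintype.card_pos
  have h : ∀ u, Real.negMulLog (τ u) ≤ τ u * Real.log (Fintype.card U) +
      (1 / Fintype.card U - τ u) := by
    intro u
    rcases (h0 u).eq_or_lt with hu | hu
    · rw [← hu]; simp
    · have := Real.log_le_sub_one_of_pos (div_pos one_pos (mul_pos hu hN))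
      rw [one_div, Real.log_inv, Real.log_mul hu.ne' hN.ne', mul_inv] at this
      have h2 := mul_le_mul_of_nonneg_left this hu.le
      have h3 : τ u * ((τ u)⁻¹ * (Fintype.card U : ℝ)⁻¹ - 1) = (1 / Fintype.card U - τ u) := by
        field_simp
      rw [h3] at h2
      rw [Real.negMulLog]
      linarith
  calc _ ≤ _ := sum_le_sum fun u _ => h u
    _ = _ := by
      rw [sum_add_distrib, ← sum_mul, hτ, sum_sub_distrib, hτ, sum_const, card_univ, nsmul_eq_mul]
      field_simp
      ring

end ListRecovery

namespace ListRecovery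

open Finset ProbabilityTheory MeasureTheory Filter Topology

variable {q ℓ L : ℕ}

/-! ### The first moment -/

/-- Count the entries outside the sets K i by rows and by columns: row i has at least its deficit of
them, and each column at most p n. -/
theorem sum_deficit_le_of_isBadMatrix {n : ℕ} {p : ℝ} {w : Fin n → Fin L → Fin q}
    (h : IsBadMatrix p ℓ L (column w)) :
    ((∑ i, deficit ℓ (histogram (w i)) : ℕ) : ℝ) ≤ p * L * n := by
  obtain ⟨-, K, hK, hB⟩ := h
  have h1 : ∑ i, deficit ℓ (histogram (w i)) ≤ ∑ j : Fin L, #{i | column w j i ∉ K i} := by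
    calc _ ≤ ∑ i, #{j | w i j ∈ (K i)ᶜ} := sum_le_sum fun i _ => by
          rw [← sum_histogram]; exact deficit_le _ (hK i)
      _ = _ := by
          simp only [card_filter]
          rw [sum_comm]
          exact sum_congr rfl fun j _ => sum_congr rfl fun i _ => by
            by_cases h : w i j ∈ K i <;> simp [column, h]
  calc ((∑ i, deficit ℓ (histogram (w i)) : ℕ) : ℝ)
      ≤ ((∑ j : Fin L, #{i | column w j i ∉ K i} : ℕ) : ℝ) := by exact_mod_cast h1
    _ = ∑ j : Fin L, (#{i | column w j i ∉ K i} : ℝ) := by push_cast; rfl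
    _ ≤ ∑ j : Fin L, p * n := sum_le_sum fun j _ => hB j
    _ = p * L * n := by simp; ring

/-- A Chernoff bound: since x ≤ 1 and the total deficit is at most p L n, every bad matrix has
weight at least 1, and the weights of all matrices sum to a product over rows. For p = x = 0 the
deficits all vanish and 0^0 = 1. -/
theorem card_isBadMatrix_le {p x : ℝ} (hx : 0 ≤ x) (hx1 : x ≤ 1)
    (hpx : 0 < x ∨ (p = 0 ∧ x = 0)) (n : ℕ) [DecidablePred fun w : Fin n → Fin L → Fin q =>
      IsBadMatrix p ℓ L (column w)] :
    (#{w : Fin n → Fin L → Fin q | IsBadMatrix p ℓ L (column w)} : ℝ) ≤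
      (weightSum q ℓ L x * x ^ (-(p * L))) ^ n := by
  have h1 : ∀ w : Fin n → Fin L → Fin q, IsBadMatrix p ℓ L (column w) →
      1 ≤ (∏ i, x ^ deficit ℓ (histogram (w i))) * (x ^ (-(p * L))) ^ n := by
    intro w hw
    have h2 := sum_deficit_le_of_isBadMatrix hw
    rw [prod_pow_eq_pow_sum]
    rcases hpx with hx0 | ⟨rfl, rfl⟩
    · rw [← Real.rpow_natCast, ← Real.rpow_natCast, ← Real.rpow_mul hx, ← Real.rpow_add hx0]
      refine Real.one_le_rpow_of_pos_of_le_one_of_nonpos hx0 hx1 ?_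
      linarith
    · rw [zero_mul, zero_mul] at h2
      have : ∑ i, deficit ℓ (histogram (w i)) = 0 := by
        exact_mod_cast le_antisymm h2 (by positivity)
      simp [this]
  rw [mul_pow, weightSum, ← sum_prod_apply, sum_mul, card_filter, Nat.cast_sum]
  refine sum_le_sum fun w _ => ?_
  split_ifs with hw
  · simpa using h1 w hw
  · rw [Nat.cast_zero]
    exact mul_nonneg (prod_nonneg fun i _ => pow_nonneg hx _)
      (pow_nonneg (Real.rpow_nonneg hx _) _)

theorem probSatisfies_le {p x : ℝ} (hx : 0 ≤ x) (hx1 : x ≤ 1)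
    (hpx : 0 < x ∨ (p = 0 ∧ x = 0)) (n : ℕ) (R : unitInterval) :
    probSatisfies (NotListRecoverable q p ℓ L) n R ≤
      (weightSum q ℓ L x * x ^ (-(p * L))) ^ n * (inclusionProb q n R : ℝ) ^ L := by
  classical
  set μ := setBernoulli (Set.univ : Set (Fin n → Fin q)) (inclusionProb q n R) with hμ
  have h1 : {C : Code q n | NotListRecoverable q p ℓ L n C} ⊆
      ⋃ w ∈ ({w : Fin n → Fin L → Fin q | IsBadMatrix p ℓ L (column w)} :
        Finset (Fin n → Fin L → Fin q)),
        {C | ∀ y ∈ univ.image (column w), y ∈ C} := by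
    intro C hC
    obtain ⟨B, hB, hBC⟩ := not_not.1 hC
    refine Set.mem_iUnion₂.2 ⟨fun i j => B j i, mem_filter.2 ⟨mem_univ _, hB⟩, fun y hy => ?_⟩
    obtain ⟨j, -, rfl⟩ := mem_image.1 hy
    exact hBC j
  calc probSatisfies (NotListRecoverable q p ℓ L) n R ≤ μ.real _ := measureReal_mono h1 (measure_ne_top _ _)
    _ ≤ ∑ w ∈ ({w : Fin n → Fin L → Fin q | IsBadMatrix p ℓ L (column w)} :
        Finset (Fin n → Fin L → Fin q)), μ.real {C | ∀ y ∈ univ.image (column w), y ∈ C} :=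
        measureReal_biUnion_finset_le _ _
    _ = ∑ w ∈ ({w : Fin n → Fin L → Fin q | IsBadMatrix p ℓ L (column w)} :
        Finset (Fin n → Fin L → Fin q)), (inclusionProb q n R : ℝ) ^ L := by
        refine sum_congr rfl fun w hw => ?_
        rw [mem_filter] at hw
        rw [setBernoulli_real_superset, card_image_of_injective _ hw.2.1, card_univ,
          Fintype.card_fin]
    _ ≤ _ := by
        rw [sum_const, nsmul_eq_mul]
        have := (inclusionProb q n R).2.1
        gcongr
        exact card_isBadMatrix_le hx hx1 hpx n

theorem tendsto_probSatisfies_zero (hq : 2 ≤ q) (hℓ : 1 ≤ ℓ) (hℓq : ℓ ≤ q) {p x : ℝ}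
    (hx : 0 ≤ x) (hx1 : x ≤ 1) (hpx : 0 < x ∨ (p = 0 ∧ x = 0)) {R : unitInterval}
    (hR : Real.log (weightSum q ℓ L x) - p * L * Real.log x < L * ((1 - R) * Real.log q)) :
    Tendsto (fun n => probSatisfies (NotListRecoverable q p ℓ L) n R) atTop (𝓝 0) := by
  have hZ := one_le_weightSum (L := L) hq hℓ hℓq hx
  set E := Real.log (weightSum q ℓ L x) - p * L * Real.log x with hE
  have hM : weightSum q ℓ L x * x ^ (-(p * L)) = Real.exp E := by
    rcases hpx with hx0 | ⟨rfl, rfl⟩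
    · rw [hE, Real.exp_sub, Real.exp_log (by linarith), Real.rpow_neg hx, Real.rpow_def_of_pos hx0,
        div_eq_mul_inv, mul_comm (Real.log x)]
    · rw [hE]; simp [Real.exp_log (show 0 < weightSum q ℓ L 0 by linarith)]
  have h1 : ∀ n, probSatisfies (NotListRecoverable q p ℓ L) n R ≤
      Real.exp ((E - L * ((1 - R) * Real.log q)) * n) := by
    intro n
    refine (probSatisfies_le hx hx1 hpx n R).trans (le_of_eq ?_)
    rw [← inv_inv ((inclusionProb q n R : ℝ) ^ L), inclusionProb_pow_inv hq, hM, ← Real.exp_nat_mul,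
      ← Real.exp_neg, ← Real.exp_add]
    congr 1
    ring
  refine squeeze_zero (fun n => measureReal_nonneg) h1 ?_
  refine Real.tendsto_exp_atBot.comp ?_
  exact (tendsto_natCast_atTop_atTop).const_mul_atTop_of_neg (by linarith)

/-! ### The formula for the threshold rate -/

/-- Criterion for a threshold rate. -/
theorem isThresholdRate_of_forall {P : CodeProperty q} {r : ℝ} (hr : r ∈ Set.Icc (0 : ℝ) 1)
    (below : ∀ R : unitInterval, (R : ℝ) < r → Tendsto (fun n => probSatisfies P n R) atTop (𝓝 0))
    (above : ∀ R₀ : ℝ, r < R₀ → ∀ η > 0, ∀ᶠ n in atTop, ∀ R : unitInterval, R₀ ≤ R →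
      1 - η ≤ probSatisfies P n R) : IsThresholdRate P r where
  mem := hr
  below := below
  above R hR := by
    rw [tendsto_order]
    constructor
    · intro a ha
      filter_upwards [above R hR ((1 - a) / 2) (by linarith)] with n hn
      have := hn R le_rfl
      linarith
    · intro a ha
      refine .of_forall fun n => lt_of_le_of_lt ?_ ha
      exact measureReal_le_one
  tendsto := by
    have hbdd : ∀ n, BddAbove ((fun R : unitInterval => (R : ℝ)) ''
        {R : unitInterval | probSatisfies P n R ≤ 1 / 2}) := fun n =>
      ⟨1, by rintro _ ⟨R, -, rfl⟩; exact R.2.2⟩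
    rw [tendsto_order]
    constructor
    · intro a ha
      rcases lt_or_ge a 0 with ha0 | ha0
      · refine .of_forall fun n => lt_of_lt_of_le ha0 (Real.sSup_nonneg ?_)
        rintro _ ⟨R, -, rfl⟩; exact R.2.1
      · obtain ⟨b, hab, hbr⟩ := exists_between ha
        have hb : b ∈ unitInterval := ⟨by linarith, by linarith [hr.2]⟩
        filter_upwards [(below ⟨b, hb⟩ hbr).eventually_lt_const
          (show (0 : ℝ) < 1 / 2 by norm_num)] with n hn
        exact hab.trans_le (le_csSup (hbdd n) ⟨⟨b, hb⟩, hn.le, rfl⟩)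
    · intro a ha
      obtain ⟨b, hrb, hba⟩ := exists_between ha
      -- Every R ≥ b has probability at least 3/4, which exceeds 1/2, so b bounds the supremum. This
      -- needs `above` uniformly in R.
      filter_upwards [above b hrb (1 / 4) (by norm_num)] with n hn
      refine lt_of_le_of_lt (Real.sSup_le ?_ (hr.1.trans hrb.le)) hba
      rintro _ ⟨R, hR, rfl⟩
      by_contra hlt
      have h1 := hn R (not_le.1 hlt).le
      have h2 : probSatisfies P n R ≤ 1 / 2 := hR
      linarith

/-- A set of `ℓ` symbols that covers as many letters of a word with the histogram `h` as
possible. -/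
noncomputable def bestSet (hℓq : ℓ ≤ q) (h : Fin q → ℕ) : Finset (Fin q) :=
  (exists_deficit_eq hℓq h).choose

theorem card_bestSet (hℓq : ℓ ≤ q) (h : Fin q → ℕ) : #(bestSet hℓq h) = ℓ :=
  (exists_deficit_eq hℓq h).choose_spec.1

theorem card_notMem_bestSet (hℓq : ℓ ≤ q) (u : Fin L → Fin q) :
    #{j | u j ∉ bestSet hℓq (histogram u)} = deficit ℓ (histogram u) := by
  rw [← (exists_deficit_eq hℓq (histogram u)).choose_spec.2, sum_histogram]
  refine congrArg card (filter_congr fun j _ => ?_)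
  rw [mem_compl, bestSet]

/-- For exchangeable words every letter has the same probability of not being covered. -/
theorem mul_sum_notMem_bestSet (hℓq : ℓ ≤ q) {τ : (Fin L → Fin q) → ℝ}
    (hs : ∀ (ρ : Equiv.Perm (Fin L)) u, τ (u ∘ ρ) = τ u) (j : Fin L) :
    L * (∑ u, τ u * if u j ∉ bestSet hℓq (histogram u) then (1 : ℝ) else 0) =
      ∑ u, τ u * deficit ℓ (histogram u) := by
  have h1 : ∀ j' : Fin L, (∑ u, τ u * if u j' ∉ bestSet hℓq (histogram u) then (1 : ℝ) else 0) =
      ∑ u, τ u * if u j ∉ bestSet hℓq (histogram u) then (1 : ℝ) else 0 := by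
    intro j'
    rw [← ((Equiv.swap j j').arrowCongr (Equiv.refl (Fin q))).symm.sum_comp]
    refine sum_congr rfl fun u _ => ?_
    have : ((Equiv.swap j j').arrowCongr (Equiv.refl (Fin q))).symm u = u ∘ Equiv.swap j j' := by
      ext i; simp [Equiv.arrowCongr]
    rw [this, hs, histogram_comp_perm]
    simp
  calc _ = ∑ j' : Fin L, ∑ u, τ u * if u j' ∉ bestSet hℓq (histogram u) then (1 : ℝ) else 0 := by
        simp only [h1, sum_const, card_univ, Fintype.card_fin, nsmul_eq_mul]
    _ = _ := by
        rw [sum_comm]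
        refine sum_congr rfl fun u _ => ?_
        rw [← mul_sum, ← card_notMem_bestSet hℓq, sum_boole]

/-- The threshold rate for list-recovery in terms of the saddle point `x`. -/
theorem isThresholdRate_notListRecoverable (hq : 2 ≤ q) (hℓ : 1 ≤ ℓ) (hℓq : ℓ ≤ q) (hL : 1 ≤ L)
    {p x : ℝ} (hx : 0 ≤ x) (hx1 : x ≤ 1)
    (hpx : (0 < p ∧ 0 < x) ∨ (p = 0 ∧ x = 0 ∧ (2 ≤ ℓ ∨ L = 1)))
    (hmean : deficitSum q ℓ L x = p * L * weightSum q ℓ L x ∨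
      (x = 1 ∧ deficitSum q ℓ L x ≤ p * L * weightSum q ℓ L x)) :
    IsThresholdRate (NotListRecoverable q p ℓ L)
      (1 - Real.logb q (weightSum q ℓ L x) / L + p * Real.logb q x) := by
  have hL' : (0 : ℝ) < L := by exact_mod_cast hL
  have hlog : 0 < Real.log q := Real.log_pos (by exact_mod_cast hq)
  have hZ := one_le_weightSum (L := L) hq hℓ hℓq hx
  have hp : 0 ≤ p := by rcases hpx with h | h; exacts [h.1.le, h.1.ge]
  have : Nonempty (Fin q) := ⟨⟨0, by omega⟩⟩
  set H := ∑ u, Real.negMulLog (gibbs q ℓ L x u) with hH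
  -- At a saddle point the Chernoff exponent is exactly the Gibbs entropy; for x = 1 the mean is
  -- irrelevant because log 1 = 0. This makes the two moment bounds meet.
  have hHE : H = Real.log (weightSum q ℓ L x) - p * L * Real.log x := by
    rw [hH, entropy_gibbs hq hℓ hℓq hx]
    rcases hmean with h | ⟨rfl, -⟩
    · rw [h, mul_div_assoc, div_self (by linarith), mul_one]
    · simp
  have hr : 1 - Real.logb q (weightSum q ℓ L x) / L + p * Real.logb q x =
      1 - H / (L * Real.log q) := by
    rw [hHE, Real.logb, Real.logb]; field_simp; ring
  have hH0 : 0 ≤ H := sum_nonneg fun u _ => Real.negMulLog_nonneg (gibbs_nonneg hx u) (by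
    rw [← sum_gibbs (L := L) hq hℓ hℓq hx]
    exact single_le_sum (fun u _ => gibbs_nonneg hx u) (mem_univ u))
  have hH1 : H ≤ L * Real.log q := by
    have := sum_negMulLog_le (gibbs_nonneg (q := q) (ℓ := ℓ) (L := L) hx) (sum_gibbs hq hℓ hℓq hx)
    simpa using this
  have hpos : 0 < L * Real.log q := by positivity
  rw [hr]
  refine isThresholdRate_of_forall ⟨?_, ?_⟩ ?_ ?_
  · rw [sub_nonneg]; exact div_le_one_of_le₀ hH1 hpos.le
  · rw [sub_le_self_iff]; positivity
  · intro R hR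
    refine tendsto_probSatisfies_zero hq hℓ hℓq hx hx1 ?_ ?_
    · rcases hpx with h | h
      exacts [.inl h.2, .inr ⟨h.1, h.2.1⟩]
    · rw [← hHE]
      rw [lt_sub_comm, div_lt_iff₀ hpos] at hR
      linarith
  · intro R₀ hR₀ η hη
    rw [sub_lt_comm, lt_div_iff₀ hpos] at hR₀
    -- A small share δ of the Gibbs distribution is replaced by the uniform distribution on words of
    -- deficit 0. This scales the mean deficit by 1 - δ, making the constraint strict for p > 0,
    -- while concavity keeps at least the fraction 1 - δ of the entropy.
    obtain ⟨δ, hδ0, hδ1, hδ⟩ : ∃ δ : ℝ, 0 < δ ∧ δ < 1 ∧ (1 - R₀) * (L * Real.log q) < (1 - δ) * H := by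
      have hc : Tendsto (fun δ : ℝ => (1 - δ) * H) (𝓝[>] 0) (𝓝 H) := by
        have : ContinuousAt (fun δ : ℝ => (1 - δ) * H) 0 := by fun_prop
        have h2 := this.tendsto.mono_left (nhdsWithin_le_nhds (s := Set.Ioi 0))
        simpa using h2
      have h1 := hc.eventually_const_lt hR₀
      have h2 : ∀ᶠ δ : ℝ in 𝓝[>] 0, δ < 1 :=
        nhdsWithin_le_nhds (eventually_lt_nhds zero_lt_one)
      obtain ⟨δ, h3, h4, h5⟩ := (h1.and (h2.and self_mem_nhdsWithin)).exists
      exact ⟨δ, h5, h4, h3⟩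
    set τ : (Fin L → Fin q) → ℝ := fun u => (1 - δ) * gibbs q ℓ L x u + δ * gibbs q ℓ L 0 u with hτdef
    have hg := gibbs_nonneg (q := q) (ℓ := ℓ) (L := L) hx
    have hg0 := gibbs_nonneg (q := q) (ℓ := ℓ) (L := L) le_rfl
    have h1δ : 0 < 1 - δ := by linarith
    have h0 : ∀ u, 0 ≤ τ u := fun u =>
      add_nonneg (mul_nonneg h1δ.le (hg u)) (mul_nonneg hδ0.le (hg0 u))
    have hτ : ∑ u, τ u = 1 := by
      simp only [hτdef, sum_add_distrib, ← mul_sum, sum_gibbs hq hℓ hℓq hx,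
        sum_gibbs hq hℓ hℓq le_rfl]
      ring
    have hs : ∀ (ρ : Equiv.Perm (Fin L)) u, τ (u ∘ ρ) = τ u := fun ρ u => by
      simp only [hτdef, gibbs_comp_perm]
    have hent : (1 - δ) * H ≤ marginalEntropy τ univ := by
      rw [marginalEntropy_univ, hH, mul_sum]
      refine sum_le_sum fun u _ => ?_
      have h1 := Real.concaveOn_negMulLog.2 (Set.mem_Ici.2 (hg u)) (Set.mem_Ici.2 (hg0 u)) h1δ.le
        hδ0.le (by ring)
      have h2 := Real.negMulLog_nonneg (hg0 u) (by
        rw [← sum_gibbs (L := L) hq hℓ hℓq le_rfl]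
        exact single_le_sum (fun u _ => hg0 u) (mem_univ u))
      simp only [smul_eq_mul] at h1
      have h3 := mul_nonneg hδ0.le h2
      simp only [hτdef]
      linarith
    have hmean' : deficitSum q ℓ L x ≤ p * L * weightSum q ℓ L x := by
      rcases hmean with h | h
      exacts [h.le, h.2]
    have hE : ∑ u, τ u * deficit ℓ (histogram u) ≤ (1 - δ) * (p * L) := by
      have e1 : ∑ u, τ u * deficit ℓ (histogram u) =
          (1 - δ) * ∑ u, gibbs q ℓ L x u * deficit ℓ (histogram u) +
          δ * ∑ u : Fin L → Fin q, gibbs q ℓ L 0 u * deficit ℓ (histogram u) := by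
        rw [mul_sum, mul_sum, ← sum_add_distrib]
        exact sum_congr rfl fun u _ => by simp only [hτdef]; ring
      have e2 : ∑ u : Fin L → Fin q, gibbs q ℓ L 0 u * deficit ℓ (histogram u) = 0 := by
        refine sum_eq_zero fun u _ => ?_
        rw [gibbs]
        by_cases hu : deficit ℓ (histogram u) = 0 <;> simp [hu]
      rw [e1, e2, sum_gibbs_mul_deficit, mul_zero, add_zero]
      refine mul_le_mul_of_nonneg_left ?_ h1δ.le
      rw [div_le_iff₀ (by linarith)]
      exact hmean'
    refine eventually_le_probSatisfies hq hL (fun u => bestSet hℓq (histogram u))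
      (fun u => card_bestSet hℓq _) h0 hτ hs ?_ ?_ ?_ hη
    · intro j
      -- Exchangeability spreads the mean deficit evenly over the L columns.
      have h1 := mul_sum_notMem_bestSet hℓq hs j
      rw [← h1] at hE
      set c := (∑ u, τ u * if u j ∉ bestSet hℓq (histogram u) then (1 : ℝ) else 0) with hc
      have hc0 : 0 ≤ c := sum_nonneg fun u _ => mul_nonneg (h0 u) (by split_ifs <;> norm_num)
      have hE' : c ≤ (1 - δ) * p := by
        refine le_of_mul_le_mul_left ?_ hL'
        linarith
      rcases hpx with h | h
      · left; nlinarith [h.1]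
      · right
        refine ⟨hp, le_antisymm ?_ hc0⟩
        rw [h.1, mul_zero] at hE'
        exact hE'
    · intro i j hij
      -- Columns i and j differ with positive probability. For x = 0 the witness must have deficit
      -- 0; it uses two symbols, hence ℓ ≥ 2.
      obtain ⟨u₀, hu₀, hpos₀⟩ : ∃ u₀ : Fin L → Fin q, u₀ i ≠ u₀ j ∧ 0 < τ u₀ := by
        set u₀ : Fin L → Fin q := fun k => if k = i then ⟨0, by omega⟩ else ⟨1, by omega⟩ with hu
        refine ⟨u₀, ?_, ?_⟩
        · simp [hu, hij.symm]
        · refine add_pos_of_pos_of_nonneg (mul_pos h1δ (div_pos ?_ (by linarith)))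
            (mul_nonneg hδ0.le (hg0 u₀))
          rcases hpx with h | ⟨-, rfl, h | h⟩
          · exact pow_pos h.2 _
          · have : deficit ℓ (histogram u₀) = 0 :=
              deficit_eq_zero hℓq (K := {⟨0, by omega⟩, ⟨1, by omega⟩})
                ((card_insert_le _ _).trans (by simpa using h)) (fun k => by
                  simp only [hu]; split_ifs <;> simp)
            rw [this]; simp
          · exfalso
            subst h
            exact hij (Subsingleton.elim _ _)
      have : (∑ u, if u i = u j then τ u else 0) < ∑ u, τ u := by
        refine sum_lt_sum (fun u _ => ?_) ⟨u₀, mem_univ _, by simpa [hu₀] using hpos₀⟩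
        split_ifs
        exacts [le_rfl, h0 u]
      rwa [hτ] at this
    · linarith

/-- Distinct words cannot be recovered from lists of length one without errors. -/
theorem isThresholdRate_one (hL : 2 ≤ L) :
    IsThresholdRate (NotListRecoverable q 0 1 L) 1 := by
  have h : ∀ n R, probSatisfies (NotListRecoverable q 0 1 L) n R = 0 := by
    intro n R
    have : {C : Code q n | NotListRecoverable q 0 1 L n C} = ∅ := by
      rw [Set.eq_empty_iff_forall_notMem]
      intro C hC
      obtain ⟨B, ⟨hinj, K, hK, hB⟩, -⟩ := not_not.1 hC
      have hin : ∀ j i, B j i ∈ K i := by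
        intro j i
        have h1 : #{i | B j i ∉ K i} = 0 := by
          have := hB j
          rw [zero_mul] at this
          exact_mod_cast le_antisymm this (by positivity)
        by_contra hne
        rw [card_eq_zero, filter_eq_empty_iff] at h1
        exact h1 (mem_univ i) hne
      have : (⟨0, by omega⟩ : Fin L) = ⟨1, by omega⟩ := hinj (funext fun i => by
        obtain ⟨a, ha⟩ := card_eq_one.1 (hK i)
        have h1 := hin ⟨0, by omega⟩ i
        have h2 := hin ⟨1, by omega⟩ i
        rw [ha, mem_singleton] at h1 h2
        rw [h1, h2])
      simp at this
    rw [probSatisfies, this, measureReal_empty]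
  refine isThresholdRate_of_forall ⟨zero_le_one, le_rfl⟩ (fun R _ => ?_) fun R₀ hR₀ η hη => ?_
  · simp only [h]; exact tendsto_const_nhds
  · exact .of_forall fun n R hR => absurd R.2.2 (by linarith)

end ListRecovery

namespace RealRAM

open Finset

/-! ### Building blocks for programs -/

variable {Y : ℕ}

/-- The natural-number cell `k`. -/
abbrev natVar (k : ℕ) : NatExpr := .cell (.const k)

/-- The real cell `k`. -/
abbrev realVar (k : ℕ) : RealExpr := .cell (.const k)

/-- A natural-number constant as a real number. -/
abbrev realConst (k : ℕ) : RealExpr := .ofNat (.const k)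

abbrev assignNat (k : ℕ) (e : NatExpr) : Program := .setNat (.const k) e

abbrev assignReal (k : ℕ) (e : RealExpr) : Program := .setReal (.const k) e

/-- Execute `P` with the values `0, …, n - 1` of the cell `i`, where `n` is the value of `e`. -/
def forLoop (i : ℕ) (e : NatExpr) (P : Program) : Program :=
  .seq (assignNat i (.const 0))
    (.loop (.natLt (natVar i) e) (.seq P (assignNat i (.add (natVar i) (.const 1)))))

/-- The invariant may not depend on the counter cell (`hI`), and the body must return the counter
unchanged; the increment is then handled here once and for all. -/
theorem ends_forLoop {i : ℕ} {e : NatExpr} {P : Program} {Q : Store → Prop} {s : Store} (N : ℕ)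
    (hN : N ≤ Y) (I : ℕ → Store → Prop)
    (hI : ∀ k s x, I k s → I k ⟨Function.update s.nat i x, s.real⟩)
    (he : ∀ k s, I k s → e.eval s = N) (h0 : I 0 s)
    (h : ∀ k s, k < N → s.nat i = k → I k s →
      Ends Y P (fun s' => s'.nat i = k ∧ I (k + 1) s') s)
    (hQ : ∀ s, I N s → Q s) :
    Ends Y (forLoop i e P) Q s := by
  refine ends_seq (ends_setNat ?_)
  refine ends_for N hN (fun k s => s.nat i = k ∧ I k s) ⟨by simp [NatExpr.eval], hI _ _ _ h0⟩ ?_ ?_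
  · rintro k s hk ⟨hi, hIk⟩
    refine ⟨?_, ends_seq ((h k s hk hi hIk).mono ?_)⟩
    · simp only [Test.Holds, NatExpr.eval, he k s hIk, hi, hk]
    · rintro s' ⟨hi', hI'⟩
      exact ends_setNat ⟨by simp [NatExpr.eval, hi'], hI _ _ _ hI'⟩
  · rintro s ⟨hi, hIN⟩
    exact ⟨by simp [Test.Holds, NatExpr.eval, he N s hIN, hi], hQ s hIN⟩

open scoped Classical in
-- Both branches merge into one store with a conditional value, so that successive conditionals do
-- not multiply the cases.
theorem ends_ite_setNat {b : Test} {a e : NatExpr} {Q : Store → Prop} {s : Store}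
    (h : Q ⟨Function.update s.nat (a.eval s) (if b.Holds s then e.eval s else s.nat (a.eval s)),
      s.real⟩) : Ends Y (.ite b (.setNat a e) .skip) Q s := by
  refine ends_ite (fun hb => ends_setNat ?_) (fun hb => ends_skip ?_)
  · simpa [hb] using h
  · simpa [hb] using h

open scoped Classical in
theorem ends_ite_setReal {b : Test} {a : NatExpr} {e : RealExpr} {Q : Store → Prop} {s : Store}
    (h : Q ⟨s.nat, Function.update s.real (a.eval s)
      (if b.Holds s then e.eval s else s.real (a.eval s))⟩) :
    Ends Y (.ite b (.setReal a e) .skip) Q s := by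
  refine ends_ite (fun hb => ends_setReal ?_) (fun hb => ends_skip ?_)
  · simpa [hb] using h
  · simpa [hb] using h

/-- Store the product of the cells `a` and `b` in the cell `c`, with the counter `i`. -/
def mulProgram (c i a b : ℕ) : Program :=
  .seq (assignNat c (.const 0)) (forLoop i (natVar a) (assignNat c (.add (natVar c) (natVar b))))

theorem ends_mulProgram {c i a b : ℕ} (hci : c ≠ i) (hac : a ≠ c) (hai : a ≠ i) (hbc : b ≠ c)
    (hbi : b ≠ i) {s : Store} (hs : s.nat a ≤ Y) :
    Ends Y (mulProgram c i a b) (fun s' => s'.nat c = s.nat a * s.nat b ∧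
      (∀ k, k ≠ c → k ≠ i → s'.nat k = s.nat k) ∧ s'.real = s.real) s := by
  refine ends_seq (ends_setNat ?_)
  refine ends_forLoop (s.nat a) hs (fun k s' => s'.nat c = k * s.nat b ∧
      (∀ k, k ≠ c → k ≠ i → s'.nat k = s.nat k) ∧ s'.real = s.real) ?_ ?_ ?_ ?_ ?_
  · rintro k s' x ⟨h1, h2, h3⟩
    refine ⟨by simpa [hci] using h1, fun k h4 h5 => by simp [h5, h2 k h4 h5], h3⟩
  · rintro k s' ⟨h1, h2, h3⟩
    exact h2 a hac hai
  · exact ⟨by simp [NatExpr.eval], fun k h4 h5 => by simp [NatExpr.eval, h4], rfl⟩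
  · rintro k s' hk hi ⟨h1, h2, h3⟩
    refine ends_setNat ⟨by simp [NatExpr.eval, hci.symm, hi], ?_, fun k h4 h5 => ?_, h3⟩
    · simp [NatExpr.eval, h1, h2 b hbc hbi]; ring
    · simp [NatExpr.eval, h4, h2 k h4 h5]
  · exact fun s h => h

/-! ### The table of the dynamic program; table and counts alternate in the real cells from 20 on -/

/-- The address of the `i`-th entry of the table of the dynamic program. -/
def tableAddr (i : NatExpr) : NatExpr := .add (.const 20) (.add i i)

/-- The address of the number of words with deficit `d`. -/
def countAddr (d : NatExpr) : NatExpr := .add (.const 21) (.add d d)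

/-- The table in the memory. -/
def Store.table (s : Store) (i : ℕ) : ℝ := s.real (20 + (i + i))

/-- The list of numbers of words with given deficits in the memory. -/
def Store.count (s : Store) (d : ℕ) : ℝ := s.real (21 + (d + d))

/-- Compute the new entry with index `nat 9` of the table in the cell `real 3`. -/
def entryProgram : Program :=
  .seq (assignReal 3 (realConst 0)) <|
  .seq (assignReal 4 (realConst 1)) <|
  .seq (assignNat 12 (.const 0)) <|
  forLoop 10 (.add (natVar 2) (.const 1)) <|
    .seq (assignNat 11 (.add (natVar 10) (natVar 12))) <|
    .seq (.ite (.natLt (natVar 7) (natVar 10))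
      (assignNat 11 (.add (natVar 11) (natVar 4))) .skip) <|
    .seq (.ite (.natLt (natVar 10) (natVar 7))
      (assignNat 11 (.add (natVar 11) (natVar 5))) .skip) <|
    .seq (.ite (.natLe (natVar 11) (natVar 9)) (assignReal 3 (.add (realVar 3)
      (.mul (realVar 4) (.cell (tableAddr (.sub (natVar 9) (natVar 11))))))) .skip) <|
    .seq (assignReal 4 (.div (realVar 4) (.ofNat (.add (natVar 10) (.const 1))))) <|
    .ite (.natLt (natVar 10) (natVar 7)) (assignNat 12 (.add (natVar 12) (natVar 3))) .skip

-- The weight 1/h! and the product of the base with min h v are updated incrementally in `real 4`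
-- and `nat 12`, so each term takes constant time although natural numbers cannot be multiplied in
-- one step.
open ListRecovery in
theorem ends_entryProgram {s : Store} (hQ2 : s.nat 4 = s.nat 3 * s.nat 3)
    (hQ3 : s.nat 5 = s.nat 3 * s.nat 3 * s.nat 3) (hY : s.nat 2 + 1 ≤ Y) :
    Ends Y entryProgram (fun s' =>
      s'.real 3 = shiftSum (s.nat 2) (fun h => 1 / (h.factorial : ℝ))
        (rankShift (s.nat 3) (s.nat 7)) s.table (s.nat 9) ∧
      (∀ k < 10, s'.nat k = s.nat k) ∧ (∀ k, k < 3 ∨ 5 ≤ k → s'.real k = s.real k)) s := by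
  refine ends_seq (ends_setReal (ends_seq (ends_setReal (ends_seq (ends_setNat ?_)))))
  refine ends_forLoop (s.nat 2 + 1) hY (fun k s' =>
    (s'.real 3 = ∑ h ∈ range k, if rankShift (s.nat 3) (s.nat 7) h ≤ s.nat 9 then
      1 / (h.factorial : ℝ) * s.table (s.nat 9 - rankShift (s.nat 3) (s.nat 7) h) else 0) ∧
    s'.real 4 = 1 / (k.factorial : ℝ) ∧ s'.nat 12 = s.nat 3 * min k (s.nat 7) ∧
      (∀ k < 10, s'.nat k = s.nat k) ∧ (∀ k, k < 3 ∨ 5 ≤ k → s'.real k = s.real k)) ?_ ?_ ?_ ?_ ?_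
  · rintro k s' x ⟨h1, h2, h3, h4, h5⟩
    exact ⟨h1, h2, by simpa using h3, fun k hk => by
      simp (disch := omega) [Function.update_of_ne, h4 k hk], h5⟩
  · rintro k s' ⟨h1, h2, h3, h4, h5⟩
    simp [NatExpr.eval, h4]
  · refine ⟨by simp [RealExpr.eval, NatExpr.eval], by simp [RealExpr.eval, NatExpr.eval],
      by simp [NatExpr.eval], fun k hk => ?_, fun k hk => ?_⟩
    · simp (disch := omega) [NatExpr.eval, Function.update_of_ne]
    · simp (disch := omega) [NatExpr.eval, Function.update_of_ne]
  · rintro k s' hk hi ⟨h1, h2, h3, h4, h5⟩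
    refine ends_seq (ends_setNat (ends_seq (ends_ite_setNat (ends_seq (ends_ite_setNat
      (ends_seq (ends_ite_setReal (ends_seq (ends_setReal (ends_ite_setNat ?_)))))))))) 
    simp only [NatExpr.eval, RealExpr.eval, Test.Holds, tableAddr]
    simp (disch := omega) only [Function.update_self, Function.update_of_ne]
    have n2 := h4 2 (by omega)
    have n3 := h4 3 (by omega)
    have n4 := h4 4 (by omega)
    have n5 := h4 5 (by omega)
    have n7 := h4 7 (by omega)
    have n9 := h4 9 (by omega)
    rw [n3, n4, n5, n7, n9, hi, h1, h2, h3]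
    have hsh : (if k < s.nat 7 then
          (if s.nat 7 < k then k + s.nat 3 * min k (s.nat 7) + s.nat 4
            else k + s.nat 3 * min k (s.nat 7)) + s.nat 5
        else if s.nat 7 < k then k + s.nat 3 * min k (s.nat 7) + s.nat 4
          else k + s.nat 3 * min k (s.nat 7)) = rankShift (s.nat 3) (s.nat 7) k := by
      rw [rankShift, hQ2, hQ3]
      split_ifs <;> ring
    rw [hsh]
    refine ⟨rfl, ?_, ?_, ?_, fun i hi => ?_, fun i hi => ?_⟩
    · rw [sum_range_succ, h5 _ (by omega)]
      by_cases h : rankShift (s.nat 3) (s.nat 7) k ≤ s.nat 9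
      · rw [if_pos h, if_pos h]; rfl
      · rw [if_neg h, if_neg h, add_zero]
    · rw [Nat.factorial_succ]
      push_cast
      rw [div_div, mul_comm]
    · split_ifs with h
      · rw [min_eq_left h.le, min_eq_left (by omega)]; ring
      · rw [min_eq_right (by omega), min_eq_right (by omega)]
    · simp (disch := omega) only [Function.update_of_ne, h4 i hi]
    · simp (disch := omega) only [Function.update_of_ne, h5 i hi]
  · rintro s' ⟨h1, h2, h3, h4, h5⟩
    exact ⟨h1, h4, h5⟩

/-- Multiply the power series in the table in place. -/
def multiplyProgram : Program :=
  .seq (assignNat 9 (natVar 6)) <|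
  .loop (.natLt (.const 0) (natVar 9)) <|
    .seq (assignNat 9 (.sub (natVar 9) (.const 1))) <|
    .seq entryProgram <|
    .setReal (tableAddr (natVar 9)) (realVar 3)

-- Indices run downwards, and an entry depends only on entries of the same or smaller index, which
-- are not yet overwritten; no second table is needed.
open ListRecovery in
theorem ends_multiplyProgram {s : Store} (hQ2 : s.nat 4 = s.nat 3 * s.nat 3)
    (hQ3 : s.nat 5 = s.nat 3 * s.nat 3 * s.nat 3) (hY : s.nat 2 + 1 ≤ Y) (hY' : s.nat 6 ≤ Y) :
    Ends Y multiplyProgram (fun s' =>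
      (∀ i < s.nat 6, s'.table i = shiftSum (s.nat 2) (fun h => 1 / (h.factorial : ℝ))
        (rankShift (s.nat 3) (s.nat 7)) s.table i) ∧
      (∀ k < 9, s'.nat k = s.nat k) ∧ (∀ k < 3, s'.real k = s.real k) ∧ s'.count = s.count) s := by
  refine ends_seq (ends_setNat ?_)
  refine ends_for (s.nat 6) hY' (fun k s' => k + s'.nat 9 = s.nat 6 ∧
      (∀ i < s.nat 6, s'.table i = if s'.nat 9 ≤ i then
        shiftSum (s.nat 2) (fun h => 1 / (h.factorial : ℝ)) (rankShift (s.nat 3) (s.nat 7)) s.table i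
        else s.table i) ∧
      (∀ k < 9, s'.nat k = s.nat k) ∧ (∀ k < 3, s'.real k = s.real k) ∧ s'.count = s.count)
      ?_ ?_ ?_
  · refine ⟨by simp [NatExpr.eval], fun i hi => ?_, fun k hk => ?_, fun _ _ => rfl, rfl⟩
    · rw [if_neg]
      · rfl
      · simpa [NatExpr.eval] using hi
    · simp (disch := omega) only [NatExpr.eval, Function.update_of_ne]
  · rintro k s' hk ⟨h1, h2, h3, h4, h5⟩
    have n2 := h3 2 (by omega)
    have n3 := h3 3 (by omega)
    have n4 := h3 4 (by omega)
    have n5 := h3 5 (by omega)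
    have n7 := h3 7 (by omega)
    refine ⟨by simp only [Test.Holds, NatExpr.eval]; omega, ends_seq (ends_setNat (ends_seq ?_))⟩
    simp only [NatExpr.eval]
    refine (ends_entryProgram ?_ ?_ ?_).mono ?_
    · simp (disch := omega) only [Function.update_of_ne, n3, n4, hQ2]
    · simp (disch := omega) only [Function.update_of_ne, n3, n5, hQ3]
    · simp (disch := omega) only [Function.update_of_ne, n2]; exact hY
    rintro s'' ⟨a1, a2, a3⟩
    simp (disch := omega) only [Function.update_self, Function.update_of_ne, n2, n3, n7] at a1
    have a9 := a2 9 (by omega)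
    simp only [Function.update_self] at a9
    refine ends_setReal ?_
    simp only [NatExpr.eval, RealExpr.eval, tableAddr]
    have htab : ∀ i, s''.table i = s'.table i := fun i => a3 _ (by omega)
    refine ⟨by simp only [a9]; omega, fun i hi => ?_, fun k hk => ?_, fun k hk => ?_, ?_⟩
    · simp only [Store.table, a9]
      by_cases hii : i = s'.nat 9 - 1
      · rw [hii, Function.update_self, a1, if_pos le_rfl]
        refine sum_congr rfl fun h _ => ?_
        split_ifs with hh
        · have e1 : (Store.mk (Function.update s'.nat 9 (s'.nat 9 - 1)) s'.real).table
              (s'.nat 9 - 1 - rankShift (s.nat 3) (s.nat 7) h) =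
              s'.table (s'.nat 9 - 1 - rankShift (s.nat 3) (s.nat 7) h) := rfl
          rw [e1, h2 _ (by omega), if_neg (by omega)]
        · rfl
      · rw [Function.update_of_ne (by omega)]
        refine (htab i).trans ((h2 i hi).trans (if_congr ?_ rfl rfl))
        omega
    · rw [a2 k (by omega)]
      simp (disch := omega) only [Function.update_of_ne, h3 k hk]
    · rw [Function.update_of_ne (by omega), a3 k (by omega)]
      exact h4 k hk
    · rw [← h5]
      funext d
      simp only [Store.count]
      rw [Function.update_of_ne (by omega), a3 _ (by omega)]
  · rintro s' ⟨h1, h2, h3, h4, h5⟩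
    refine ⟨by simp only [Test.Holds, NatExpr.eval]; omega, fun i hi => ?_, h3, h4, h5⟩
    rw [h2 i hi, if_pos (by omega)]

/-- Compute the table of the dynamic program for the rank value in the cell `nat 7`. -/
def tableProgram : Program :=
  .seq (forLoop 9 (natVar 6) (.setReal (tableAddr (natVar 9)) (realConst 0))) <|
  .seq (.setReal (tableAddr (.const 0)) (realVar 2)) <|
  forLoop 8 (natVar 0) multiplyProgram

-- Because of this locality, a finite table computes an initial segment of the power series exactly.
open ListRecovery in
theorem shiftSum_congr {L : ℕ} {w : ℕ → ℝ} {sh : ℕ → ℕ} {C C' : ℕ → ℝ} {i : ℕ}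
    (h : ∀ k ≤ i, C k = C' k) : shiftSum L w sh C i = shiftSum L w sh C' i := by
  refine sum_congr rfl fun k _ => ?_
  split_ifs
  · rw [h _ (by omega)]
  · rfl

open ListRecovery in
theorem ends_tableProgram {q L v : ℕ} {s : Store} (hq : s.nat 0 = q) (hL : s.nat 2 = L)
    (hQ : s.nat 3 = indexBase q L) (hQ2 : s.nat 4 = s.nat 3 * s.nat 3)
    (hQ3 : s.nat 5 = s.nat 3 * s.nat 3 * s.nat 3) (hv : s.nat 7 = v)
    (hfac : s.real 2 = L.factorial)
    (hY : L + 1 ≤ Y) (hY' : s.nat 6 ≤ Y) (hqY : q ≤ Y) :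
    Ends Y tableProgram (fun s' => (∀ i < s.nat 6, s'.table i = rankTable q L v i) ∧
      (∀ k < 8, s'.nat k = s.nat k) ∧ (∀ k < 3, s'.real k = s.real k) ∧ s'.count = s.count) s := by
  refine ends_seq ?_
  refine ends_forLoop (s.nat 6) hY' (fun k s' => (∀ i < k, s'.table i = 0) ∧
    (∀ k < 8, s'.nat k = s.nat k) ∧ (∀ k < 3, s'.real k = s.real k) ∧ s'.count = s.count)
    ?_ ?_ ?_ ?_ ?_
  · rintro k s' x ⟨h1, h2, h3, h4⟩
    exact ⟨h1, fun k hk => by simp (disch := omega) only [Function.update_of_ne, h2 k hk], h3, h4⟩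
  · rintro k s' ⟨h1, h2, h3, h4⟩
    exact h2 6 (by omega)
  · exact ⟨fun i hi => absurd hi (by omega), fun _ _ => rfl, fun _ _ => rfl, rfl⟩
  · rintro k s' hk hi ⟨h1, h2, h3, h4⟩
    refine ends_setReal ⟨hi, ?_, h2, fun k hk => ?_, ?_⟩
    · intro i hik
      simp only [Store.table, NatExpr.eval, RealExpr.eval, tableAddr, hi]
      by_cases hii : i = k
      · rw [hii]; simp
      · rw [Function.update_of_ne (by omega)]; exact h1 i (by omega)
    · simp only [NatExpr.eval, tableAddr]
      rw [Function.update_of_ne (by omega), h3 k hk]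
    · rw [← h4]
      funext d
      simp only [Store.count, NatExpr.eval, tableAddr]
      rw [Function.update_of_ne (by omega)]
  rintro s₁ ⟨h1, h2, h3, h4⟩
  refine ends_seq (ends_setReal ?_)
  simp only [NatExpr.eval, RealExpr.eval, tableAddr]
  refine ends_forLoop q hqY (fun k s' => (∀ i < s.nat 6, s'.table i =
      (shiftSum L (fun h => 1 / (h.factorial : ℝ)) (rankShift (indexBase q L) v))^[k]
        (Pi.single 0 (L.factorial : ℝ)) i) ∧
    (∀ k < 8, s'.nat k = s.nat k) ∧ (∀ k < 3, s'.real k = s.real k) ∧ s'.count = s.count)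
    ?_ ?_ ?_ ?_ ?_
  · rintro k s' x ⟨h1, h2, h3, h4⟩
    exact ⟨h1, fun k hk => by simp (disch := omega) only [Function.update_of_ne, h2 k hk], h3, h4⟩
  · rintro k s' ⟨h1, h2, h3, h4⟩
    simp only [NatExpr.eval, h2 0 (by omega), hq]
  · refine ⟨fun i hi => ?_, h2, fun k hk => ?_, ?_⟩
    · simp only [Store.table, Function.iterate_zero, id]
      by_cases hii : i = 0
      · subst hii
        simp [h3 2, hfac]
      · rw [Function.update_of_ne (by omega), Pi.single_eq_of_ne hii]
        exact h1 i hi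
    · dsimp only
      rw [Function.update_of_ne (by omega), h3 k hk]
    · rw [← h4]
      funext d
      simp only [Store.count]
      rw [Function.update_of_ne (by omega)]
  · rintro k s' hk hi ⟨a1, a2, a3, a4⟩
    refine (ends_multiplyProgram ?_ ?_ ?_ ?_).mono ?_
    · rw [a2 4 (by omega), a2 3 (by omega), hQ2]
    · rw [a2 5 (by omega), a2 3 (by omega), hQ3]
    · rw [a2 2 (by omega), hL]; exact hY
    · rw [a2 6 (by omega)]; exact hY'
    rintro s'' ⟨b1, b2, b3, b4⟩
    rw [a2 2 (by omega), a2 3 (by omega), a2 6 (by omega), a2 7 (by omega), hL, hQ, hv] at b1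
    refine ⟨by rw [b2 8 (by omega), hi], fun i hii => ?_, fun k hk => ?_, fun k hk => ?_, ?_⟩
    · rw [b1 i hii, Function.iterate_succ_apply']
      exact shiftSum_congr fun j hj => a1 j (by omega)
    · rw [b2 k (by omega), a2 k hk]
    · rw [b3 k hk, a3 k hk]
    · rw [b4, a4]
  · rintro s' h
    exact h

end RealRAM

/-! ### The program that counts words by deficit -/

namespace RealRAM

open Finset ListRecovery

variable {Y : ℕ}

/-- Add the entries of the table with indices `nat 11 + nat 5 * j` to the count `nat 8`. -/
def addRowProgram : Program :=
  forLoop 12 (.add (.sub (natVar 0) (natVar 1)) (.const 1)) <|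
    .seq (.setReal (countAddr (natVar 8)) (.add (.cell (countAddr (natVar 8)))
      (.cell (tableAddr (natVar 11))))) <|
    assignNat 11 (.add (natVar 11) (natVar 5))

theorem ends_addRowProgram {s : Store} (hY : s.nat 0 - s.nat 1 + 1 ≤ Y) :
    Ends Y addRowProgram (fun s' => s'.count = Function.update s.count (s.nat 8)
        (s.count (s.nat 8) + ∑ j ∈ range (s.nat 0 - s.nat 1 + 1),
          s.table (s.nat 11 + s.nat 5 * j)) ∧
      (∀ k < 11, s'.nat k = s.nat k) ∧ (∀ k < 20, s'.real k = s.real k) ∧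
      s'.table = s.table) s := by
  refine ends_forLoop (s.nat 0 - s.nat 1 + 1) hY (fun k s' =>
    (s'.count = Function.update s.count (s.nat 8)
        (s.count (s.nat 8) + ∑ j ∈ range k, s.table (s.nat 11 + s.nat 5 * j)) ∧
      (∀ k < 11, s'.nat k = s.nat k) ∧ (∀ k < 20, s'.real k = s.real k) ∧
      s'.table = s.table) ∧ s'.nat 11 = s.nat 11 + s.nat 5 * k) ?_ ?_ ?_ ?_ ?_
  · rintro k s' x ⟨⟨h1, h2, h3, h4⟩, h5⟩
    exact ⟨⟨h1, fun k hk => by simp (disch := omega) only [Function.update_of_ne, h2 k hk], h3, h4⟩,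
      by simpa using h5⟩
  · rintro k s' ⟨⟨h1, h2, h3, h4⟩, h5⟩
    simp only [NatExpr.eval, h2 0 (by omega), h2 1 (by omega)]
  · exact ⟨⟨by simp, fun _ _ => rfl, fun _ _ => rfl, rfl⟩, by simp⟩
  · rintro k s' hk hi ⟨⟨h1, h2, h3, h4⟩, h5⟩
    refine ends_seq (ends_setReal (ends_setNat ?_))
    simp only [NatExpr.eval, RealExpr.eval, tableAddr, countAddr]
    have n8 := h2 8 (by omega)
    have n5 := h2 5 (by omega)
    rw [n8, n5, h5]
    refine ⟨by simp (disch := omega) only [Function.update_of_ne, hi],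
      ⟨?_, fun k hk => ?_, fun k hk => ?_, ?_⟩, by simp; ring⟩
    · funext d
      have e1 : s'.real (21 + (s.nat 8 + s.nat 8)) = s'.count (s.nat 8) := rfl
      have e2 : s'.real (20 + (s.nat 11 + s.nat 5 * k + (s.nat 11 + s.nat 5 * k))) =
        s'.table (s.nat 11 + s.nat 5 * k) := rfl
      rw [e1, e2, h1, h4, Function.update_self]
      by_cases hd : d = s.nat 8
      · subst hd
        simp only [Store.count, Function.update_self]
        rw [sum_range_succ, add_assoc]
      · rw [Function.update_of_ne hd]
        simp only [Store.count]
        rw [Function.update_of_ne (by omega)]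
        have := congrFun h1 d
        rw [Function.update_of_ne hd] at this
        exact this
    · simp (disch := omega) only [Function.update_of_ne, h2 k hk]
    · simp (disch := omega) only [Function.update_of_ne, h3 k hk]
    · rw [← h4]
      funext i
      simp only [Store.table]
      rw [Function.update_of_ne (by omega)]
  · rintro s' ⟨h, -⟩
    exact h

/-- Add the entries of the table with indices `nat 10 + nat 4 * j + nat 5 * j'` to the count
`nat 8`. -/
def addBlockProgram : Program :=
  forLoop 9 (natVar 1) <|
    .seq (assignNat 11 (natVar 10)) <|
    .seq addRowProgram <|
    assignNat 10 (.add (natVar 10) (natVar 4))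

theorem ends_addBlockProgram {s : Store} (hY : s.nat 0 - s.nat 1 + 1 ≤ Y) (hY' : s.nat 1 ≤ Y) :
    Ends Y addBlockProgram (fun s' => s'.count = Function.update s.count (s.nat 8)
        (s.count (s.nat 8) + ∑ j ∈ range (s.nat 1), ∑ j' ∈ range (s.nat 0 - s.nat 1 + 1),
          s.table (s.nat 10 + s.nat 4 * j + s.nat 5 * j')) ∧
      (∀ k < 9, s'.nat k = s.nat k) ∧ (∀ k < 20, s'.real k = s.real k) ∧
      s'.table = s.table) s := by
  refine ends_forLoop (s.nat 1) hY' (fun k s' =>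
    (s'.count = Function.update s.count (s.nat 8)
        (s.count (s.nat 8) + ∑ j ∈ range k, ∑ j' ∈ range (s.nat 0 - s.nat 1 + 1),
          s.table (s.nat 10 + s.nat 4 * j + s.nat 5 * j')) ∧
      (∀ k < 9, s'.nat k = s.nat k) ∧ (∀ k < 20, s'.real k = s.real k) ∧
      s'.table = s.table) ∧ s'.nat 10 = s.nat 10 + s.nat 4 * k) ?_ ?_ ?_ ?_ ?_
  · rintro k s' x ⟨⟨h1, h2, h3, h4⟩, h5⟩
    exact ⟨⟨h1, fun k hk => by simp (disch := omega) only [Function.update_of_ne, h2 k hk], h3, h4⟩,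
      by simpa using h5⟩
  · rintro k s' ⟨⟨h1, h2, h3, h4⟩, h5⟩
    simp only [NatExpr.eval, h2 1 (by omega)]
  · exact ⟨⟨by simp, fun _ _ => rfl, fun _ _ => rfl, rfl⟩, by simp⟩
  · rintro k s' hk hi ⟨⟨h1, h2, h3, h4⟩, h5⟩
    have n8 := h2 8 (by omega)
    have n5 := h2 5 (by omega)
    have n4 := h2 4 (by omega)
    have n0 := h2 0 (by omega)
    have n1 := h2 1 (by omega)
    refine ends_seq (ends_setNat (ends_seq ?_))
    simp only [NatExpr.eval]
    refine (ends_addRowProgram ?_).mono ?_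
    · simp (disch := omega) only [Function.update_of_ne, n0, n1]; exact hY
    rintro s'' ⟨b1, b2, b3, b4⟩
    simp (disch := omega) only [Function.update_self, Function.update_of_ne, n0, n1, n5, n8, h5]
      at b1
    have m10 := b2 10 (by omega)
    have m9 := b2 9 (by omega)
    have m4 := b2 4 (by omega)
    simp (disch := omega) only [Function.update_of_ne, h5, n4, hi] at m10 m9 m4
    have e1 : ∀ f : ℕ → ℕ, (Store.mk f s'.real).count = s'.count := fun _ => rfl
    have e2 : ∀ f : ℕ → ℕ, (Store.mk f s'.real).table = s'.table := fun _ => rfl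
    rw [e1, e2, h1, h4, Function.update_self] at b1
    refine ends_setNat ?_
    simp only [NatExpr.eval, m10, m4]
    refine ⟨by simp (disch := omega) only [Function.update_of_ne, m9],
      ⟨?_, fun k hk => ?_, fun k hk => ?_, ?_⟩, by simp; ring⟩
    · change s''.count = _
      rw [b1, Function.update_idem, sum_range_succ _ k, add_assoc]
    · have := b2 k (by omega)
      simp (disch := omega) only [Function.update_of_ne] at this ⊢
      rw [this, h2 k hk]
    · exact (b3 k hk).trans (h3 k hk)
    · exact b4.trans h4
  · rintro s' ⟨h, -⟩
    exact h

/-- Add the numbers of words with the `ℓ`-th largest number of occurrences `nat 7` to the counts. -/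
def addCountsProgram : Program :=
  forLoop 8 (.add (natVar 2) (.const 1)) <|
    .seq (mulProgram 11 12 1 7) <|
    .seq (assignNat 11 (.add (natVar 11) (natVar 8))) <|
    .seq (mulProgram 10 12 3 11) <|
    .seq (assignNat 10 (.add (natVar 10) (natVar 2))) addBlockProgram

/-- Only the index L + Q (d + ℓ v), with Q the base in `nat 3`, needs multiplications. The inner
loops reach the other digits by steps Q^2 and Q^3. -/
theorem ends_addCountsProgram {s : Store} (hY : s.nat 0 - s.nat 1 + 1 ≤ Y) (hY1 : s.nat 1 ≤ Y)
    (hY2 : s.nat 2 + 1 ≤ Y) (hY3 : s.nat 3 ≤ Y) :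
    Ends Y addCountsProgram (fun s' => (∀ d ≤ s.nat 2, s'.count d =
        s.count d + ∑ j ∈ range (s.nat 1), ∑ j' ∈ range (s.nat 0 - s.nat 1 + 1),
          s.table (s.nat 2 + s.nat 3 * (d + s.nat 1 * s.nat 7) + s.nat 4 * j + s.nat 5 * j')) ∧
      (∀ k < 8, s'.nat k = s.nat k) ∧ (∀ k < 20, s'.real k = s.real k)) s := by
  refine ends_forLoop (s.nat 2 + 1) hY2 (fun k s' =>
    (∀ d, s'.count d = if d < k then
        s.count d + ∑ j ∈ range (s.nat 1), ∑ j' ∈ range (s.nat 0 - s.nat 1 + 1),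
          s.table (s.nat 2 + s.nat 3 * (d + s.nat 1 * s.nat 7) + s.nat 4 * j + s.nat 5 * j')
        else s.count d) ∧
      (∀ k < 8, s'.nat k = s.nat k) ∧ (∀ k < 20, s'.real k = s.real k) ∧
      s'.table = s.table) ?_ ?_ ?_ ?_ ?_
  · rintro k s' x ⟨h1, h2, h3, h4⟩
    exact ⟨h1, fun k hk => by simp (disch := omega) only [Function.update_of_ne, h2 k hk], h3, h4⟩
  · rintro k s' ⟨h1, h2, h3, h4⟩
    simp only [NatExpr.eval, h2 2 (by omega)]
  · exact ⟨by simp, fun _ _ => rfl, fun _ _ => rfl, rfl⟩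
  · rintro k s' hk hi ⟨h1, h2, h3, h4⟩
    have n0 := h2 0 (by omega)
    have n1 := h2 1 (by omega)
    have n2 := h2 2 (by omega)
    have n3 := h2 3 (by omega)
    have n4 := h2 4 (by omega)
    have n5 := h2 5 (by omega)
    have n7 := h2 7 (by omega)
    refine ends_seq ((ends_mulProgram (by decide) (by decide) (by decide) (by decide) (by decide)
      (by rw [n1]; exact hY1)).mono ?_)
    rintro s₁ ⟨a1, a2, a3⟩
    refine ends_seq (ends_setNat (ends_seq ?_))
    simp only [NatExpr.eval, a1, a2 8 (by omega) (by omega), hi, n1, n7]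
    refine (ends_mulProgram (by decide) (by decide) (by decide) (by decide) (by decide) ?_).mono ?_
    · simp (disch := omega) only [Function.update_of_ne]
      rw [a2 3 (by omega) (by omega), n3]; exact hY3
    rintro s₂ ⟨b1, b2, b3⟩
    simp (disch := omega) only [Function.update_of_ne, Function.update_self,
      a2 3 (by omega) (by omega), n3] at b1
    have hb : ∀ k < 10, s₂.nat k = s'.nat k := fun k hk => by
      rw [b2 k (by omega) (by omega)]
      simp (disch := omega) only [Function.update_of_ne, a2]
    refine ends_seq (ends_setNat ?_)
    simp only [NatExpr.eval, b1, hb 2 (by omega), n2]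
    refine (ends_addBlockProgram ?_ ?_).mono ?_
    · simp (disch := omega) only [Function.update_of_ne, hb, n0, n1]; exact hY
    · simp (disch := omega) only [Function.update_of_ne, hb, n1]; exact hY1
    rintro s₃ ⟨c1, c2, c3, c4⟩
    have hreal : s₂.real = s'.real := b3.trans a3
    have e1 : ∀ f : ℕ → ℕ, (Store.mk f s₂.real).count = s'.count := fun _ => by
      rw [hreal]; rfl
    have e2 : ∀ f : ℕ → ℕ, (Store.mk f s₂.real).table = s.table := fun _ => by
      rw [hreal, ← h4]; rfl
    simp (disch := omega) only [Function.update_of_ne, Function.update_self, hb, n0, n1, n4, n5,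
      hi, e1, e2] at c1
    have hc : ∀ k < 9, s₃.nat k = s'.nat k := fun k hk => by
      rw [c2 k hk]
      simp (disch := omega) only [Function.update_of_ne, hb]
    refine ⟨by rw [hc 8 (by omega), hi], fun d => ?_, fun k hk => by rw [hc k (by omega), h2 k hk],
      fun k hk => ?_, c4.trans (e2 _)⟩
    · rw [c1]
      by_cases hd : d = k
      · subst hd
        rw [Function.update_self, if_pos (by omega), h1, if_neg (by omega)]
        congr 1
        refine sum_congr rfl fun j _ => sum_congr rfl fun j' _ => ?_
        congr 1
        ring
      · rw [Function.update_of_ne hd, h1]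
        exact if_congr (by omega) rfl rfl
    · rw [c3 k hk]
      change s₂.real k = _
      rw [hreal, h3 k hk]
  · rintro s' ⟨h1, h2, h3, h4⟩
    refine ⟨fun d hd => ?_, h2, h3⟩
    rw [h1, if_pos (by omega)]

/-- Compute the powers of the base, the size of the table and the factorial of `L`. -/
def prepareProgram : Program :=
  .seq (assignNat 7 (.add (natVar 0) (.const 1))) <|
  .seq (mulProgram 3 9 7 2) <|
  .seq (assignNat 3 (.add (natVar 3) (.const 1))) <|
  .seq (mulProgram 4 9 3 3) <|
  .seq (mulProgram 5 9 3 4) <|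
  .seq (mulProgram 6 9 3 5) <|
  .seq (assignReal 2 (realConst 1)) <|
  forLoop 9 (natVar 2) (assignReal 2 (.mul (realVar 2) (.ofNat (.add (natVar 9) (.const 1)))))

theorem ends_prepareProgram {q ℓ L : ℕ} {p ε : ℝ} (hqY : q + 1 ≤ Y) (hLY : L ≤ Y)
    (hY : indexBase q L ≤ Y) :
    Ends Y prepareProgram (fun s => s.nat 0 = q ∧ s.nat 1 = ℓ ∧ s.nat 2 = L ∧
      s.nat 3 = indexBase q L ∧ s.nat 4 = indexBase q L * indexBase q L ∧
      s.nat 5 = indexBase q L * indexBase q L * indexBase q L ∧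
      s.nat 6 = indexBase q L * indexBase q L * indexBase q L * indexBase q L ∧
      s.real 0 = p ∧ s.real 1 = ε ∧ s.real 2 = L.factorial ∧ s.count = 0) (input q ℓ L p ε) := by
  refine ends_seq (ends_setNat ?_)
  simp only [NatExpr.eval]
  have i0 : (input q ℓ L p ε).nat 0 = q := rfl
  have i1 : (input q ℓ L p ε).nat 1 = ℓ := rfl
  have i2 : (input q ℓ L p ε).nat 2 = L := rfl
  rw [i0]
  refine ends_seq ((ends_mulProgram (by decide) (by decide) (by decide) (by decide) (by decide)
      (by simpa using hqY)).mono ?_)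
  rintro s₁ ⟨a1, a2, a3⟩
  simp (disch := omega) only [Function.update_of_ne, Function.update_self, i2] at a1
  have A : ∀ k < 3, s₁.nat k = (input q ℓ L p ε).nat k := fun k hk => by
    rw [a2 k (by omega) (by omega)]
    simp (disch := omega) only [Function.update_of_ne]
  refine ends_seq (ends_setNat (ends_seq ?_))
  simp only [NatExpr.eval, a1]
  have hQ : (q + 1) * L + 1 = indexBase q L := rfl
  rw [hQ]
  refine (ends_mulProgram (by decide) (by decide) (by decide) (by decide) (by decide)
      (by simpa using hY)).mono ?_
  rintro s₂ ⟨b1, b2, b3⟩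
  simp only [Function.update_self] at b1
  have B3 := b2 3 (by decide) (by decide)
  simp only [Function.update_self] at B3
  have B : ∀ k < 3, s₂.nat k = (input q ℓ L p ε).nat k := fun k hk => by
    rw [b2 k (by omega) (by omega)]
    simp (disch := omega) only [Function.update_of_ne, A]
  refine ends_seq ((ends_mulProgram (by decide) (by decide) (by decide) (by decide) (by decide)
      (by rw [B3]; exact hY)).mono ?_)
  rintro s₃ ⟨c1, c2, c3⟩
  rw [B3, b1] at c1
  refine ends_seq ((ends_mulProgram (by decide) (by decide) (by decide) (by decide) (by decide)
      (by rw [c2 3 (by decide) (by decide), B3]; exact hY)).mono ?_)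
  rintro s₄ ⟨d1, d2, d3⟩
  rw [c2 3 (by decide) (by decide), B3, c1] at d1
  have D : ∀ k < 3, s₄.nat k = (input q ℓ L p ε).nat k := fun k hk => by
    rw [d2 k (by omega) (by omega), c2 k (by omega) (by omega), B k hk]
  have D3 : s₄.nat 3 = indexBase q L := by
    rw [d2 3 (by decide) (by decide), c2 3 (by decide) (by decide), B3]
  have D4 : s₄.nat 4 = indexBase q L * indexBase q L := by
    rw [d2 4 (by decide) (by decide), c2 4 (by decide) (by decide), b1]
  have D5 : s₄.nat 5 = indexBase q L * indexBase q L * indexBase q L := by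
    rw [d2 5 (by decide) (by decide), c1]; ring
  have D6 : s₄.nat 6 = indexBase q L * indexBase q L * indexBase q L * indexBase q L := by
    rw [d1]; ring
  have R : s₄.real = (input q ℓ L p ε).real := by rw [d3, c3, b3, a3]
  refine ends_seq (ends_setReal ?_)
  simp only [NatExpr.eval, RealExpr.eval]
  refine ends_forLoop L hLY (fun k s => s.real 2 = k.factorial ∧ (∀ k < 9, s.nat k = s₄.nat k) ∧
    ∀ k, k ≠ 2 → s.real k = (input q ℓ L p ε).real k) ?_ ?_ ?_ ?_ ?_
  · rintro k s' x ⟨h1, h2, h3⟩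
    exact ⟨h1, fun k hk => by simp (disch := omega) only [Function.update_of_ne, h2 k hk], h3⟩
  · rintro k s' ⟨h1, h2, h3⟩
    simp only [NatExpr.eval, h2 2 (by omega), D 2 (by omega), i2]
  · exact ⟨by simp, fun _ _ => rfl, fun k hk => by simp [hk, R]⟩
  · rintro k s' hk hi ⟨h1, h2, h3⟩
    refine ends_setReal ⟨hi, ?_, h2, fun k hk => ?_⟩
    · simp only [NatExpr.eval, RealExpr.eval, Function.update_self, h1, hi]
      rw [Nat.factorial_succ]; push_cast; ring
    · simp only [NatExpr.eval]
      rw [Function.update_of_ne hk, h3 k hk]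
  · rintro s ⟨h1, h2, h3⟩
    refine ⟨by rw [h2 0 (by decide), D 0 (by decide)]; rfl,
      by rw [h2 1 (by decide), D 1 (by decide)]; rfl,
      by rw [h2 2 (by decide), D 2 (by decide)]; rfl, by rw [h2 3 (by decide), D3],
      by rw [h2 4 (by decide), D4], by rw [h2 5 (by decide), D5], by rw [h2 6 (by decide), D6],
      by rw [h3 0 (by decide)]; rfl, by rw [h3 1 (by decide)]; rfl, h1, ?_⟩
    funext d
    simp only [Store.count, Pi.zero_apply]
    rw [h3 _ (by omega)]
    simp only [input]
    rw [if_neg (by omega), if_neg (by omega)]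

theorem digits_lt {Q a b c d : ℕ} (ha : a + 1 ≤ Q) (hb : b + 1 ≤ Q) (hc : c + 1 ≤ Q)
    (hd : d + 1 ≤ Q) : a + Q * b + Q * Q * c + Q * Q * Q * d < Q * Q * Q * Q := by
  have f2 : Q * (b + 1) ≤ Q * Q := Nat.mul_le_mul_left _ hb
  have f3 : Q * Q * (c + 1) ≤ Q * Q * Q := Nat.mul_le_mul_left _ hc
  have f4 : Q * Q * Q * (d + 1) ≤ Q * Q * Q * Q := Nat.mul_le_mul_left _ hd
  linarith

/-- Compute the numbers of words with given deficits. -/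
def countProgram : Program :=
  .seq prepareProgram <|
  forLoop 7 (.add (natVar 2) (.const 1)) (.seq tableProgram addCountsProgram)

/-- The memory holds the input and the numbers of words with given deficits. -/
structure HasCounts (q ℓ L : ℕ) (p ε : ℝ) (s : Store) : Prop where
  nat0 : s.nat 0 = q
  nat1 : s.nat 1 = ℓ
  nat2 : s.nat 2 = L
  real0 : s.real 0 = p
  real1 : s.real 1 = ε
  count : ∀ d ≤ L, s.count d = deficitCount q ℓ L d

theorem ends_countProgram {q ℓ L : ℕ} {p ε : ℝ} (hℓ : 1 ≤ ℓ) (hℓq : ℓ ≤ q)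
    (hL : 1 ≤ L) (hY : indexBase q L ^ 4 ≤ Y) :
    Ends Y countProgram (HasCounts q ℓ L p ε) (input q ℓ L p ε) := by
  have hB1 : q + 1 ≤ indexBase q L := by
    unfold indexBase; nlinarith
  have hB2 : L + 1 ≤ indexBase q L := by
    unfold indexBase; nlinarith
  have hB3 : ∀ d k, d ≤ L → k ≤ L → d + ℓ * k + 1 ≤ indexBase q L := by
    intro d k hd hk
    have : ℓ * k ≤ q * L := Nat.mul_le_mul hℓq hk
    have h2 : (q + 1) * L = q * L + L := by ring
    unfold indexBase
    omega
  have hB4 : indexBase q L ≤ indexBase q L ^ 4 := Nat.le_self_pow (by decide) _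
  have hD : indexBase q L * indexBase q L * indexBase q L * indexBase q L ≤ Y := by
    refine le_trans (le_of_eq ?_) hY; ring
  refine ends_seq ((ends_prepareProgram (by omega) (by omega) (by omega)).mono ?_)
  rintro s ⟨h0, h1, h2, h3, h4, h5, h6, h7, h8, h9, h10⟩
  refine ends_forLoop (L + 1) (by omega) (fun k s' => (∀ k < 7, s'.nat k = s.nat k) ∧
    (∀ k < 3, s'.real k = s.real k) ∧ ∀ d ≤ L, s'.count d = ∑ v ∈ range k, ∑ j ∈ range ℓ,
      ∑ j' ∈ range (q - ℓ + 1), rankTable q L v (L + indexBase q L * (d + ℓ * v) +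
        indexBase q L * indexBase q L * j + indexBase q L * indexBase q L * indexBase q L * j'))
    ?_ ?_ ?_ ?_ ?_
  · rintro k s' x ⟨a1, a2, a3⟩
    exact ⟨fun k hk => by simp (disch := omega) only [Function.update_of_ne, a1 k hk], a2, a3⟩
  · rintro k s' ⟨a1, a2, a3⟩
    simp only [NatExpr.eval, a1 2 (by omega), h2]
  · exact ⟨fun _ _ => rfl, fun _ _ => rfl, fun d _ => by simp [h10]⟩
  · rintro k s' hk hi ⟨a1, a2, a3⟩
    have n0 := (a1 0 (by omega)).trans h0
    have n1 := (a1 1 (by omega)).trans h1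
    have n2 := (a1 2 (by omega)).trans h2
    have n3 := (a1 3 (by omega)).trans h3
    have n4 := (a1 4 (by omega)).trans h4
    have n5 := (a1 5 (by omega)).trans h5
    have n6 := (a1 6 (by omega)).trans h6
    refine ends_seq ((ends_tableProgram n0 n2 n3 (by rw [n4, n3]) (by rw [n5, n3]) hi
      ((a2 2 (by omega)).trans h9) (by omega) (by rw [n6]; exact hD)
      (by omega)).mono ?_)
    rintro s₁ ⟨b1, b2, b3, b4⟩
    have m0 := (b2 0 (by omega)).trans n0
    have m1 := (b2 1 (by omega)).trans n1
    have m2 := (b2 2 (by omega)).trans n2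
    have m3 := (b2 3 (by omega)).trans n3
    have m4 := (b2 4 (by omega)).trans n4
    have m5 := (b2 5 (by omega)).trans n5
    have m7 := (b2 7 (by omega)).trans hi
    refine (ends_addCountsProgram (by rw [m0, m1]; omega) (by rw [m1]; omega) (by rw [m2]; omega)
      (by rw [m3]; omega)).mono ?_
    rintro s₂ ⟨c1, c2, c3⟩
    rw [m0, m1, m2, m3, m4, m5, m7] at c1
    refine ⟨by rw [c2 7 (by omega), m7], fun k hk => by
      rw [c2 k (by omega), b2 k (by omega), a1 k hk], fun k hk => by
      rw [c3 k (by omega), b3 k hk, a2 k hk], fun d hd => ?_⟩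
    rw [c1 d hd, b4, a3 d hd, sum_range_succ]
    congr 1
    refine sum_congr rfl fun j hj => sum_congr rfl fun j' hj' => ?_
    refine b1 _ ?_
    rw [mem_range] at hj hj'
    rw [n6]
    exact digits_lt hB2 (hB3 d k hd (by omega)) (by omega) (by omega)
  · rintro s' ⟨a1, a2, a3⟩
    refine ⟨(a1 0 (by omega)).trans h0, (a1 1 (by omega)).trans h1, (a1 2 (by omega)).trans h2,
      (a2 0 (by omega)).trans h7, (a2 1 (by omega)).trans h8, fun d hd => ?_⟩
    rw [a3 d hd, deficitCount_eq_sum hℓ hℓq hL hd]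

end RealRAM

/-! ### Estimates for the numerical evaluation of the rate -/

namespace ListRecovery

open Finset

variable {q ℓ L : ℕ}

theorem deficit_histogram_le (hℓq : ℓ ≤ q) (u : Fin L → Fin q) : deficit ℓ (histogram u) ≤ L := by
  rw [← card_notMem_bestSet hℓq]
  simpa using card_filter_le (univ : Finset (Fin L)) fun j => u j ∉ bestSet hℓq (histogram u)

/-- Sums over q^L words become sums of L + 1 terms, which is what makes their evaluation cheap. -/
theorem sum_comp_deficit (hℓq : ℓ ≤ q) (f : ℕ → ℝ) :
    ∑ u : Fin L → Fin q, f (deficit ℓ (histogram u)) =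
      ∑ d ∈ range (L + 1), deficitCount q ℓ L d * f d := by
  rw [← sum_fiberwise_of_maps_to (g := fun u : Fin L → Fin q => deficit ℓ (histogram u))
    (t := range (L + 1)) fun u _ => mem_range.2 (Nat.lt_succ_of_le (deficit_histogram_le hℓq u))]
  refine sum_congr rfl fun d _ => ?_
  rw [sum_congr rfl (g := fun _ => f d) fun u hu => by rw [(mem_filter.1 hu).2], sum_const,
    nsmul_eq_mul, deficitCount]

theorem weightSum_eq (hℓq : ℓ ≤ q) (x : ℝ) :
    weightSum q ℓ L x = ∑ d ∈ range (L + 1), deficitCount q ℓ L d * x ^ d :=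
  sum_comp_deficit hℓq fun d => x ^ d

theorem deficitSum_eq (hℓq : ℓ ≤ q) (x : ℝ) :
    deficitSum q ℓ L x = ∑ d ∈ range (L + 1), d * (deficitCount q ℓ L d * x ^ d) := by
  refine (sum_comp_deficit hℓq fun d => (d : ℝ) * x ^ d).trans ?_
  exact sum_congr rfl fun d _ => by ring

theorem weightSum_one : weightSum q ℓ L 1 = (q : ℝ) ^ L := by
  simp [weightSum]

theorem weightSum_le {x : ℝ} (hx : 0 ≤ x) (hx1 : x ≤ 1) : weightSum q ℓ L x ≤ (q : ℝ) ^ L := by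
  rw [← weightSum_one (ℓ := ℓ)]
  refine sum_le_sum fun u _ => ?_
  gcongr

/-- A positive deficit carries at least one factor x. This makes p / q^L a left end for the
bisection. -/
theorem deficitSum_le (hℓq : ℓ ≤ q) {x : ℝ} (hx : 0 ≤ x) (hx1 : x ≤ 1) :
    deficitSum q ℓ L x ≤ L * x * (q : ℝ) ^ L := by
  have h : ∀ u : Fin L → Fin q,
      (deficit ℓ (histogram u) : ℝ) * x ^ deficit ℓ (histogram u) ≤ L * x := by
    intro u
    have h1 := deficit_histogram_le hℓq u
    rcases Nat.eq_zero_or_pos (deficit ℓ (histogram u)) with h0 | h0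
    · rw [h0]; simp; positivity
    · have h2 : x ^ deficit ℓ (histogram u) ≤ x := pow_le_of_le_one hx hx1 (by omega)
      gcongr
  calc _ ≤ ∑ u : Fin L → Fin q, (L : ℝ) * x := sum_le_sum fun u _ => h u
    _ = _ := by simp [mul_comm]

theorem continuous_weightSum : Continuous (weightSum q ℓ L) := by
  unfold weightSum; fun_prop

theorem continuous_deficitSum : Continuous (deficitSum q ℓ L) := by
  unfold deficitSum; fun_prop

theorem log_two_ge_half : (1 / 2 : ℝ) ≤ Real.log 2 := by
  have := Real.log_two_gt_d9; norm_num at this ⊢; linarith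

theorem logb_one_add_le (hq : 2 ≤ q) {η : ℝ} (hη : 0 ≤ η) : Real.logb q (1 + η) ≤ 2 * η := by
  have hq' : (2 : ℝ) ≤ q := by exact_mod_cast hq
  have h1 : Real.log 2 ≤ Real.log q := Real.log_le_log (by norm_num) hq'
  have h2 := log_two_ge_half
  have h3 : Real.log (1 + η) ≤ η := by
    have := Real.log_le_sub_one_of_pos (show 0 < 1 + η by linarith); linarith
  rw [Real.logb, div_le_iff₀ (by linarith)]
  nlinarith

/-- The threshold rate is a Lipschitz function of the logarithm of the saddle point. -/
theorem abs_rate_sub_le (hq : 2 ≤ q) (hℓ : 1 ≤ ℓ) (hℓq : ℓ ≤ q) (hL : 1 ≤ L) {p x y η : ℝ}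
    (hp : 0 ≤ p) (hp1 : p ≤ 1) (hx : 0 < x) (hxy : x ≤ y) (hη : 0 ≤ η) (hyx : y ≤ (1 + η) * x) :
    |(1 - Real.logb q (weightSum q ℓ L x) / L + p * Real.logb q x) -
      (1 - Real.logb q (weightSum q ℓ L y) / L + p * Real.logb q y)| ≤ 2 * η := by
  have hq1 : (1 : ℝ) < q := by exact_mod_cast hq
  have hL' : (0 : ℝ) < L := by exact_mod_cast hL
  have hZx := one_le_weightSum (L := L) hq hℓ hℓq hx.le
  have hy : 0 < y := hx.trans_le hxy
  have h1 : weightSum q ℓ L x ≤ weightSum q ℓ L y := by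
    unfold weightSum; gcongr
  -- Deficits are at most L, so a factor 1 + η in the argument costs at most (1 + η)^L, which the
  -- division by L in the rate compensates.
  have h2 : weightSum q ℓ L y ≤ (1 + η) ^ L * weightSum q ℓ L x := by
    unfold weightSum
    rw [mul_sum]
    refine sum_le_sum fun u _ => ?_
    calc y ^ deficit ℓ (histogram u) ≤ ((1 + η) * x) ^ deficit ℓ (histogram u) := by gcongr
      _ = (1 + η) ^ deficit ℓ (histogram u) * x ^ deficit ℓ (histogram u) := mul_pow _ _ _
      _ ≤ _ := by
        gcongr
        · linarith
        · exact deficit_histogram_le hℓq u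
  have h3 := Real.logb_le_logb_of_le hq1 (by linarith) h1
  have h4 := Real.logb_le_logb_of_le hq1 (by linarith) h2
  rw [Real.logb_mul (by positivity) (by linarith), Real.logb_pow] at h4
  have h5 := Real.logb_le_logb_of_le hq1 hx hxy
  have h6 := Real.logb_le_logb_of_le hq1 hy hyx
  rw [Real.logb_mul (by positivity) hx.ne'] at h6
  have h7 := logb_one_add_le hq hη
  set a := Real.logb q (weightSum q ℓ L y) - Real.logb q (weightSum q ℓ L x) with ha
  set b := Real.logb q y - Real.logb q x with hb
  have ha0 : 0 ≤ a / L := div_nonneg (by linarith) hL'.le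
  have ha1 : a / L ≤ 2 * η := by
    rw [div_le_iff₀ hL']
    nlinarith
  have hb0 : 0 ≤ p * b := mul_nonneg hp (by linarith)
  have hb1 : p * b ≤ 2 * η := by nlinarith
  -- Both contributions lie between 0 and 2 η and enter with opposite signs, so their difference is
  -- at most 2 η in absolute value.
  have : (1 - Real.logb q (weightSum q ℓ L x) / L + p * Real.logb q x) -
      (1 - Real.logb q (weightSum q ℓ L y) / L + p * Real.logb q y) = a / L - p * b := by
    rw [ha, hb]; ring
  rw [this, abs_le]
  constructor <;> linarith

end ListRecovery

/-! ### Evaluation of the weights and of logarithms -/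

namespace RealRAM

open Finset ListRecovery

variable {Y q ℓ L : ℕ} {p ε : ℝ}

theorem HasCounts.of_eq {s s' : Store} (h : HasCounts q ℓ L p ε s)
    (h1 : ∀ k < 3, s'.nat k = s.nat k) (h2 : ∀ k, k < 2 ∨ 20 ≤ k → s'.real k = s.real k) :
    HasCounts q ℓ L p ε s' where
  nat0 := (h1 0 (by omega)).trans h.nat0
  nat1 := (h1 1 (by omega)).trans h.nat1
  nat2 := (h1 2 (by omega)).trans h.nat2
  real0 := (h2 0 (by omega)).trans h.real0
  real1 := (h2 1 (by omega)).trans h.real1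
  count d hd := (h2 _ (by omega)).trans (h.count d hd)

theorem HasCounts.update {s : Store} (h : HasCounts q ℓ L p ε s) {k : ℕ} (hk : 2 ≤ k)
    (hk' : k < 20) (x : ℝ) : HasCounts q ℓ L p ε ⟨s.nat, Function.update s.real k x⟩ :=
  h.of_eq (fun _ _ => rfl) fun i hi => by
    simp (disch := omega) only [Function.update_of_ne]

/-- Evaluate the weights of all words at `real 2`. -/
def weightProgram : Program :=
  .seq (assignReal 10 (realConst 0)) <|
  .seq (assignReal 11 (realConst 0)) <|
  .seq (assignReal 12 (realConst 1)) <|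
  forLoop 7 (.add (natVar 2) (.const 1)) <|
    .seq (assignReal 10 (.add (realVar 10)
      (.mul (.cell (countAddr (natVar 7))) (realVar 12)))) <|
    .seq (assignReal 11 (.add (realVar 11) (.mul (.ofNat (natVar 7))
      (.mul (.cell (countAddr (natVar 7))) (realVar 12))))) <|
    assignReal 12 (.mul (realVar 12) (realVar 2))

theorem ends_weightProgram (hℓq : ℓ ≤ q) (hY : L + 1 ≤ Y) {s : Store}
    (hs : HasCounts q ℓ L p ε s) :
    Ends Y weightProgram (fun s' => HasCounts q ℓ L p ε s' ∧
      s'.real 10 = weightSum q ℓ L (s.real 2) ∧ s'.real 11 = deficitSum q ℓ L (s.real 2) ∧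
      ∀ k < 10, s'.real k = s.real k) s := by
  refine ends_seq (ends_setReal (ends_seq (ends_setReal (ends_seq (ends_setReal ?_)))))
  simp only [NatExpr.eval, RealExpr.eval]
  refine ends_forLoop (L + 1) hY (fun k s' => HasCounts q ℓ L p ε s' ∧
    s'.real 10 = ∑ d ∈ range k, deficitCount q ℓ L d * s.real 2 ^ d ∧
    s'.real 11 = ∑ d ∈ range k, d * (deficitCount q ℓ L d * s.real 2 ^ d) ∧
    s'.real 12 = s.real 2 ^ k ∧ ∀ k < 10, s'.real k = s.real k) ?_ ?_ ?_ ?_ ?_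
  · rintro k s' x ⟨h1, h2, h3, h4, h5⟩
    refine ⟨h1.of_eq (fun i hi => ?_) fun _ _ => rfl, h2, h3, h4, h5⟩
    simp (disch := omega) only [Function.update_of_ne]
  · rintro k s' ⟨h1, -⟩
    simp only [NatExpr.eval, h1.nat2]
  · refine ⟨((hs.update (by omega) (by omega) _).update (by omega) (by omega) _).update
      (by omega) (by omega) _, by simp, by simp, by simp, fun k hk => ?_⟩
    simp (disch := omega) only [Function.update_of_ne]
  · rintro k s' hk hi ⟨h1, h2, h3, h4, h5⟩
    refine ends_seq (ends_setReal (ends_seq (ends_setReal (ends_setReal ?_))))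
    have hc : s'.real (21 + (k + k)) = deficitCount q ℓ L k := h1.count k (by omega)
    simp only [NatExpr.eval, RealExpr.eval, countAddr, hi]
    simp (disch := omega) only [Function.update_self, Function.update_of_ne, hc, h2, h3, h4,
      h5 2 (by omega)]
    refine ⟨trivial, ((h1.update (by omega) (by omega) _).update (by omega) (by omega) _).update
      (by omega) (by omega) _, (sum_range_succ _ _).symm, (sum_range_succ _ _).symm,
      (pow_succ _ _).symm, fun k hk => ?_⟩
    simp (disch := omega) only [Function.update_of_ne, h5 k hk]
  · rintro s' ⟨h1, h2, h3, h4, h5⟩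
    exact ⟨h1, h2.trans (weightSum_eq hℓq _).symm, h3.trans (deficitSum_eq hℓq _).symm, h5⟩

/-- Store an approximation of the logarithm with base `q` of `real 13` in `real 14`. -/
def logProgram : Program :=
  .seq (assignReal 14 (realConst 0)) <|
  .seq (.loop (.realLe (.ofNat (natVar 0)) (realVar 13)) <|
    .seq (assignReal 13 (.div (realVar 13) (.ofNat (natVar 0)))) <|
    assignReal 14 (.add (realVar 14) (realConst 1))) <|
  .seq (assignReal 15 (realConst 1)) <|
  .loop (.realLt (.div (realVar 1) (realConst 4)) (realVar 15)) <|
    .seq (assignReal 15 (.div (realVar 15) (realConst 2))) <|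
    .seq (assignReal 13 (.mul (realVar 13) (realVar 13))) <|
    .ite (.realLe (.ofNat (natVar 0)) (realVar 13))
      (.seq (assignReal 13 (.div (realVar 13) (.ofNat (natVar 0))))
        (assignReal 14 (.add (realVar 14) (realVar 15)))) .skip

/-- Divisions by q give the integer part, and squarings the binary digits after it. Throughout the
second loop log y = `real 14` + `real 15` * log (`real 13`) in base q, with 1 ≤ `real 13` < q. The
last term is at most the step `real 15`, which is halved until it is at most ε / 4. -/
theorem ends_logProgram (hq : 2 ≤ q) {s : Store} (hs : HasCounts q ℓ L p ε s) {y : ℝ}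
    (hsy : s.real 13 = y) (hy : 1 ≤ y) (hyY : y < 2 ^ Y) (hε : 4 ≤ ε * 2 ^ Y) :
    Ends Y logProgram (fun s' => HasCounts q ℓ L p ε s' ∧ |s'.real 14 - Real.logb q y| ≤ ε / 4 ∧
      ∀ k < 13, s'.real k = s.real k) s := by
  have hq1 : (1 : ℝ) < q := by exact_mod_cast hq
  have hq2 : (2 : ℝ) ≤ q := by exact_mod_cast hq
  have hq0 : (0 : ℝ) < q := by linarith
  refine ends_seq (ends_setReal (ends_seq ?_))
  simp only [NatExpr.eval, RealExpr.eval]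
  refine ends_loop Y le_rfl (fun k s' => HasCounts q ℓ L p ε s' ∧ s'.real 13 = y / (q : ℝ) ^ k ∧
    1 ≤ s'.real 13 ∧ s'.real 14 = k ∧ ∀ k < 13, s'.real k = s.real k) ?_ ?_
  · refine ⟨hs.update (by omega) (by omega) _, ?_, ?_, ?_, fun k hk => ?_⟩
    · simp [hsy]
    · simpa [hsy] using hy
    · simp
    · simp (disch := omega) only [Function.update_of_ne]
  rintro k s' hk ⟨h1, h2, h3, h4, h5⟩
  simp only [Test.Holds, NatExpr.eval, RealExpr.eval, h1.nat0, not_le]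
  rcases le_or_gt (q : ℝ) (s'.real 13) with h | h
  · right
    refine ⟨?_, h, ?_⟩
    · by_contra hlt
      obtain rfl : k = Y := by omega
      have h6 : (1 : ℝ) * q ^ k ≤ y := by
        rw [← le_div_iff₀ (by positivity), ← h2]; exact h3
      have h7 : (2 : ℝ) ^ k ≤ q ^ k := by gcongr
      linarith
    · refine ends_seq (ends_setReal (ends_setReal ?_))
      simp only [NatExpr.eval, RealExpr.eval, h1.nat0]
      simp (disch := omega) only [Function.update_self, Function.update_of_ne]
      refine ⟨(h1.update (by omega) (by omega) _).update (by omega) (by omega) _, ?_, ?_, ?_,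
        fun k hk => ?_⟩
      · rw [h2, pow_succ, div_div]
      · rw [le_div_iff₀ hq0]; linarith
      · rw [h4]; push_cast; ring
      · simp (disch := omega) only [Function.update_of_ne, h5 k hk]
  left
  refine ⟨h, ends_seq (ends_setReal ?_)⟩
  simp only [NatExpr.eval, RealExpr.eval]
  have hlog : Real.logb q y = s'.real 14 + 1 * Real.logb q (s'.real 13) := by
    rw [h2, h4, Real.logb_div (by linarith) (by positivity), Real.logb_pow,
      Real.logb_self_eq_one hq1]
    ring
  refine ends_loop Y le_rfl (fun k s' => HasCounts q ℓ L p ε s' ∧ s'.real 15 = (1 / 2) ^ k ∧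
    Real.logb q y = s'.real 14 + s'.real 15 * Real.logb q (s'.real 13) ∧ 1 ≤ s'.real 13 ∧
    s'.real 13 < q ∧ ∀ k < 13, s'.real k = s.real k) ?_ ?_
  · refine ⟨h1.update (by omega) (by omega) _, ?_, ?_, ?_, ?_, fun k hk => ?_⟩
    · simp
    · simpa using hlog
    · simpa using h3
    · simpa using h
    · simp (disch := omega) only [Function.update_of_ne, h5 k hk]
  clear h1 h2 h3 h4 h5 h hlog
  rintro k s' hk ⟨h1, h2, h3, h4, h4', h5⟩
  simp only [Test.Holds, NatExpr.eval, RealExpr.eval, h1.real1, not_lt, Nat.cast_ofNat]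
  have hδ : 0 < s'.real 15 := by rw [h2]; positivity
  rcases lt_or_ge (ε / 4) (s'.real 15) with h | h
  · right
    refine ⟨?_, h, ?_⟩
    · by_contra hlt
      obtain rfl : k = Y := by omega
      rw [h2, div_pow, one_pow, lt_div_iff₀ (by positivity)] at h
      linarith
    · refine ends_seq (ends_setReal (ends_seq (ends_setReal ?_)))
      simp only [NatExpr.eval, RealExpr.eval, Nat.cast_ofNat]
      simp (disch := omega) only [Function.update_of_ne]
      have hsq : 1 ≤ s'.real 13 * s'.real 13 := by nlinarith
      have hlsq : Real.logb q (s'.real 13 * s'.real 13) = 2 * Real.logb q (s'.real 13) := by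
        rw [Real.logb_mul (by linarith) (by linarith)]; ring
      have hc := (h1.update (show 2 ≤ 15 by omega) (by omega) (s'.real 15 / 2)).update
        (show 2 ≤ 13 by omega) (by omega) (s'.real 13 * s'.real 13)
      refine ends_ite (fun hb => ends_seq (ends_setReal (ends_setReal ?_))) (fun hb => ends_skip ?_)
      · simp only [Test.Holds, NatExpr.eval, RealExpr.eval, Function.update_self, h1.nat0] at hb
        simp only [NatExpr.eval, RealExpr.eval]
        simp (disch := omega) only [Function.update_self, Function.update_of_ne, h1.nat0]
        refine ⟨(hc.update (by omega) (by omega) _).update (by omega) (by omega) _, ?_, ?_, ?_, ?_,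
          fun k hk => ?_⟩
        · rw [h2, pow_succ]; ring
        · rw [h3, Real.logb_div (by linarith) (by linarith), hlsq, Real.logb_self_eq_one hq1]; ring
        · rw [le_div_iff₀ hq0]; linarith
        · rw [div_lt_iff₀ hq0]; nlinarith
        · simp (disch := omega) only [Function.update_of_ne, h5 k hk]
      · simp only [Test.Holds, NatExpr.eval, RealExpr.eval, Function.update_self, h1.nat0,
          not_le] at hb
        simp (disch := omega) only [Function.update_self, Function.update_of_ne]
        refine ⟨hc, ?_, ?_, hsq, hb, fun k hk => ?_⟩
        · rw [h2, pow_succ]; ring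
        · rw [h3, hlsq]; ring
        · simp (disch := omega) only [Function.update_of_ne, h5 k hk]
  · left
    refine ⟨h, h1, ?_, h5⟩
    have l0 : 0 ≤ Real.logb q (s'.real 13) := Real.logb_nonneg hq1 h4
    have l1 : Real.logb q (s'.real 13) ≤ 1 := by
      rw [← Real.logb_self_eq_one hq1]
      exact Real.logb_le_logb_of_le hq1 (by linarith) h4'.le
    rw [h3, abs_le]
    constructor <;> nlinarith

end RealRAM

/-! ### Bisection for the saddle point, and the complete program -/

namespace RealRAM

open Finset ListRecovery

variable {Y q ℓ L : ℕ} {p ε : ℝ}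

/-- `p * L * Z`, where `Z` is the sum of the weights in the cell `real 10`. -/
def meanBound : RealExpr := .mul (.mul (realVar 0) (.ofNat (natVar 2))) (realVar 10)

/-- Approximate the saddle point by bisection. Its reciprocal is stored in `real 3`. -/
def bisectProgram : Program :=
  .seq (assignReal 4 (.div (realVar 0) (realVar 10))) <|
  .seq (assignReal 5 (realConst 1)) <|
  .seq (assignReal 6 (.mul (realVar 4) (.div (realVar 1) (realConst 4)))) <|
  .seq (.loop (.realLt (realVar 6) (.sub (realVar 5) (realVar 4))) <|
    .seq (assignReal 2 (.div (.add (realVar 4) (realVar 5)) (realConst 2))) <|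
    .seq weightProgram <|
    .ite (.realLe (realVar 11) meanBound) (assignReal 4 (realVar 2))
      (assignReal 5 (realVar 2))) <|
  .seq (assignReal 2 (realVar 4)) <|
  assignReal 3 (.div (realConst 1) (realVar 4))

/-- `x` approximates a saddle point `y`. -/
structure IsNearSaddle (q ℓ L : ℕ) (p ε x y : ℝ) : Prop where
  le : x ≤ y
  le_one : y ≤ 1
  le_mul : y ≤ (1 + ε / 4) * x
  le_pow_mul : p ≤ x * (q : ℝ) ^ L
  saddle : deficitSum q ℓ L y = p * L * weightSum q ℓ L y ∨
    (y = 1 ∧ deficitSum q ℓ L y ≤ p * L * weightSum q ℓ L y)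

/-- The bracket starts as [p / q^L, 1] and keeps opposite weak signs of D - p L Z at its ends; no
monotonicity is needed, since the intermediate value theorem provides a saddle point inside. The
length is compared with ε / 4 times the initial left end, so the final error is relative to x. -/
theorem ends_bisectProgram (hq : 2 ≤ q) (hℓ : 1 ≤ ℓ) (hℓq : ℓ ≤ q)
    (hp : 0 < p) (hp1 : p ≤ 1) (hε : 0 < ε) (hLY : L + 1 ≤ Y)
    (hY : 4 * (q : ℝ) ^ L ≤ p * ε * 2 ^ Y) {s : Store} (hs : HasCounts q ℓ L p ε s)
    (hZ : s.real 10 = weightSum q ℓ L 1)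
    (hA : p * L * weightSum q ℓ L 1 ≤ deficitSum q ℓ L 1) :
    Ends Y bisectProgram (fun s' => HasCounts q ℓ L p ε s' ∧ s'.real 3 = 1 / s'.real 2 ∧
      0 < s'.real 2 ∧ ∃ y, IsNearSaddle q ℓ L p ε (s'.real 2) y) s := by
  have hq1 : (1 : ℝ) < q := by exact_mod_cast hq
  have hqL : (1 : ℝ) ≤ (q : ℝ) ^ L := one_le_pow₀ hq1.le
  set a := p / (q : ℝ) ^ L with ha
  have ha0 : 0 < a := by positivity
  have ha1 : a ≤ 1 := (div_le_one (by positivity)).2 (by linarith)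
  refine ends_seq (ends_setReal (ends_seq (ends_setReal (ends_seq (ends_setReal (ends_seq ?_))))))
  simp only [NatExpr.eval, RealExpr.eval, Nat.cast_ofNat]
  simp (disch := omega) only [Function.update_self, Function.update_of_ne, hs.real0, hs.real1, hZ,
    weightSum_one, ← ha]
  refine ends_loop Y le_rfl (fun k s' => HasCounts q ℓ L p ε s' ∧ a ≤ s'.real 4 ∧
    s'.real 4 ≤ s'.real 5 ∧ s'.real 5 ≤ 1 ∧ s'.real 5 - s'.real 4 = (1 - a) / 2 ^ k ∧
    s'.real 6 = a * (ε / 4) ∧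
    deficitSum q ℓ L (s'.real 4) ≤ p * L * weightSum q ℓ L (s'.real 4) ∧
    p * L * weightSum q ℓ L (s'.real 5) ≤ deficitSum q ℓ L (s'.real 5)) ?_ ?_
  · have hc := ((hs.update (show 2 ≤ 4 by omega) (by omega) a).update
      (show 2 ≤ 5 by omega) (by omega) ((1 : ℕ) : ℝ)).update (show 2 ≤ 6 by omega) (by omega)
        (a * (ε / 4))
    refine ⟨hc, ?_⟩
    simp (disch := omega) only [Function.update_self, Function.update_of_ne, Nat.cast_one]
    refine ⟨le_rfl, ha1, le_rfl, by simp, trivial, ?_, hA⟩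
    have h1 := deficitSum_le (L := L) (ℓ := ℓ) hℓq ha0.le ha1
    have h2 : (L : ℝ) * a * (q : ℝ) ^ L = p * L := by rw [ha]; field_simp
    have h3 := one_le_weightSum (L := L) hq hℓ hℓq ha0.le
    have h4 : 0 ≤ p * L := by positivity
    nlinarith
  rintro k s' hk ⟨h1, h2, h3, h4, h5, h6, h7, h8⟩
  simp only [Test.Holds, NatExpr.eval, RealExpr.eval, h6, not_lt]
  rcases lt_or_ge (a * (ε / 4)) (s'.real 5 - s'.real 4) with h | h
  · right
    refine ⟨?_, h, ?_⟩
    · by_contra hlt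
      obtain rfl : k = Y := by omega
      -- After Y halvings the bracket is short enough, because 2^Y ≥ 4 q^L / (p ε).
      have e1 : (1 - a) / 2 ^ k ≤ a * (ε / 4) := by
        rw [div_le_iff₀ (by positivity), ha]
        have : p / (q : ℝ) ^ L * (ε / 4) * 2 ^ k = (p * ε * 2 ^ k) / (4 * (q : ℝ) ^ L) := by
          field_simp
        rw [this]
        have h9 : 1 ≤ (p * ε * 2 ^ k) / (4 * (q : ℝ) ^ L) := (one_le_div (by positivity)).2 hY
        linarith
      linarith
    · refine ends_seq (ends_setReal (ends_seq ?_))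
      simp only [NatExpr.eval, RealExpr.eval, Nat.cast_ofNat]
      set m := (s'.real 4 + s'.real 5) / 2 with hm
      refine (ends_weightProgram hℓq hLY (h1.update (show 2 ≤ 2 by omega) (by omega) m)).mono ?_
      rintro s'' ⟨b1, b2, b3, b4⟩
      simp only [Function.update_self] at b2 b3
      have m2 := b4 2 (by omega)
      have m4 := b4 4 (by omega)
      have m5 := b4 5 (by omega)
      have m6 := b4 6 (by omega)
      simp (disch := omega) only [Function.update_self, Function.update_of_ne] at m2 m4 m5 m6
      refine ends_ite (fun hb => ends_setReal ?_) (fun hb => ends_setReal ?_)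
      · simp only [Test.Holds, NatExpr.eval, RealExpr.eval, meanBound, b1.real0, b1.nat2, b2,
          b3] at hb
        refine ⟨b1.update (show 2 ≤ 4 by omega) (by omega) _, ?_⟩
        simp only [NatExpr.eval, RealExpr.eval]
        simp (disch := omega) only [Function.update_self, Function.update_of_ne, m2, m5, m6]
        refine ⟨by linarith, by linarith, h4, ?_, h6, hb, h8⟩
        have : s'.real 5 - m = (s'.real 5 - s'.real 4) / 2 := by rw [hm]; ring
        rw [this, h5, pow_succ, div_div]
      · simp only [Test.Holds, NatExpr.eval, RealExpr.eval, meanBound, b1.real0, b1.nat2, b2,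
          b3, not_le] at hb
        refine ⟨b1.update (show 2 ≤ 5 by omega) (by omega) _, ?_⟩
        simp only [NatExpr.eval, RealExpr.eval]
        simp (disch := omega) only [Function.update_self, Function.update_of_ne, m2, m4, m6]
        refine ⟨h2, by linarith, by linarith, ?_, h6, h7, hb.le⟩
        have : m - s'.real 4 = (s'.real 5 - s'.real 4) / 2 := by rw [hm]; ring
        rw [this, h5, pow_succ, div_div]
  · left
    refine ⟨h, ends_seq (ends_setReal (ends_setReal ?_))⟩
    simp only [NatExpr.eval, RealExpr.eval, Nat.cast_one]
    refine ⟨(h1.update (by omega) (by omega) _).update (by omega) (by omega) _, ?_⟩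
    simp (disch := omega) only [Function.update_self, Function.update_of_ne]
    refine ⟨trivial, by linarith, ?_⟩
    obtain ⟨y, hy, hy0⟩ := intermediate_value_Icc h3
      (f := fun x => deficitSum q ℓ L x - p * L * weightSum q ℓ L x)
      (continuous_deficitSum.sub (continuous_const.mul continuous_weightSum)).continuousOn
      (show (0 : ℝ) ∈ Set.Icc _ _ from ⟨by linarith, by linarith⟩)
    simp only at hy0
    refine ⟨y, hy.1, hy.2.trans h4, ?_, ?_, .inl (by linarith)⟩
    · have h9 : a * (ε / 4) ≤ s'.real 4 * (ε / 4) := by gcongr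
      have := hy.2
      linarith
    · rw [ha, div_le_iff₀ (by positivity)] at h2
      exact h2

/-- Find an approximate saddle point for `p > 0`. -/
def saddleProgram : Program :=
  .seq (assignReal 2 (realConst 1)) <|
  .seq weightProgram <|
  .ite (.realLe (realVar 11) meanBound) (assignReal 3 (realConst 1)) bisectProgram

/-- If the uniform distribution already satisfies the constraint on the mean, x = 1 is used and is
exact; otherwise the sign at 1 is the one that bisection requires. -/
theorem ends_saddleProgram (hq : 2 ≤ q) (hℓ : 1 ≤ ℓ) (hℓq : ℓ ≤ q)
    (hp : 0 < p) (hp1 : p ≤ 1) (hε : 0 < ε) (hLY : L + 1 ≤ Y)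
    (hY : 4 * (q : ℝ) ^ L ≤ p * ε * 2 ^ Y) {s : Store} (hs : HasCounts q ℓ L p ε s) :
    Ends Y saddleProgram (fun s' => HasCounts q ℓ L p ε s' ∧ s'.real 3 = 1 / s'.real 2 ∧
      0 < s'.real 2 ∧ ∃ y, IsNearSaddle q ℓ L p ε (s'.real 2) y) s := by
  have hq1 : (1 : ℝ) < q := by exact_mod_cast hq
  have hqL : (1 : ℝ) ≤ (q : ℝ) ^ L := one_le_pow₀ hq1.le
  refine ends_seq (ends_setReal (ends_seq ?_))
  simp only [NatExpr.eval, RealExpr.eval, Nat.cast_one]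
  refine (ends_weightProgram hℓq hLY (hs.update (show 2 ≤ 2 by omega) (by omega) 1)).mono ?_
  rintro s' ⟨b1, b2, b3, b4⟩
  have m2 := b4 2 (by omega)
  simp only [Function.update_self] at b2 b3 m2
  refine ends_ite (fun hb => ends_setReal ?_) (fun hb => ?_)
  · simp only [Test.Holds, NatExpr.eval, RealExpr.eval, meanBound, b1.real0, b1.nat2, b2,
      b3] at hb
    refine ⟨b1.update (show 2 ≤ 3 by omega) (by omega) _, ?_⟩
    simp only [NatExpr.eval, RealExpr.eval]
    simp (disch := omega) only [Function.update_self, Function.update_of_ne, m2]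
    refine ⟨by simp, one_pos, 1, le_rfl, le_rfl, by linarith, by linarith, .inr ⟨rfl, hb⟩⟩
  · simp only [Test.Holds, NatExpr.eval, RealExpr.eval, meanBound, b1.real0, b1.nat2, b2,
      b3, not_le] at hb
    exact ends_bisectProgram hq hℓ hℓq hp hp1 hε hLY hY b1 b2 hb.le

/-- Compute the approximation of the rate in the cell `real 8`. -/
def rateProgram : Program :=
  .seq countProgram <|
  .seq (.ite (.realLe (realVar 0) (realConst 0))
    (.seq (assignReal 2 (realConst 0)) (assignReal 3 (realConst 1))) saddleProgram) <|
  .seq weightProgram <|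
  .seq (assignReal 13 (realVar 10)) <|
  .seq logProgram <|
  .seq (assignReal 7 (realVar 14)) <|
  .seq (assignReal 13 (realVar 3)) <|
  .seq logProgram <|
  assignReal 8 (.sub (.sub (realConst 1) (.div (realVar 7) (.ofNat (natVar 2))))
    (.mul (realVar 0) (realVar 14)))

/-- The error budget is ε / 2 for the saddle point and ε / 4 for each logarithm, using L ≥ 1 and p ≤
1. The logarithm of 1 / x is computed because arguments must be at least 1. For p = 0 the reciprocal
cell is set to 1, so that its term vanishes. -/
theorem ends_rateProgram (hq : 2 ≤ q) (hℓ : 1 ≤ ℓ) (hℓq : ℓ ≤ q) (hL : 1 ≤ L)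
    (hp : 0 ≤ p) (hp1 : p ≤ 1) (hε : 0 < ε) (hB : indexBase q L ^ 4 ≤ Y)
    (hY : 0 < p → 4 * (q : ℝ) ^ L ≤ p * ε * 2 ^ Y) (hY1 : (q : ℝ) ^ L < 2 ^ Y)
    (hY2 : 0 < p → (q : ℝ) ^ L < p * 2 ^ Y) (hY3 : 4 ≤ ε * 2 ^ Y) :
    Ends Y rateProgram (fun s => HasCounts q ℓ L p ε s ∧ ((p = 0 ∧ ℓ ≤ 1 ∧ 1 < L) ∨
      ∃ r, IsThresholdRate (NotListRecoverable q p ℓ L) r ∧ |s.real 8 - r| ≤ ε))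
      (input q ℓ L p ε) := by
  have hq1 : (1 : ℝ) < q := by exact_mod_cast hq
  have hL' : (1 : ℝ) ≤ L := by exact_mod_cast hL
  have hLY : L + 1 ≤ Y := by
    have h1 : L + 1 ≤ indexBase q L := by unfold indexBase; nlinarith
    have h2 : indexBase q L ≤ indexBase q L ^ 4 := Nat.le_self_pow (by decide) _
    omega
  refine ends_seq ((ends_countProgram hℓ hℓq hL hB).mono ?_)
  intro s₀ h₀
  have hsaddle : Ends Y (.ite (.realLe (realVar 0) (realConst 0))
      (.seq (assignReal 2 (realConst 0)) (assignReal 3 (realConst 1))) saddleProgram)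
      (fun s => HasCounts q ℓ L p ε s ∧ 0 ≤ s.real 2 ∧ s.real 2 ≤ 1 ∧ 1 ≤ s.real 3 ∧
        s.real 3 < 2 ^ Y ∧ p * Real.logb q (s.real 3) = -(p * Real.logb q (s.real 2)) ∧
        ((p = 0 ∧ ℓ ≤ 1 ∧ 1 < L) ∨ ∃ r, IsThresholdRate (NotListRecoverable q p ℓ L) r ∧
          |(1 - Real.logb q (weightSum q ℓ L (s.real 2)) / L + p * Real.logb q (s.real 2)) - r| ≤
            ε / 2)) s₀ := by
    refine ends_ite (fun hb => ?_) (fun hb => ?_)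
    · simp only [Test.Holds, NatExpr.eval, RealExpr.eval, h₀.real0, Nat.cast_zero] at hb
      obtain rfl : p = 0 := le_antisymm hb hp
      refine ends_seq (ends_setReal (ends_setReal ?_))
      simp only [NatExpr.eval, RealExpr.eval, Nat.cast_one, Nat.cast_zero]
      refine ⟨(h₀.update (by omega) (by omega) _).update (by omega) (by omega) _, ?_⟩
      simp (disch := omega) only [Function.update_self, Function.update_of_ne]
      refine ⟨le_rfl, zero_le_one, le_rfl, one_lt_pow₀ (by norm_num) (by omega), by simp, ?_⟩
      by_cases hsp : ℓ ≤ 1 ∧ 1 < L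
      · exact .inl ⟨trivial, hsp⟩
      · right
        refine ⟨_, isThresholdRate_notListRecoverable hq hℓ hℓq hL le_rfl zero_le_one
          (.inr ⟨rfl, rfl, by omega⟩) (.inl ?_), ?_⟩
        · rw [zero_mul, zero_mul]
          refine sum_eq_zero fun u _ => ?_
          by_cases hu : deficit ℓ (histogram u) = 0 <;> simp [hu]
        · rw [sub_self, abs_zero]; positivity
    · simp only [Test.Holds, NatExpr.eval, RealExpr.eval, h₀.real0, Nat.cast_zero, not_le] at hb
      refine (ends_saddleProgram hq hℓ hℓq hb hp1 hε hLY (hY hb) h₀).mono ?_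
      rintro s ⟨h1, h2, h3, y, hy⟩
      have hx1 := hy.le.trans hy.le_one
      refine ⟨h1, h3.le, hx1, ?_, ?_, ?_, .inr ⟨_, isThresholdRate_notListRecoverable hq hℓ hℓq hL
        (h3.le.trans hy.le) hy.le_one (.inl ⟨hb, h3.trans_le hy.le⟩) hy.saddle, ?_⟩⟩
      · rw [h2]; exact one_le_one_div h3 hx1
      -- Since x ≥ p / q^L, its reciprocal is at most q^L / p, which `hY2` puts below 2^Y.
      · rw [h2, div_lt_iff₀ h3]
        have h4 := hY2 hb
        have h5 := hy.le_pow_mul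
        have h6 : (q : ℝ) ^ L < s.real 2 * q ^ L * 2 ^ Y := by
          refine h4.trans_le ?_
          gcongr
        have h7 : (0 : ℝ) < (q : ℝ) ^ L := by positivity
        nlinarith
      · rw [h2, one_div, Real.logb_inv]; ring
      · refine (abs_rate_sub_le hq hℓ hℓq hL hp hp1 h3 hy.le (by positivity) hy.le_mul).trans
          (le_of_eq ?_)
        ring
  refine ends_seq (hsaddle.mono ?_)
  rintro s₁ ⟨a1, a2, a3, a4, a5, a6, a7⟩
  refine ends_seq ((ends_weightProgram hℓq hLY a1).mono ?_)
  rintro s₂ ⟨b1, b2, -, b4⟩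
  refine ends_seq (ends_setReal (ends_seq ?_))
  simp only [NatExpr.eval, RealExpr.eval, b2]
  have hZ1 := one_le_weightSum (L := L) hq hℓ hℓq a2
  have hZ2 := weightSum_le (q := q) (ℓ := ℓ) (L := L) a2 a3
  refine (ends_logProgram hq (b1.update (show 2 ≤ 13 by omega) (by omega) _) (by simp) hZ1
    (hZ2.trans_lt hY1) hY3).mono ?_
  rintro s₃ ⟨c1, c2, c3⟩
  have m3 := c3 3 (by omega)
  simp (disch := omega) only [Function.update_of_ne, b4 3 (by omega)] at m3
  refine ends_seq (ends_setReal (ends_seq (ends_setReal (ends_seq ?_))))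
  simp only [NatExpr.eval, RealExpr.eval]
  simp (disch := omega) only [Function.update_of_ne, m3]
  refine (ends_logProgram hq ((c1.update (show 2 ≤ 7 by omega) (by omega) _).update
    (show 2 ≤ 13 by omega) (by omega) _) (by simp) a4 a5 hY3).mono ?_
  rintro s₄ ⟨d1, d2, d3⟩
  have m7 := d3 7 (by omega)
  simp (disch := omega) only [Function.update_self, Function.update_of_ne] at m7
  refine ends_setReal ⟨d1.update (show 2 ≤ 8 by omega) (by omega) _, ?_⟩
  simp only [NatExpr.eval, RealExpr.eval, Function.update_self, m7, d1.real0, d1.nat2, Nat.cast_one]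
  refine a7.imp_right ?_
  rintro ⟨r, hr, hr'⟩
  refine ⟨r, hr, ?_⟩
  set z := Real.logb q (weightSum q ℓ L (s₁.real 2)) with hz
  set w := Real.logb q (s₁.real 3) with hw
  have e1 : |(s₃.real 14 - z) / L| ≤ ε / 4 := by
    rw [abs_div, abs_of_pos (show (0 : ℝ) < L by linarith), div_le_iff₀ (by linarith)]
    nlinarith
  have e2 : |p * (s₄.real 14 - w)| ≤ ε / 4 := by
    rw [abs_mul, abs_of_nonneg hp]
    nlinarith [abs_nonneg (s₄.real 14 - w)]
  have e3 : 1 - s₃.real 14 / L - p * s₄.real 14 - r =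
      ((1 - z / L + p * Real.logb q (s₁.real 2)) - r) - (s₃.real 14 - z) / L -
        p * (s₄.real 14 - w) := by
    have : p * Real.logb q (s₁.real 2) = -(p * w) := by rw [a6]; ring
    rw [this, sub_div]; ring
  rw [e3]
  rw [abs_le] at *
  constructor <;> linarith [hr'.1, hr'.2, e1.1, e1.2, e2.1, e2.2]

/-- Approximate the threshold rate for list-recovery. -/
def thresholdProgram : Program :=
  .seq rateProgram <|
  .seq (.ite (.realLe (realVar 0) (realConst 0)) (.ite (.natLe (natVar 1) (.const 1))
    (.ite (.natLt (.const 1) (natVar 2)) (assignReal 8 (realConst 1)) .skip) .skip) .skip) <|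
  assignReal 0 (realVar 8)

/-- In the exceptional case p = 0, ℓ = 1 < L the computed value is overwritten by the threshold rate
1. -/
theorem ends_thresholdProgram (hq : 2 ≤ q) (hℓ : 1 ≤ ℓ) (hℓq : ℓ ≤ q) (hL : 1 ≤ L)
    (hp : 0 ≤ p) (hp1 : p ≤ 1) (hε : 0 < ε) (hB : indexBase q L ^ 4 ≤ Y)
    (hY : 0 < p → 4 * (q : ℝ) ^ L ≤ p * ε * 2 ^ Y) (hY1 : (q : ℝ) ^ L < 2 ^ Y)
    (hY2 : 0 < p → (q : ℝ) ^ L < p * 2 ^ Y) (hY3 : 4 ≤ ε * 2 ^ Y) :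
    Ends Y thresholdProgram (fun s =>
      ∃ r, IsThresholdRate (NotListRecoverable q p ℓ L) r ∧ |s.output - r| ≤ ε)
      (input q ℓ L p ε) := by
  refine ends_seq ((ends_rateProgram hq hℓ hℓq hL hp hp1 hε hB hY hY1 hY2 hY3).mono ?_)
  rintro s ⟨h1, h2⟩
  have key : Ends Y (.ite (.realLe (realVar 0) (realConst 0)) (.ite (.natLe (natVar 1) (.const 1))
      (.ite (.natLt (.const 1) (natVar 2)) (assignReal 8 (realConst 1)) .skip) .skip) .skip)
      (fun s => ∃ r, IsThresholdRate (NotListRecoverable q p ℓ L) r ∧ |s.real 8 - r| ≤ ε) s := by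
    have hb : ∀ {x y : Prop}, ¬ x → (x ∨ y) → y := fun hx h => h.resolve_left hx
    refine ends_ite (fun b1 => ends_ite (fun b2 => ends_ite (fun b3 => ends_setReal ?_)
      fun b3 => ends_skip (hb ?_ h2)) fun b2 => ends_skip (hb ?_ h2)) fun b1 => ends_skip (hb ?_ h2)
    · simp only [Test.Holds, NatExpr.eval, RealExpr.eval, h1.real0, h1.nat1, h1.nat2,
        Nat.cast_zero] at b1 b2 b3
      obtain rfl : p = 0 := le_antisymm b1 hp
      obtain rfl : ℓ = 1 := le_antisymm b2 hℓ
      refine ⟨1, isThresholdRate_one b3, ?_⟩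
      simp only [NatExpr.eval, RealExpr.eval, Function.update_self, Nat.cast_one, sub_self,
        abs_zero]
      exact hε.le
    · rintro ⟨-, -, h⟩
      exact b3 (by simpa only [Test.Holds, NatExpr.eval, h1.nat2] using h)
    · rintro ⟨-, h, -⟩
      exact b2 (by simpa only [Test.Holds, NatExpr.eval, h1.nat1] using h)
    · rintro ⟨h, -, -⟩
      exact b1 (by simp only [Test.Holds, NatExpr.eval, RealExpr.eval, h1.real0, h, Nat.cast_zero,
        le_refl])
  refine ends_seq (key.mono ?_)
  rintro s' ⟨r, hr, hr'⟩
  refine ends_setReal ⟨r, hr, ?_⟩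
  simpa only [Store.output, NatExpr.eval, RealExpr.eval, Function.update_self] using hr'

end RealRAM

/-! ### The number of iterations -/

namespace RealRAM

open ListRecovery

/-- A bound for the numbers of iterations of the loops of `thresholdProgram`. -/
noncomputable def iterationBound (q L : ℕ) (p ε : ℝ) : ℕ :=
  indexBase q L ^ 4 + (q * L + ⌈max 0 (Real.logb 2 (1 / ε))⌉₊ + ⌈logInv p⌉₊ + 3)

theorem logInv_nonneg {p : ℝ} (hp : 0 ≤ p) (hp1 : p ≤ 1) : 0 ≤ logInv p := by
  unfold logInv
  split_ifs with h
  · exact zero_le_one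
  · exact Real.logb_nonneg (by norm_num) (one_le_one_div (lt_of_le_of_ne hp (Ne.symm h)) hp1)

theorem one_div_le_two_pow {x : ℝ} {n : ℕ} (hx : 0 < x) (h : Real.logb 2 (1 / x) ≤ n) :
    1 ≤ x * 2 ^ n := by
  rw [Real.logb_le_iff_le_rpow (by norm_num) (by positivity), Real.rpow_natCast] at h
  rw [mul_comm]
  exact (div_le_iff₀ hx).1 h

/-- The summands of the bound are exponents of 2: 2^(q L) dominates q^L, the two ceilings dominate 1
/ ε and 1 / p, and the final 3 gives a factor 8 that covers the constant 4 and the strict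
inequalities. -/
theorem iterationBound_spec {q L : ℕ} {p ε : ℝ} (hε : 0 < ε) :
    (q : ℝ) ^ L < 2 ^ iterationBound q L p ε ∧ 4 ≤ ε * 2 ^ iterationBound q L p ε ∧
      (0 < p → 4 * (q : ℝ) ^ L ≤ p * ε * 2 ^ iterationBound q L p ε ∧
        (q : ℝ) ^ L < p * 2 ^ iterationBound q L p ε) := by
  set a := ⌈max 0 (Real.logb 2 (1 / ε))⌉₊ with ha
  set b := ⌈logInv p⌉₊ with hb
  have hq : (q : ℝ) ^ L ≤ 2 ^ (q * L) := by
    rw [pow_mul]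
    gcongr
    exact_mod_cast Nat.lt_two_pow_self.le
  have hε' : 1 ≤ ε * 2 ^ a :=
    one_div_le_two_pow hε ((le_max_right _ _).trans (Nat.le_ceil _))
  have h2 : ∀ n : ℕ, (1 : ℝ) ≤ 2 ^ n := fun n => one_le_pow₀ (by norm_num)
  have hY : (8 : ℝ) * 2 ^ (q * L) * 2 ^ a * 2 ^ b ≤ 2 ^ iterationBound q L p ε := by
    have h8 : (8 : ℝ) = 2 ^ 3 := by norm_num
    rw [h8, ← pow_add, ← pow_add, ← pow_add]
    refine pow_le_pow_right₀ (by norm_num) ?_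
    unfold iterationBound
    omega
  have hq0 := h2 (q * L)
  have hab := h2 b
  have haa := h2 a
  refine ⟨?_, ?_, fun hp => ?_⟩
  · have h3 : (q : ℝ) ^ L * 1 * 1 ≤ 2 ^ (q * L) * 2 ^ a * 2 ^ b := by gcongr
    have h4 : (0 : ℝ) < 2 ^ (q * L) * 2 ^ a * 2 ^ b := by positivity
    linarith
  · have h1 : (8 : ℝ) ≤ ε * (8 * 2 ^ (q * L) * 2 ^ a * 2 ^ b) := by
      have : ε * (8 * 2 ^ (q * L) * 2 ^ a * 2 ^ b) = 8 * (ε * 2 ^ a) * 2 ^ (q * L) * 2 ^ b := by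
        ring
      rw [this]
      have h3 : (8 : ℝ) * 1 * 1 * 1 ≤ 8 * (ε * 2 ^ a) * 2 ^ (q * L) * 2 ^ b := by gcongr
      linarith
    have := mul_le_mul_of_nonneg_left hY hε.le
    linarith
  · have hp' : 1 ≤ p * 2 ^ b := by
      refine one_div_le_two_pow hp (le_trans (le_of_eq ?_) (Nat.le_ceil (logInv p)))
      rw [logInv, if_neg hp.ne']
    constructor
    · have h1 := mul_le_mul_of_nonneg_left hY (mul_pos hp hε).le
      have e : p * ε * (8 * 2 ^ (q * L) * 2 ^ a * 2 ^ b) =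
        8 * 2 ^ (q * L) * (ε * 2 ^ a) * (p * 2 ^ b) := by ring
      rw [e] at h1
      have h3 : 4 * (q : ℝ) ^ L * 1 * 1 ≤ 8 * 2 ^ (q * L) * (ε * 2 ^ a) * (p * 2 ^ b) := by
        gcongr; norm_num
      linarith
    · have h1 := mul_le_mul_of_nonneg_left hY hp.le
      have e : p * (8 * 2 ^ (q * L) * 2 ^ a * 2 ^ b) =
        8 * 2 ^ (q * L) * 2 ^ a * (p * 2 ^ b) := by ring
      rw [e] at h1
      have h3 : 8 * (q : ℝ) ^ L * 1 * 1 ≤ 8 * 2 ^ (q * L) * 2 ^ a * (p * 2 ^ b) := by gcongr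
      have h4 : 0 ≤ (q : ℝ) ^ L := by positivity
      rcases h4.eq_or_lt with h5 | h5
      · rw [← h5]; positivity
      · linarith

/-- With X the sum of the parameters, the base is at most 2 X^2, so the table accounts for 16 X^8;
since X ≥ 3, the remaining terms fit into 4 X^8. -/
theorem iterationBound_le {q L : ℕ} {p ε : ℝ} (hq : 2 ≤ q) (hL : 1 ≤ L) (hp : 0 ≤ p)
    (hp1 : p ≤ 1) : (iterationBound q L p ε : ℝ) + 1 ≤
      20 * ((q : ℝ) + L + max 0 (Real.logb 2 (1 / ε)) + logInv p) ^ 8 := by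
  set a := max 0 (Real.logb 2 (1 / ε)) with ha
  set b := logInv p with hb
  have ha0 : 0 ≤ a := le_max_left _ _
  have hb0 : 0 ≤ b := logInv_nonneg hp hp1
  have hq' : (2 : ℝ) ≤ q := by exact_mod_cast hq
  have hL' : (1 : ℝ) ≤ L := by exact_mod_cast hL
  set X := (q : ℝ) + L + a + b with hX
  have hX3 : 3 ≤ X := by linarith
  have hXX : 3 * X ≤ X ^ 2 := by rw [sq]; gcongr
  have hqX : (q : ℝ) ≤ X := by linarith
  have hLX : (L : ℝ) ≤ X := by linarith
  have hqL : (q : ℝ) * L ≤ X ^ 2 := by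
    rw [sq]; gcongr
  have h1 : (indexBase q L : ℝ) ≤ 2 * X ^ 2 := by
    unfold indexBase
    push_cast
    linarith
  have h2 : (indexBase q L : ℝ) ^ 4 ≤ 16 * X ^ 8 := by
    calc (indexBase q L : ℝ) ^ 4 ≤ (2 * X ^ 2) ^ 4 := by gcongr
      _ = 16 * X ^ 8 := by ring
  have h3 : (⌈a⌉₊ : ℝ) ≤ a + 1 := (Nat.ceil_lt_add_one ha0).le
  have h4 : (⌈b⌉₊ : ℝ) ≤ b + 1 := (Nat.ceil_lt_add_one hb0).le
  have h5 : X ^ 2 ≤ X ^ 8 := pow_le_pow_right₀ (by linarith) (by norm_num)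
  have h6 : 2 * X + 6 ≤ 2 * X ^ 2 := by linarith
  have h7 : 0 ≤ X ^ 8 := by positivity
  unfold iterationBound
  push_cast
  linarith

end RealRAM

theorem corollary7p4 :
    ∃ (A : RealRAM.Program) (c : ℝ) (k : ℕ),
      ∀ (q ℓ L : ℕ) (p ε : ℝ), 2 ≤ q → 1 ≤ ℓ → ℓ ≤ q → 1 ≤ L → 0 ≤ p → p ≤ 1 → 0 < ε →
        ∃ (t : ℕ) (s : RealRAM.Store) (Rstar : ℝ),
          RealRAM.Exec A (RealRAM.input q ℓ L p ε) t s ∧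
          (t : ℝ) ≤ c * (((L : ℝ) + 1) ^ q +
            ((q : ℝ) + L + max 0 (Real.logb 2 (1 / ε)) + ListRecovery.logInv p) ^ k) ∧
          ListRecovery.IsThresholdRate (ListRecovery.NotListRecoverable q p ℓ L) Rstar ∧
          |s.output - Rstar| ≤ ε := by
  obtain ⟨c, k, hck⟩ := RealRAM.thresholdProgram.bound_le_pow
  refine ⟨RealRAM.thresholdProgram, c * 20 ^ k, 8 * k, ?_⟩
  intro q ℓ L p ε hq hℓ hℓq hL hp hp1 hε
  obtain ⟨h1, h2, h3⟩ := RealRAM.iterationBound_spec (q := q) (L := L) (p := p) hε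
  obtain ⟨t, s, hexec, ht, r, hr, hs⟩ := RealRAM.ends_thresholdProgram hq hℓ hℓq hL hp hp1 hε
    (Nat.le_add_right _ _) (fun h => (h3 h).1) h1 (fun h => (h3 h).2) h2
  refine ⟨t, s, r, hexec, ?_, hr, hs⟩
  have h4 : (t : ℝ) ≤ c * ((RealRAM.iterationBound q L p ε : ℝ) + 1) ^ k := by
    exact_mod_cast ht.trans (hck _)
  refine h4.trans ?_
  calc (c : ℝ) * ((RealRAM.iterationBound q L p ε : ℝ) + 1) ^ k
      ≤ c * (20 * ((q : ℝ) + L + max 0 (Real.logb 2 (1 / ε)) + ListRecovery.logInv p) ^ 8) ^ k := by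
        gcongr
        exact RealRAM.iterationBound_le hq hL hp hp1
    _ = c * 20 ^ k *
        ((q : ℝ) + L + max 0 (Real.logb 2 (1 / ε)) + ListRecovery.logInv p) ^ (8 * k) := by
        rw [mul_pow, ← pow_mul, mul_assoc]
    -- The polynomial term alone bounds the running time; the exponential term is nonnegative and is
    -- merely added.
    _ ≤ _ := by
        gcongr
        exact le_add_of_nonneg_left (by positivity)
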